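/- **Setting.** Let $A\in\mathbb R^{m\times m}$, $B\in\mathbb R^{m\times n}$, let $Q\in\mathbb R^{m\times m}$, $R\in\mathbb R^{n\times n}$ be symmetric positive definite, let $0<\gamma\le 1$, and let $\mathcal D_0$ be a probability distribution on $\mathbb R^m$ with $\mathbb E[v]=0$, $\mathbb E[vv^\top]=I$ and $\|v\|_2^2\le C_m$ almost surely. For a policy $K\in\mathbb R^{n\times m}$ and an initial state $s_0$ put $s_{t+1}=As_t+Bu_t$, $u_t=-Ks_t$, $$\mathcal C(K;s_0)=\sum_{t\ge0}\gamma^t\big(s_t^\top Qs_t+u_t^\top Ru_t\big)\in[0,\infty],\qquad \mathcal C(K)=\mathbb E_{s_0\sim\mathcal D_0}\,\mathcal C(K;s_0).$$ Let $\mathrm{dom}=\{K:\mathcal C(K)<\infty\}$, $K_0\in\mathrm{dom}$, and $D=mn$; policies carry the Frobenius norm and inner product. **Algorithm.** One *zero-order evaluation* at $K$ returns $\mathcal C(K;s_0)$ for a fresh $s_0\sim\mathcal D_0$. With step size $\eta$, smoothing radius $r$ and minibatch size $k$, the algorithm iterates $$K_{t+1}=K_t-\frac{\eta}{k}\sum_{i=1}^k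 \mathcal C(K_t+ru_{t,i};s_{t,i})\,\frac{D}{r}\,u_{t,i},$$ where the $u_{t,i}$ (uniform on the unit sphere of $\mathbb R^{n\times m}$) and the $s_{t,i}\sim\mathcal D_0$ are all independent. Running $T$ iterations uses $kT$ zero-order evaluations. **Curvature parameters.** Let $K^*$ be a global minimizer of $\mathcal C$, $\Delta_0=\mathcal C(K_0)-\mathcal C(K^*)$ and $\mathcal G=\{K\in\mathrm{dom}:\mathcal C(K)-\mathcal C(K^*)\le10\Delta_0\}$. *Valid local parameters* are positive numbers $\phi_K,\beta_K,\lambda_K,\zeta_K$ ($K\in\mathcal G$) such that for all $K\in\mathcal G$, $K'\in\mathrm{dom}$: $\|\nabla\mathcal C(K')-\nabla\mathcal C(K)\|\le\phi_K\|K'-K\|$ if $\|K'-K\|\le\beta_K$, and $|\mathcal C(K')-\mathcal C(K)|\le\lambda_K\|K'-K\|$ if $\|K'-K\|\le\zeta_K$; and such that $\phi=\sup_{\mathcal G}\phi_K<\infty$, $\lambda=\sup_{\mathcal G}\lambda_K<\infty$, $\rho=\inf_{\mathcal G}\min\{\beta_K,\zeta_K\}>0$. Put $\theta=\min\{\frac1{2\phi},\frac\rho\lambda\}$.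 A *PL constant* is a $\mu>0$ with $\|\nabla\mathcal C(K)\|^2\ge\mu(\mathcal C(K)-\mathcal C(K^*))$ for all $K\in\mathrm{dom}$. **Claim.** A global minimizer exists. For each global minimizer $K^*$: the set $\mathrm{dom}$ is open, $\mathcal C$ is $C^1$ on it, valid local parameters and a PL constant exist; and for all valid local parameters, every PL constant $\mu$ and every $$0<\eta\le\min\Big\{1,\frac1{8\phi},\frac{\rho}{\frac{\sqrt\mu}{32}+\phi+\lambda}\Big\}$$ the following two statements hold. (1) Let $0<\epsilon<\min\{1,\frac1\mu,\rho^2\}\frac{\Delta_0}{10}$, let $$0<r\le\min\Big\{\rho,\ \frac1\rho,\ \frac1{8\phi}\min\Big\{\theta\mu\sqrt{\tfrac{\epsilon}{240}},\ \min\{1,\tfrac1\phi\}\sqrt{\tfrac{\epsilon\mu}{30}}\Big\}\Big\},$$ let $0<\delta<1$, and let $k,T$ be integers with $$k\ge\Big(C_m\frac Dr\Big(10\,\mathcal C(K_0)+\frac\lambda\rho\Big)\sqrt{\log\tfrac{2D}\delta}\Big)^2\frac{1024}{\mu\epsilon},\qquad T\ge\frac{8}{\eta\mu}\log\frac{2\Delta_0}{\epsilon}.$$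 Then, with probability exceeding $1-T\delta$, all $kT$ zero-order evaluations are finite and $\mathcal C(K_T)-\mathcal C(K^*)\le\epsilon$. (2) The total number of evaluations is $\widetilde O(\epsilon^{-2})$, with the step size $\eta$ independent of $\epsilon$: there are $C,\epsilon_0>0$ (depending on the problem, $K_0$, the chosen parameters and $\eta$, but not on $\epsilon$ or $\delta'$) such that for all $\epsilon\in(0,\epsilon_0)$ in the range of (1) and all $\delta'\in(0,1)$ there are $r,k,T$ satisfying the conditions of (1) with $\delta=\delta'/T$, for which $$k\,T\le C\,\epsilon^{-2}\log\tfrac1\epsilon\,\big(\log\log\tfrac1\epsilon+\log\tfrac1{\delta'}\big),$$ and the conclusion of (1) holds with probability exceeding $1-\delta'$. -/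

import Mathlib

open MeasureTheory ProbabilityTheory
open scoped ENNReal

universe u

noncomputable section

/-! ### Local regularity of a function `g` on a domain `S` -/

section Regularity

variable {E : Type*} [NormedAddCommGroup E] [InnerProductSpace ℝ E] [CompleteSpace E]

/-- `g`, with domain `S`, has `(φ, β)` locally Lipschitz gradients at `x`. -/
def HasLocallyLipschitzGradientAt (g : E → ℝ) (S : Set E) (φ β : ℝ) (x : E) : Prop :=
  ∀ y ∈ S, ‖y - x‖ ≤ β → ‖gradient g y - gradient g x‖ ≤ φ * ‖y - x‖

/-- `g`, with domain `S`, is `(lam, ζ)` locally Lipschitz at `x`. -/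
def IsLocallyLipschitzAt (g : E → ℝ) (S : Set E) (lam ζ : ℝ) (x : E) : Prop :=
  ∀ y ∈ S, ‖y - x‖ ≤ ζ → |g y - g x| ≤ lam * ‖y - x‖

/-- `g`, with domain `S` and minimum value `gstar`, is `μ`-PL (Polyak-Lojasiewicz). -/
def IsPL (g : E → ℝ) (S : Set E) (gstar μ : ℝ) : Prop :=
  0 < μ ∧ ∀ x ∈ S, μ * (g x - gstar) ≤ ‖gradient g x‖ ^ 2

end Regularity

/-! ### The randomly initialized linear quadratic regulator -/

/-- State vectors. -/
abbrev LQRState (m : ℕ) : Type := Fin m → ℝ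

/-- Linear policies, that is `n × m` matrices `K` (control dimension `n`, state dimension `m`),
with the Frobenius norm and inner product. -/
abbrev Policy (m n : ℕ) : Type := EuclideanSpace ℝ (Fin n × Fin m)

/-- The matrix of a policy. -/
def Policy.toMatrix {m n : ℕ} (K : Policy m n) : Matrix (Fin n) (Fin m) ℝ :=
  Matrix.of fun i j => K (i, j)

/-- A discounted, randomly initialized LQR problem: dynamics `x_{t+1} = A x_t + B u_t`, stage cost
`γ ^ t (x_tᵀ Q x_t + u_tᵀ R u_t)`, and an initial state of mean zero and identity covariance whose
squared Euclidean norm is almost surely at most `Cm`. -/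
structure LQR (m n : ℕ) where
  A : Matrix (Fin m) (Fin m) ℝ
  B : Matrix (Fin m) (Fin n) ℝ
  Q : Matrix (Fin m) (Fin m) ℝ
  R : Matrix (Fin n) (Fin n) ℝ
  Q_posDef : Q.PosDef
  R_posDef : R.PosDef
  γ : ℝ
  γ_pos : 0 < γ
  γ_le_one : γ ≤ 1
  init : Measure (LQRState m)
  init_prob : IsProbabilityMeasure init
  init_mean : ∀ i, ∫ v, v i ∂init = 0
  init_cov : ∀ i j, ∫ v, v i * v j ∂init = if i = j then 1 else 0
  Cm : ℝ
  init_bound : ∀ᵐ v ∂init, ∑ i, v i ^ 2 ≤ Cm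

namespace LQR

variable {m n : ℕ} (L : LQR m n)

/-- The state at time `t` when the policy `u_t = - K x_t` is run from the state `s`. -/
def state (K : Policy m n) (s : LQRState m) : ℕ → LQRState m
  | 0 => s
  | t + 1 => L.A.mulVec (state K s t) + L.B.mulVec (-(K.toMatrix.mulVec (state K s t)))

/-- The control at time `t`. -/
def control (K : Policy m n) (s : LQRState m) (t : ℕ) : Fin n → ℝ :=
  -(K.toMatrix.mulVec (L.state K s t))

/-- The sample cost `C(K; s)`, with values in `[0, ∞]`. -/
def sampleCost (K : Policy m n) (s : LQRState m) : ℝ≥0∞ :=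
  ∑' t : ℕ, ENNReal.ofReal (L.γ ^ t *
    (L.state K s t ⬝ᵥ L.Q.mulVec (L.state K s t) +
      L.control K s t ⬝ᵥ L.R.mulVec (L.control K s t)))

/-- The population cost `C(K)`, with values in `[0, ∞]`. -/
def cost (K : Policy m n) : ℝ≥0∞ := ∫⁻ s, L.sampleCost K s ∂L.init

/-- The domain of the population cost: the policies of finite cost. -/
def domain : Set (Policy m n) := {K | L.cost K < ∞}

/-- The population cost as a real function, meaningful on `L.domain`. -/
def realCost (K : Policy m n) : ℝ := (L.cost K).toReal

/-- `Kstar` is a globally optimal policy. -/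
def IsOptimal (Kstar : Policy m n) : Prop := ∀ K, L.cost Kstar ≤ L.cost K

/-- The initial gap to optimality, `Δ₀`. -/
def gap (K₀ Kstar : Policy m n) : ℝ := L.realCost K₀ - L.realCost Kstar

/-- The policies whose cost gap is at most ten times the initial cost gap. -/
def boundedSet (K₀ Kstar : Policy m n) : Set (Policy m n) :=
  {K | K ∈ L.domain ∧ L.realCost K - L.realCost Kstar ≤ 10 * L.gap K₀ Kstar}

end LQR

/-! ### Local curvature parameters and their uniform versions -/

/-- A choice, for each policy `K`, of a smoothness constant `φ K` with its radius `β K`, and of a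
Lipschitz constant `lam K` with its radius `ζ K`. -/
structure CurvatureParams (m n : ℕ) where
  φ : Policy m n → ℝ
  β : Policy m n → ℝ
  lam : Policy m n → ℝ
  ζ : Policy m n → ℝ

namespace CurvatureParams

variable {m n : ℕ} (c : CurvatureParams m n)

/-- The supremum of the smoothness constants over `G`. -/
def phi (G : Set (Policy m n)) : ℝ := sSup (c.φ '' G)

/-- The supremum of the Lipschitz constants over `G`. -/
def lambda (G : Set (Policy m n)) : ℝ := sSup (c.lam '' G)

/-- The infimum over `G` of the radii on which both local properties hold. -/
def rho (G : Set (Policy m n)) : ℝ := sInf ((fun K => min (c.β K) (c.ζ K)) '' G)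

/-- The functional `θ = min {1 / (2 φ), ρ / λ}` of the curvature parameters. -/
def theta (G : Set (Policy m n)) : ℝ := min (1 / (2 * c.phi G)) (c.rho G / c.lambda G)

/-- `c` consists of positive local parameters which are correct for the cost of `L` at every policy
of `G`, and whose uniform versions over `G` are finite and positive. -/
structure IsValid (L : LQR m n) (G : Set (Policy m n)) : Prop where
  pos : ∀ K ∈ G, 0 < c.φ K ∧ 0 < c.β K ∧ 0 < c.lam K ∧ 0 < c.ζ K
  smooth : ∀ K ∈ G, HasLocallyLipschitzGradientAt L.realCost L.domain (c.φ K) (c.β K) K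
  lipschitz : ∀ K ∈ G, IsLocallyLipschitzAt L.realCost L.domain (c.lam K) (c.ζ K) K
  phi_finite : BddAbove (c.φ '' G)
  lambda_finite : BddAbove (c.lam '' G)
  rho_pos : 0 < c.rho G

end CurvatureParams

/-! ### The minibatch algorithm with one-point feedback -/

/-- The uniform distribution on the unit (Frobenius) sphere of the space of policies. -/
def unifSphere (m n : ℕ) : Measure (Policy m n) :=
  (ProbabilityTheory.cond (volume : Measure (Policy m n)).toSphere Set.univ).map Subtype.val

namespace LQR

variable {m n : ℕ} (L : LQR m n)

/-- The one-point gradient estimate `C(K + r u; s) (D / r) u`, where `D = m n`. It uses one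
evaluation of the sample cost. -/
def onePointEstimate (r : ℝ) (K u : Policy m n) (s : LQRState m) : Policy m n :=
  ((L.sampleCost (K + r • u) s).toReal * (((m * n : ℕ) : ℝ) / r)) • u

/-- The average of `k` one-point estimates. -/
def minibatchEstimate (r : ℝ) (k : ℕ) (K : Policy m n) (u : ℕ → Policy m n)
    (s : ℕ → LQRState m) : Policy m n :=
  (1 / (k : ℝ)) • ∑ i ∈ Finset.range k, L.onePointEstimate r K (u i) (s i)

/-- The iterates of the minibatch algorithm; the `i`-th evaluation of iteration `t` uses the
direction `U t i` and the initial state `S t i`. -/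
def iterate (η r : ℝ) (k : ℕ) (K₀ : Policy m n) (U : ℕ → ℕ → Policy m n)
    (S : ℕ → ℕ → LQRState m) : ℕ → Policy m n
  | 0 => K₀
  | t + 1 => iterate η r k K₀ U S t -
      η • L.minibatchEstimate r k (iterate η r k K₀ U S t) (U t) (S t)

/-- The pairs `(U t i, S t i)` are independent, and in each of them the direction is uniform on the
sphere, the initial state has the law of the problem, and the two are independent. -/
def IsSampling {Ω : Type u} [MeasurableSpace Ω] (P : Measure Ω)
    (U : ℕ → ℕ → Ω → Policy m n) (S : ℕ → ℕ → Ω → LQRState m) : Prop :=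
  (∀ t i, HasLaw (fun ω => (U t i ω, S t i ω)) ((unifSphere m n).prod L.init) P) ∧
  iIndepFun (fun (p : ℕ × ℕ) (ω : Ω) => (U p.1 p.2 ω, S p.1 p.2 ω)) P

/-- With probability exceeding `p`, all the sample costs evaluated by the algorithm in `T`
iterations with minibatches of size `k` (there are `k * T` of them) are finite, and the output
`K_T` satisfies `C(K_T) - C(Kstar) ≤ ε`. -/
def Achieves (K₀ Kstar : Policy m n) (η r : ℝ) (k T : ℕ) (ε p : ℝ) : Prop :=
  ∀ (Ω : Type u) [MeasurableSpace Ω] (P : Measure Ω) [IsProbabilityMeasure P]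
    (U : ℕ → ℕ → Ω → Policy m n) (S : ℕ → ℕ → Ω → LQRState m),
    L.IsSampling P U S →
    p < P.real {ω |
      (∀ t < T, ∀ i < k, L.sampleCost
        (L.iterate η r k K₀ (fun t i => U t i ω) (fun t i => S t i ω) t + r • U t i ω)
        (S t i ω) < ∞) ∧
      L.cost (L.iterate η r k K₀ (fun t i => U t i ω) (fun t i => S t i ω) T)
        ≤ L.cost Kstar + ENNReal.ofReal ε}

end LQR

/-! ### The parameter choices -/

/-- The largest admissible error tolerance. -/
def maxTolerance (rho μ gap : ℝ) : ℝ := min 1 (min (1 / μ) (rho ^ 2)) * (gap / 10)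

/-- The largest admissible step size. -/
def maxStepSize (phi lam rho μ : ℝ) : ℝ :=
  min 1 (min (1 / (8 * phi)) (rho / (Real.sqrt μ / 32 + phi + lam)))

/-- The largest admissible smoothing radius. -/
def maxRadius (phi rho theta μ ε : ℝ) : ℝ :=
  min (min rho (1 / rho))
    (1 / (8 * phi) * min (theta * μ * Real.sqrt (ε / 240))
      (min 1 (1 / phi) * Real.sqrt (ε * μ / 30)))

/-- The minibatch size, as a real number; `D` is the dimension, `c₀` the initial cost. -/
def batchSize (Cm D c₀ lam rho μ r δ ε : ℝ) : ℝ :=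
  (Cm * (D / r) * (10 * c₀ + lam / rho) * Real.sqrt (Real.log (2 * D / δ))) ^ 2 *
    (1024 / (μ * ε))

/-- The number of iterations, as a real number. -/
def numIterations (η μ gap ε : ℝ) : ℝ := 8 / (η * μ) * Real.log (2 * gap / ε)

end

noncomputable section

open scoped Matrix Matrix.Norms.Frobenius

/-! ### Real matrices with the Frobenius norm -/

section MatrixFacts

variable {l m : ℕ}

/-! Put `M = √γ (A - B K)` and `W = Q + Kᵀ R K`. Since the initial covariance is the identity, the
cost is the trace of `W Σ_K`, where `Σ_K = ∑ M^t (M^t)ᵀ`. The cost is finite exactly when some power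
of `M` is a contraction (`mem_domain_iff`), which is an open condition. There `Σ_K` is `(1 - (X ↦ M
X Mᵀ))⁻¹ 1`, so the cost is smooth because inversion is.

The exact cost difference in `exists_performance_difference` is quadratic in the policy difference,
with the covariance of the second policy as weight. Its linear part gives the gradient, and
completing the square gives the PL inequality (`gradient_domination`). On the whole policy space the
cost is lower semicontinuous and dominates a multiple of `‖K‖²`. Its sublevel sets are therefore
compact, and this yields a minimizer and uniform curvature parameters.

For the algorithm, a sample cost is at most `‖s‖²` times the population cost, so one-point estimates
are almost surely bounded while the smoothing ball stays in the domain. Averaging over the initial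
state leaves `(D / r) E[C(K + r u) u]`. By the divergence theorem this is the mean gradient over the
ball, hence within `φ r` of the gradient (`norm_integral_onePointEstimate_sub_le`). The minibatch
mean concentrates by a dimension-free Hoeffding inequality (`measureReal_norm_sum_ge_le`), obtained
from the exponential moment `E cosh (l ‖S‖)`.

A minibatch is independent of the iterate at which it is used. Fubini therefore transfers the bound
from fixed policies to the random iterate (`measure_stage_error_le`). If every squared gradient
error is at most `μ ε / 2`, the gap contracts by `1 - η μ / 2` up to an additive `η μ ε / 4`. It
then never exceeds its initial value and ends below `ε` (`inexact_gradient_descent`). The step may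
leave the region where smoothness is known, so descent is proved by continuation along the segment
(`inexact_gradient_step`). Each stage fails with probability at most `δ / 2`, and a union bound over
`T` stages concludes. Taking `r` proportional to `√ε` makes the batch size of order `ε⁻²`, up to the
logarithm of the failure probability. -/

theorem frobenius_sq_eq_trace (X : Matrix (Fin l) (Fin m) ℝ) :
    ‖X‖ ^ 2 = (X * Xᵀ).trace := by
  rw [Matrix.frobenius_norm_def, ← Real.sqrt_eq_rpow, Real.sq_sqrt (by positivity)]
  simp [Matrix.trace, Matrix.mul_apply, sq]

theorem frobenius_sq_eq_trace' (X : Matrix (Fin l) (Fin m) ℝ) :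
    ‖X‖ ^ 2 = (Xᵀ * X).trace := by
  rw [frobenius_sq_eq_trace, Matrix.trace_mul_comm]

theorem posSemidef_exists_transpose_mul {X : Matrix (Fin m) (Fin m) ℝ} (hX : X.PosSemidef) :
    ∃ Z : Matrix (Fin m) (Fin m) ℝ, X = Zᵀ * Z := by
  open scoped MatrixOrder in
  obtain ⟨Z, hZ⟩ := CStarAlgebra.nonneg_iff_eq_star_mul_self.mp hX.nonneg
  exact ⟨Z, by rw [hZ, Matrix.star_eq_conjTranspose, Matrix.conjTranspose_eq_transpose_of_trivial]⟩

theorem posSemidef_transpose_mul_mul {X : Matrix (Fin m) (Fin m) ℝ} (hX : X.PosSemidef)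
    (Y : Matrix (Fin m) (Fin l) ℝ) : (Yᵀ * X * Y).PosSemidef := by
  simpa [Matrix.conjTranspose_eq_transpose_of_trivial] using hX.conjTranspose_mul_mul_same Y

theorem posSemidef_mul_mul_transpose {X : Matrix (Fin m) (Fin m) ℝ} (hX : X.PosSemidef)
    (Y : Matrix (Fin l) (Fin m) ℝ) : (Y * X * Yᵀ).PosSemidef := by
  simpa [Matrix.conjTranspose_eq_transpose_of_trivial] using hX.mul_mul_conjTranspose_same Y

/-- Factor `X = Zᵀ Z`; by cyclicity the trace is that of `Z Y Zᵀ`. -/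
theorem trace_mul_nonneg_of_posSemidef {X Y : Matrix (Fin m) (Fin m) ℝ} (hX : X.PosSemidef)
    (hY : Y.PosSemidef) : 0 ≤ (X * Y).trace := by
  obtain ⟨Z, rfl⟩ := posSemidef_exists_transpose_mul hX
  rw [Matrix.mul_assoc, Matrix.trace_mul_comm]
  exact (posSemidef_mul_mul_transpose hY Z).trace_nonneg

/-- The constant is the minimum of the quadratic form on the compact unit sphere, extended by
homogeneity. -/
theorem exists_pos_mul_dotProduct_le {X : Matrix (Fin m) (Fin m) ℝ} (hX : X.PosDef) :
    ∃ q : ℝ, 0 < q ∧ (X - q • (1 : Matrix (Fin m) (Fin m) ℝ)).PosSemidef := by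
  suffices h : ∃ q : ℝ, 0 < q ∧ ∀ x : Fin m → ℝ, q * (x ⬝ᵥ x) ≤ x ⬝ᵥ X.mulVec x by
    obtain ⟨q, hq, h⟩ := h
    refine ⟨q, hq, Matrix.PosSemidef.of_dotProduct_mulVec_nonneg
      (hX.isHermitian.sub (by simp [Matrix.IsHermitian])) fun x => ?_⟩
    have := h x
    simp only [Matrix.sub_mulVec, Matrix.smul_mulVec, Matrix.one_mulVec, dotProduct_sub,
      dotProduct_smul, smul_eq_mul, star_trivial]
    linarith
  have hcont : Continuous fun x : EuclideanSpace ℝ (Fin m) => x.ofLp ⬝ᵥ X.mulVec x.ofLp := by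
    fun_prop
  have hcp : IsCompact (Metric.sphere (0 : EuclideanSpace ℝ (Fin m)) 1) := isCompact_sphere _ _
  have hn : ∀ x : EuclideanSpace ℝ (Fin m), ‖x‖ ^ 2 = x.ofLp ⬝ᵥ x.ofLp := by
    intro x
    rw [EuclideanSpace.norm_sq_eq]
    simp [dotProduct, sq]
  -- An empty sphere means dimension zero, where any constant works.
  rcases (Metric.sphere (0 : EuclideanSpace ℝ (Fin m)) 1).eq_empty_or_nonempty with h0 | h0
  · refine ⟨1, one_pos, fun x => ?_⟩
    have hx : x = 0 := by
      by_contra hx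
      have hx' : (WithLp.toLp 2 x : EuclideanSpace ℝ (Fin m)) ≠ 0 := by
        simpa using hx
      have : (‖(WithLp.toLp 2 x : EuclideanSpace ℝ (Fin m))‖⁻¹ •
          (WithLp.toLp 2 x : EuclideanSpace ℝ (Fin m))) ∈
          Metric.sphere (0 : EuclideanSpace ℝ (Fin m)) 1 := by
        simp [norm_smul, norm_ne_zero_iff.2 hx']
      rw [h0] at this
      exact this
    simp [hx]
  · obtain ⟨y, hy, hmin⟩ := hcp.exists_isMinOn h0 hcont.continuousOn
    have hy0 : y.ofLp ≠ 0 := by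
      intro h
      have : y = 0 := by ext i; exact congrFun h i
      simp [this] at hy
    refine ⟨_, by simpa using hX.dotProduct_mulVec_pos hy0, fun x => ?_⟩
    by_cases hx : x = 0
    · simp [hx]
    set z : EuclideanSpace ℝ (Fin m) := WithLp.toLp 2 x with hz
    have hz0 : z ≠ 0 := by simpa [hz] using hx
    have hnz : ‖z‖ ≠ 0 := norm_ne_zero_iff.2 hz0
    have hmem : ‖z‖⁻¹ • z ∈ Metric.sphere (0 : EuclideanSpace ℝ (Fin m)) 1 := by
      simp [norm_smul, hnz]
    have h1 : y.ofLp ⬝ᵥ X.mulVec y.ofLp ≤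
        (‖z‖⁻¹ • z).ofLp ⬝ᵥ X.mulVec (‖z‖⁻¹ • z).ofLp := hmin hmem
    have h2 : (‖z‖⁻¹ • z).ofLp ⬝ᵥ X.mulVec (‖z‖⁻¹ • z).ofLp
        = (‖z‖ ^ 2)⁻¹ * (x ⬝ᵥ X.mulVec x) := by
      rw [WithLp.ofLp_smul, Matrix.mulVec_smul, dotProduct_smul, smul_dotProduct, smul_eq_mul,
        smul_eq_mul, ← mul_assoc]
      congr 1
      ring
    rw [h2] at h1
    have h3 : x ⬝ᵥ x = ‖z‖ ^ 2 := (hn z).symm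
    rw [h3]
    have h4 : (0:ℝ) < ‖z‖ ^ 2 := by positivity
    calc (y.ofLp ⬝ᵥ X.mulVec y.ofLp) * ‖z‖ ^ 2
        ≤ (‖z‖ ^ 2)⁻¹ * (x ⬝ᵥ X.mulVec x) * ‖z‖ ^ 2 := by gcongr
      _ = x ⬝ᵥ X.mulVec x := by field_simp

/-- Factor `X = Zᵀ Z` and apply Cauchy–Schwarz to each row of `Z`. -/
theorem dotProduct_mulVec_le_mul_trace {X : Matrix (Fin m) (Fin m) ℝ} (hX : X.PosSemidef)
    (s : Fin m → ℝ) : s ⬝ᵥ X.mulVec s ≤ (∑ i, s i ^ 2) * X.trace := by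
  obtain ⟨Z, rfl⟩ := posSemidef_exists_transpose_mul hX
  have h1 : s ⬝ᵥ (Zᵀ * Z).mulVec s = ∑ i, (∑ j, Z i j * s j) ^ 2 := by
    rw [← Matrix.mulVec_mulVec, Matrix.dotProduct_mulVec, Matrix.vecMul_transpose]
    simp [dotProduct, Matrix.mulVec, sq]
  have h2 : (Zᵀ * Z).trace = ∑ i, ∑ j, Z i j ^ 2 := by
    simp only [Matrix.trace, Matrix.diag, Matrix.mul_apply, Matrix.transpose_apply]
    rw [Finset.sum_comm]
    simp [sq]
  rw [h1, h2, Finset.mul_sum]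
  refine Finset.sum_le_sum fun i _ => ?_
  rw [mul_comm]
  exact Finset.sum_mul_sq_le_sq_mul_sq _ _ _

/-- Square matrices as a normed algebra, with the Frobenius norm and its topology. -/
def FrobeniusMatrix (m : ℕ) : Type := Matrix (Fin m) (Fin m) ℝ

namespace FrobeniusMatrix

variable {m : ℕ}

instance : NormedRing (FrobeniusMatrix m) :=
  inferInstanceAs (NormedRing (Matrix (Fin m) (Fin m) ℝ))
instance : NormedAlgebra ℝ (FrobeniusMatrix m) :=
  inferInstanceAs (NormedAlgebra ℝ (Matrix (Fin m) (Fin m) ℝ))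
instance : FiniteDimensional ℝ (FrobeniusMatrix m) :=
  inferInstanceAs (FiniteDimensional ℝ (Matrix (Fin m) (Fin m) ℝ))
instance : CompleteSpace (FrobeniusMatrix m) := FiniteDimensional.complete ℝ _

/-- The underlying matrix. -/
def toMatrix (X : FrobeniusMatrix m) : Matrix (Fin m) (Fin m) ℝ := X

/-- A matrix as an element of the normed algebra. -/
def of (X : Matrix (Fin m) (Fin m) ℝ) : FrobeniusMatrix m := X

/-- The trace as a linear map. -/
def traceL (m : ℕ) : FrobeniusMatrix m →L[ℝ] ℝ :=
  LinearMap.toContinuousLinearMap (Matrix.traceLinearMap (Fin m) ℝ ℝ)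

/-- The transpose as a linear map. -/
def transposeL (m : ℕ) : FrobeniusMatrix m →L[ℝ] FrobeniusMatrix m :=
  LinearMap.toContinuousLinearMap
    (Matrix.transposeLinearEquiv (Fin m) (Fin m) ℝ ℝ).toLinearMap

end FrobeniusMatrix

/-- A matrix one of whose powers is a contraction has square-summable powers. -/
theorem summable_sq_norm_pow {R : Type*} [NormedRing R] {a : R} {N : ℕ} (h : ‖a ^ N‖ < 1) :
    Summable fun t => ‖a ^ t‖ ^ 2 := by
  set c := ‖a ^ N‖ ^ 2 with hc
  have hc1 : c < 1 := by
    rw [hc]; exact pow_lt_one₀ (norm_nonneg _) h two_ne_zero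
  have hstep : ∀ t, ‖a ^ (t + N)‖ ^ 2 ≤ c * ‖a ^ t‖ ^ 2 := by
    intro t
    rw [hc, ← mul_pow, add_comm, pow_add]
    gcongr
    exact norm_mul_le _ _
  -- Splitting off the first `N` terms gives `S ≤ A + c S` for every partial sum `S`, hence a
  -- uniform bound.
  set A := ∑ t ∈ Finset.range N, ‖a ^ t‖ ^ 2
  refine summable_of_sum_range_le (c := A / (1 - c)) (fun _ => by positivity) fun n => ?_
  rw [le_div_iff₀ (by linarith)]
  have h1 : ∑ t ∈ Finset.range n, ‖a ^ t‖ ^ 2 ≤ ∑ t ∈ Finset.range (N + n), ‖a ^ t‖ ^ 2 :=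
    Finset.sum_le_sum_of_subset_of_nonneg (Finset.range_mono (by omega))
      fun _ _ _ => by positivity
  rw [Finset.sum_range_add] at h1
  have h2 : ∑ t ∈ Finset.range n, ‖a ^ (N + t)‖ ^ 2 ≤ c * ∑ t ∈ Finset.range n, ‖a ^ t‖ ^ 2 := by
    rw [Finset.mul_sum]
    exact Finset.sum_le_sum fun t _ => by simpa [add_comm] using hstep t
  linarith

end MatrixFacts
end

noncomputable section

open scoped Matrix Matrix.Norms.Frobenius Topology
open Filter

/-! ### The quadratic form of the cost -/

namespace Policy

variable {m n : ℕ}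

/-- The policy with a given matrix. -/
def ofMatrix (X : Matrix (Fin n) (Fin m) ℝ) : Policy m n := WithLp.toLp 2 fun p => X p.1 p.2

@[simp] theorem toMatrix_ofMatrix (X : Matrix (Fin n) (Fin m) ℝ) : (ofMatrix X).toMatrix = X := rfl

theorem toMatrix_add (K K' : Policy m n) : (K + K').toMatrix = K.toMatrix + K'.toMatrix := rfl

theorem toMatrix_smul (c : ℝ) (K : Policy m n) : (c • K).toMatrix = c • K.toMatrix := rfl

theorem norm_sq_eq_trace (K : Policy m n) : ‖K‖ ^ 2 = (K.toMatrixᵀ * K.toMatrix).trace := by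
  rw [EuclideanSpace.norm_sq_eq, Fintype.sum_prod_type, Finset.sum_comm]
  simp [Matrix.trace, Matrix.mul_apply, toMatrix, sq]

end Policy

namespace LQR

variable {m n : ℕ} (L : LQR m n)

/-- The discounted closed loop matrix `√γ (A - B K)`. -/
def closedLoop (K : Policy m n) : FrobeniusMatrix m :=
  .of (Real.sqrt L.γ • (L.A - L.B * K.toMatrix))

/-- The matrix of the stage cost, `Q + Kᵀ R K`. -/
def stageMatrix (K : Policy m n) : Matrix (Fin m) (Fin m) ℝ :=
  L.Q + K.toMatrixᵀ * L.R * K.toMatrix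

/-- The matrix of the discounted cost at time `t` as a quadratic form in the initial state. -/
def stepMatrix (K : Policy m n) (t : ℕ) : Matrix (Fin m) (Fin m) ℝ :=
  (L.closedLoop K ^ t).toMatrixᵀ * L.stageMatrix K * (L.closedLoop K ^ t).toMatrix

theorem stageMatrix_sub_Q_posSemidef (K : Policy m n) : (L.stageMatrix K - L.Q).PosSemidef := by
  rw [stageMatrix, add_sub_cancel_left]
  exact posSemidef_transpose_mul_mul L.R_posDef.posSemidef _

theorem stageMatrix_posSemidef (K : Policy m n) : (L.stageMatrix K).PosSemidef :=
  L.Q_posDef.posSemidef.add (posSemidef_transpose_mul_mul L.R_posDef.posSemidef _)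

theorem stepMatrix_posSemidef (K : Policy m n) (t : ℕ) : (L.stepMatrix K t).PosSemidef :=
  posSemidef_transpose_mul_mul (L.stageMatrix_posSemidef K) _

theorem state_eq (K : Policy m n) (s : LQRState m) (t : ℕ) :
    L.state K s t = ((L.A - L.B * K.toMatrix) ^ t).mulVec s := by
  induction t with
  | zero => simp [state]
  | succ t ih =>
    rw [state, ih, pow_succ', ← Matrix.mulVec_mulVec, Matrix.sub_mulVec _ (L.B * _),
      Matrix.mulVec_neg, Matrix.mulVec_mulVec _ L.B]
    exact (sub_eq_add_neg _ _).symm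

theorem closedLoop_pow (K : Policy m n) (t : ℕ) :
    L.closedLoop K ^ t = .of (Real.sqrt L.γ ^ t • (L.A - L.B * K.toMatrix) ^ t) :=
  smul_pow (Real.sqrt L.γ) (L.A - L.B * K.toMatrix) t

theorem stepCost_eq (K : Policy m n) (s : LQRState m) (t : ℕ) :
    L.γ ^ t * (L.state K s t ⬝ᵥ L.Q.mulVec (L.state K s t) +
      L.control K s t ⬝ᵥ L.R.mulVec (L.control K s t)) = s ⬝ᵥ (L.stepMatrix K t).mulVec s := by
  have h1 : L.state K s t ⬝ᵥ L.Q.mulVec (L.state K s t) +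
      L.control K s t ⬝ᵥ L.R.mulVec (L.control K s t) =
      L.state K s t ⬝ᵥ (L.stageMatrix K).mulVec (L.state K s t) := by
    rw [stageMatrix, Matrix.add_mulVec, dotProduct_add, control, Matrix.mulVec_neg,
      neg_dotProduct_neg]
    congr 1
    simp only [← Matrix.mulVec_mulVec]
    rw [Matrix.dotProduct_mulVec (L.state K s t) K.toMatrixᵀ, Matrix.vecMul_transpose]
  have h2 : Real.sqrt L.γ ^ t * Real.sqrt L.γ ^ t = L.γ ^ t := by
    rw [← mul_pow, Real.mul_self_sqrt L.γ_pos.le]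
  have h3 : (L.closedLoop K ^ t).toMatrix =
      Real.sqrt L.γ ^ t • (L.A - L.B * K.toMatrix) ^ t := L.closedLoop_pow K t
  rw [h1, state_eq, stepMatrix, h3]
  simp only [← Matrix.mulVec_mulVec]
  rw [Matrix.dotProduct_mulVec s, Matrix.vecMul_transpose]
  simp only [Matrix.smul_mulVec, Matrix.mulVec_smul, dotProduct_smul, smul_dotProduct, smul_eq_mul]
  rw [← mul_assoc, h2]

theorem sampleCost_eq (K : Policy m n) (s : LQRState m) :
    L.sampleCost K s = ∑' t, ENNReal.ofReal (s ⬝ᵥ (L.stepMatrix K t).mulVec s) := by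
  simp only [sampleCost, stepCost_eq]

theorem integrable_mul_coord (i j : Fin m) : Integrable (fun v => v i * v j) L.init := by
  have := L.init_prob
  refine Integrable.of_bound (C := L.Cm) (by fun_prop) ?_
  filter_upwards [L.init_bound] with v hv
  have hi := Finset.single_le_sum (f := fun i => v i ^ 2) (fun i _ => sq_nonneg _)
    (Finset.mem_univ i)
  have hj := Finset.single_le_sum (f := fun i => v i ^ 2) (fun i _ => sq_nonneg _)
    (Finset.mem_univ j)
  rw [Real.norm_eq_abs, abs_le]
  constructor <;> nlinarith [sq_nonneg (v i - v j), sq_nonneg (v i + v j)]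

/-- This is where the identity covariance of the initial state enters: it turns the mean of a
quadratic form into a trace. -/
theorem lintegral_quadratic {X : Matrix (Fin m) (Fin m) ℝ} (hX : X.PosSemidef) :
    ∫⁻ s, ENNReal.ofReal (s ⬝ᵥ X.mulVec s) ∂L.init = ENNReal.ofReal X.trace := by
  have heq : ∀ s : LQRState m, s ⬝ᵥ X.mulVec s = ∑ i, ∑ j, X i j * (s i * s j) := by
    intro s
    simp only [dotProduct, Matrix.mulVec, Finset.mul_sum]
    exact Finset.sum_congr rfl fun i _ => Finset.sum_congr rfl fun j _ => by ring
  have hint : ∀ i j, Integrable (fun s : LQRState m => X i j * (s i * s j)) L.init :=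
    fun i j => (L.integrable_mul_coord i j).const_mul _
  rw [← ofReal_integral_eq_lintegral_ofReal]
  · congr 1
    simp only [heq]
    rw [integral_finsetSum _ fun i _ => integrable_finsetSum _ fun j _ => hint i j]
    simp only [integral_finsetSum _ fun j _ => hint _ j, integral_const_mul, L.init_cov]
    simp [Matrix.trace]
  · simp only [heq]
    exact integrable_finsetSum _ fun i _ => integrable_finsetSum _ fun j _ => hint i j
  · exact ae_of_all _ fun s => by simpa using hX.dotProduct_mulVec_nonneg s

theorem cost_eq (K : Policy m n) :
    L.cost K = ∑' t, ENNReal.ofReal (L.stepMatrix K t).trace := by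
  simp only [cost, sampleCost_eq]
  rw [lintegral_tsum]
  · exact tsum_congr fun t => L.lintegral_quadratic (L.stepMatrix_posSemidef K t)
  · intro t
    refine (Measurable.ennreal_ofReal ?_).aemeasurable
    exact Continuous.measurable (by fun_prop)

/-- Compare term by term in time. Consequently a finite population cost makes the sample cost finite
at every initial state, not just almost every one. -/
theorem sampleCost_le (K : Policy m n) (s : LQRState m) :
    L.sampleCost K s ≤ ENNReal.ofReal (∑ i, s i ^ 2) * L.cost K := by
  rw [sampleCost_eq, cost_eq, ← ENNReal.tsum_mul_left]
  refine ENNReal.tsum_le_tsum fun t => ?_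
  rw [← ENNReal.ofReal_mul (Finset.sum_nonneg fun i _ => sq_nonneg _)]
  exact ENNReal.ofReal_le_ofReal (dotProduct_mulVec_le_mul_trace (L.stepMatrix_posSemidef K t) s)

/-! ### The domain -/

theorem trace_stepMatrix (K : Policy m n) (t : ℕ) :
    (L.stepMatrix K t).trace = FrobeniusMatrix.traceL m
      (.of (L.stageMatrix K) *
        (L.closedLoop K ^ t * FrobeniusMatrix.transposeL m (L.closedLoop K ^ t))) := by
  rw [stepMatrix, Matrix.mul_assoc, Matrix.trace_mul_comm, Matrix.mul_assoc]
  rfl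

theorem norm_transposeL (X : FrobeniusMatrix m) : ‖FrobeniusMatrix.transposeL m X‖ = ‖X‖ :=
  Matrix.frobenius_norm_transpose X

theorem mem_domain_of_norm_pow_lt {K : Policy m n} {N : ℕ} (h : ‖L.closedLoop K ^ N‖ < 1) :
    K ∈ L.domain := by
  have hs := summable_sq_norm_pow h
  have h1 : Summable fun t => (L.stepMatrix K t).trace := by
    refine Summable.of_nonneg_of_le (fun t => (L.stepMatrix_posSemidef K t).trace_nonneg)
      (fun t => ?_) (hs.mul_left
        (‖FrobeniusMatrix.traceL m‖ * ‖FrobeniusMatrix.of (L.stageMatrix K)‖))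
    rw [trace_stepMatrix]
    refine (Real.le_norm_self _).trans ((ContinuousLinearMap.le_opNorm _ _).trans ?_)
    rw [mul_assoc]
    gcongr
    refine (norm_mul_le _ _).trans ?_
    gcongr
    refine (norm_mul_le _ _).trans ?_
    rw [norm_transposeL, sq]
  rw [domain, Set.mem_ofPred_eq, cost_eq]
  exact h1.tsum_ofReal_lt_top

/-- Since `Q ≥ q I` with `q > 0`, the cost at time `t` is at least `q ‖M ^ t‖²` for the closed loop
matrix `M`. -/
theorem summable_sq_norm_of_mem_domain {K : Policy m n} (hK : K ∈ L.domain) :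
    Summable fun t => ‖L.closedLoop K ^ t‖ ^ 2 := by
  obtain ⟨q, hq, hQ⟩ := exists_pos_mul_dotProduct_le L.Q_posDef
  have h1 : ∑' t, ENNReal.ofReal (L.stepMatrix K t).trace ≠ ∞ := by
    rw [← cost_eq]; exact ne_of_lt hK
  have h2 : Summable fun t => (L.stepMatrix K t).trace := by
    have := ENNReal.summable_toReal h1
    simpa only [ENNReal.toReal_ofReal (L.stepMatrix_posSemidef K _).trace_nonneg] using this
  refine Summable.of_nonneg_of_le (fun _ => by positivity) (fun t => ?_) (h2.mul_left q⁻¹)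
  set X : Matrix (Fin m) (Fin m) ℝ := (L.closedLoop K ^ t).toMatrix with hX
  have h3 : 0 ≤ (Xᵀ * (L.stageMatrix K - q • (1 : Matrix (Fin m) (Fin m) ℝ)) * X).trace := by
    refine (posSemidef_transpose_mul_mul ?_ _).trace_nonneg
    have := (L.stageMatrix_sub_Q_posSemidef K).add hQ
    simpa using this
  have h4 : ‖L.closedLoop K ^ t‖ ^ 2 = (Xᵀ * X).trace := frobenius_sq_eq_trace' X
  rw [Matrix.mul_sub, Matrix.sub_mul, Matrix.trace_sub, Matrix.mul_smul, Matrix.smul_mul,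
    Matrix.trace_smul, Matrix.mul_one, smul_eq_mul] at h3
  rw [h4, le_inv_mul_iff₀ hq]
  have h5 : (L.stepMatrix K t).trace = (Xᵀ * L.stageMatrix K * X).trace := rfl
  rw [h5]
  linarith

/-- This plays the role of the spectral radius criterion, in a form visibly open for each `N`. -/
theorem mem_domain_iff {K : Policy m n} :
    K ∈ L.domain ↔ ∃ N, ‖L.closedLoop K ^ N‖ < 1 := by
  refine ⟨fun h => ?_, fun ⟨N, h⟩ => L.mem_domain_of_norm_pow_lt h⟩
  have h1 := (L.summable_sq_norm_of_mem_domain h).tendsto_atTop_zero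
  obtain ⟨N, hN⟩ := (h1.eventually (gt_mem_nhds one_pos)).exists
  exact ⟨N, by simpa using lt_of_pow_lt_pow_left₀ 2 zero_le_one (by simpa using hN)⟩

theorem contDiff_closedLoop : ContDiff ℝ ⊤ L.closedLoop := by
  let T : Policy m n →ₗ[ℝ] FrobeniusMatrix m :=
    { toFun := fun K => .of (Real.sqrt L.γ • (L.B * K.toMatrix))
      map_add' := fun K K' => by
        rw [Policy.toMatrix_add, Matrix.mul_add, smul_add]; rfl
      map_smul' := fun c K => by
        rw [Policy.toMatrix_smul, Matrix.mul_smul, smul_comm]; rfl }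
  have : L.closedLoop = fun K =>
      FrobeniusMatrix.of (Real.sqrt L.γ • L.A) -
        (LinearMap.toContinuousLinearMap T : Policy m n →L[ℝ] FrobeniusMatrix m) K := by
    funext K
    exact smul_sub (Real.sqrt L.γ) L.A (L.B * K.toMatrix)
  rw [this]
  exact ContDiff.sub contDiff_const (ContinuousLinearMap.contDiff _)

theorem isOpen_domain : IsOpen L.domain := by
  have : L.domain = ⋃ N, {K | ‖L.closedLoop K ^ N‖ < 1} := by
    ext K; simp [mem_domain_iff]
  rw [this]
  refine isOpen_iUnion fun N => isOpen_lt ?_ continuous_const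
  exact (L.contDiff_closedLoop.continuous.pow N).norm

end LQR
end

noncomputable section

open scoped Matrix Matrix.Norms.Frobenius Topology
open Filter

/-! ### The state covariance and the value matrix -/

theorem posSemidef_of_hasSum {m : ℕ} {f : ℕ → FrobeniusMatrix m} {X : FrobeniusMatrix m}
    (hf : ∀ t, (f t).toMatrix.PosSemidef) (hX : HasSum f X) : X.toMatrix.PosSemidef := by
  refine Matrix.PosSemidef.of_dotProduct_mulVec_nonneg ?_ fun x => ?_
  · have h1 := (FrobeniusMatrix.transposeL m).hasSum hX
    have h2 : (fun t => FrobeniusMatrix.transposeL m (f t)) = f := by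
      funext t
      have := (hf t).isHermitian
      rw [Matrix.IsHermitian, Matrix.conjTranspose_eq_transpose_of_trivial] at this
      exact this
    rw [h2] at h1
    rw [Matrix.IsHermitian, Matrix.conjTranspose_eq_transpose_of_trivial]
    exact h1.unique hX
  · let T : FrobeniusMatrix m →ₗ[ℝ] ℝ :=
      { toFun := fun Y => x ⬝ᵥ Y.toMatrix.mulVec x
        map_add' := fun Y Z => by
          have : (Y + Z).toMatrix = Y.toMatrix + Z.toMatrix := rfl
          rw [this, Matrix.add_mulVec, dotProduct_add]
        map_smul' := fun c Y => by
          have : (c • Y).toMatrix = c • Y.toMatrix := rfl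
          rw [this, Matrix.smul_mulVec, dotProduct_smul]; rfl }
    have h1 := (LinearMap.toContinuousLinearMap T : FrobeniusMatrix m →L[ℝ] ℝ).hasSum hX
    rw [star_trivial]
    refine h1.nonneg fun t => ?_
    have := (hf t).dotProduct_mulVec_nonneg x
    rwa [star_trivial] at this

namespace LQR

variable {m n : ℕ} (L : LQR m n)

/-- The operator `X ↦ M X Mᵀ`, for the closed loop matrix `M`. -/
def lyapunov (K : Policy m n) : FrobeniusMatrix m →L[ℝ] FrobeniusMatrix m :=
  ContinuousLinearMap.mulLeftRight ℝ (FrobeniusMatrix m) (L.closedLoop K)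
    (FrobeniusMatrix.transposeL m (L.closedLoop K))

theorem lyapunov_pow (K : Policy m n) (t : ℕ) :
    L.lyapunov K ^ t = ContinuousLinearMap.mulLeftRight ℝ (FrobeniusMatrix m) (L.closedLoop K ^ t)
      (FrobeniusMatrix.transposeL m (L.closedLoop K) ^ t) := by
  induction t with
  | zero => ext X; simp
  | succ t ih =>
    ext X
    rw [pow_succ', ih, mul_apply_eq_comp, lyapunov,
      ContinuousLinearMap.mulLeftRight_apply, ContinuousLinearMap.mulLeftRight_apply,
      ContinuousLinearMap.mulLeftRight_apply, pow_succ', pow_succ]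
    simp only [mul_assoc]

theorem transposeL_pow (X : FrobeniusMatrix m) (t : ℕ) :
    FrobeniusMatrix.transposeL m X ^ t = FrobeniusMatrix.transposeL m (X ^ t) :=
  (Matrix.transpose_pow X.toMatrix t).symm

theorem norm_lyapunov_pow_le (K : Policy m n) (t : ℕ) :
    ‖L.lyapunov K ^ t‖ ≤ ‖L.closedLoop K ^ t‖ ^ 2 := by
  rw [lyapunov_pow, transposeL_pow]
  refine (ContinuousLinearMap.opNorm_mulLeftRight_apply_apply_le _ _ _ _).trans ?_
  rw [norm_transposeL, sq]

/-- Some power of the operator `T` has norm below one, so `1 - T ^ N` is a unit. It factors as `1 -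
T` times a geometric sum commuting with it, so `1 - T` is a unit too. -/
theorem isUnit_one_sub_lyapunov {K : Policy m n} (hK : K ∈ L.domain) :
    IsUnit (1 - L.lyapunov K) := by
  obtain ⟨N, hN⟩ := L.mem_domain_iff.1 hK
  have h1 : ‖L.lyapunov K ^ N‖ < 1 :=
    (L.norm_lyapunov_pow_le K N).trans_lt (pow_lt_one₀ (norm_nonneg _) hN two_ne_zero)
  have h2 : IsUnit (1 - L.lyapunov K ^ N) := isUnit_one_sub_of_norm_lt_one h1
  rw [← mul_neg_geom_sum] at h2
  refine ((Commute.isUnit_mul_iff ?_).1 h2).1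
  exact Commute.sum_right _ _ _ fun i _ =>
    (Commute.one_left _).sub_left ((Commute.refl _).pow_right i)

/-- The discounted state covariance. -/
def covariance (K : Policy m n) : FrobeniusMatrix m := Ring.inverse (1 - L.lyapunov K) 1

theorem covariance_eq {K : Policy m n} (hK : K ∈ L.domain) :
    L.covariance K = 1 + L.closedLoop K * L.covariance K *
      FrobeniusMatrix.transposeL m (L.closedLoop K) := by
  have h : (1 - L.lyapunov K) (L.covariance K) = 1 := by
    rw [covariance, ← mul_apply_eq_comp,
      Ring.mul_inverse_cancel _ (L.isUnit_one_sub_lyapunov hK), one_apply_eq_self]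
  rw [sub_apply, one_apply_eq_self, sub_eq_iff_eq_add] at h
  exact h

/-- The series solves the fixed-point equation that the inverse solves uniquely. The inverse gives
smoothness in `K`; the series gives positivity and the link with the cost. -/
theorem hasSum_covariance {K : Policy m n} (hK : K ∈ L.domain) :
    HasSum (fun t => L.closedLoop K ^ t * FrobeniusMatrix.transposeL m (L.closedLoop K ^ t))
      (L.covariance K) := by
  have hs : Summable fun t =>
      L.closedLoop K ^ t * FrobeniusMatrix.transposeL m (L.closedLoop K ^ t) := by
    refine Summable.of_norm_bounded (L.summable_sq_norm_of_mem_domain hK) fun t => ?_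
    refine (norm_mul_le _ _).trans ?_
    rw [norm_transposeL, sq]
  set S := ∑' t, L.closedLoop K ^ t * FrobeniusMatrix.transposeL m (L.closedLoop K ^ t) with hS
  have hT : ∀ t, L.lyapunov K (L.closedLoop K ^ t * FrobeniusMatrix.transposeL m
      (L.closedLoop K ^ t)) = L.closedLoop K ^ (t + 1) * FrobeniusMatrix.transposeL m
      (L.closedLoop K ^ (t + 1)) := by
    intro t
    rw [lyapunov, ContinuousLinearMap.mulLeftRight_apply, ← transposeL_pow, ← transposeL_pow,
      pow_succ', pow_succ (FrobeniusMatrix.transposeL m _)]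
    simp only [mul_assoc]
  have h1 : S = 1 + L.lyapunov K S := by
    rw [hS, (L.lyapunov K).map_tsum hs]
    simp only [hT]
    rw [hs.tsum_eq_zero_add]
    congr 1
    rw [← transposeL_pow, pow_zero, pow_zero, one_mul]
  have h2 : (1 - L.lyapunov K) S = 1 := by
    rw [sub_apply, one_apply_eq_self, sub_eq_iff_eq_add]
    exact h1
  have h3 : L.covariance K = S := by
    rw [covariance, ← h2, ← mul_apply_eq_comp,
      Ring.inverse_mul_cancel _ (L.isUnit_one_sub_lyapunov hK), one_apply_eq_self]
  rw [h3]
  exact hs.hasSum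

theorem covariance_posSemidef {K : Policy m n} (hK : K ∈ L.domain) :
    (L.covariance K).toMatrix.PosSemidef := by
  refine posSemidef_of_hasSum (fun t => ?_) (L.hasSum_covariance hK)
  have := Matrix.posSemidef_self_mul_conjTranspose (L.closedLoop K ^ t).toMatrix
  rwa [Matrix.conjTranspose_eq_transpose_of_trivial] at this

theorem covariance_toMatrix {K : Policy m n} (hK : K ∈ L.domain) :
    (L.covariance K).toMatrix = 1 + (L.closedLoop K).toMatrix * (L.covariance K).toMatrix *
      (L.closedLoop K).toMatrixᵀ := L.covariance_eq hK

theorem covariance_sub_one_posSemidef {K : Policy m n} (hK : K ∈ L.domain) :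
    ((L.covariance K).toMatrix - 1).PosSemidef := by
  rw [L.covariance_toMatrix hK, add_sub_cancel_left]
  exact posSemidef_mul_mul_transpose (L.covariance_posSemidef hK) _

theorem cost_eq_ofReal_of_hasSum {K : Policy m n} {c : ℝ}
    (h : HasSum (fun t => (L.stepMatrix K t).trace) c) : L.realCost K = c := by
  have h0 : ∀ t, 0 ≤ (L.stepMatrix K t).trace :=
    fun t => (L.stepMatrix_posSemidef K t).trace_nonneg
  rw [realCost, cost_eq, ← ENNReal.ofReal_tsum_of_nonneg h0 h.summable, h.tsum_eq,
    ENNReal.toReal_ofReal (h.nonneg h0)]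

theorem realCost_eq {K : Policy m n} (hK : K ∈ L.domain) :
    L.realCost K = FrobeniusMatrix.traceL m (.of (L.stageMatrix K) * L.covariance K) := by
  refine L.cost_eq_ofReal_of_hasSum ?_
  simp only [trace_stepMatrix]
  exact (FrobeniusMatrix.traceL m).hasSum ((L.hasSum_covariance hK).mul_left _)

/-- The value matrix is the sum of the step matrices, and shifting the time index gives its
equation. It depends on `K` alone, so it can be paired with the covariance of another policy. -/
theorem exists_valueMatrix {K : Policy m n} (hK : K ∈ L.domain) :
    ∃ P : Matrix (Fin m) (Fin m) ℝ, P.PosSemidef ∧ P.trace = L.realCost K ∧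
      P = L.stageMatrix K + (L.closedLoop K).toMatrixᵀ * P * (L.closedLoop K).toMatrix := by
  set f : ℕ → FrobeniusMatrix m := fun t => .of (L.stepMatrix K t) with hf
  have hf' : ∀ t, f t = FrobeniusMatrix.transposeL m (L.closedLoop K ^ t) *
    .of (L.stageMatrix K) * L.closedLoop K ^ t := fun t => rfl
  have hs : Summable f := by
    refine Summable.of_norm_bounded ((L.summable_sq_norm_of_mem_domain hK).mul_left
      ‖FrobeniusMatrix.of (L.stageMatrix K)‖) fun t => ?_
    rw [hf']
    calc _ ≤ ‖FrobeniusMatrix.transposeL m (L.closedLoop K ^ t)‖ *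
          ‖FrobeniusMatrix.of (L.stageMatrix K)‖ * ‖L.closedLoop K ^ t‖ :=
        (norm_mul_le _ _).trans (by gcongr; exact norm_mul_le _ _)
      _ = _ := by rw [norm_transposeL]; ring
  refine ⟨(∑' t, f t).toMatrix, posSemidef_of_hasSum (fun t => L.stepMatrix_posSemidef K t)
    hs.hasSum, ?_, ?_⟩
  · exact (L.cost_eq_ofReal_of_hasSum ((FrobeniusMatrix.traceL m).hasSum hs.hasSum)).symm
  · have h1 : ∀ t, f (t + 1) = ContinuousLinearMap.mulLeftRight ℝ (FrobeniusMatrix m)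
        (FrobeniusMatrix.transposeL m (L.closedLoop K)) (L.closedLoop K) (f t) := by
      intro t
      rw [hf', hf', ContinuousLinearMap.mulLeftRight_apply, ← transposeL_pow, ← transposeL_pow,
        pow_succ', pow_succ (L.closedLoop K)]
      simp only [mul_assoc]
    have h2 : f 0 = .of (L.stageMatrix K) := by
      rw [hf', ← transposeL_pow, pow_zero, pow_zero, one_mul, mul_one]
    have h3 : ∑' t, f t = .of (L.stageMatrix K) + ContinuousLinearMap.mulLeftRight ℝ
        (FrobeniusMatrix m) (FrobeniusMatrix.transposeL m (L.closedLoop K)) (L.closedLoop K)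
        (∑' t, f t) := by
      rw [ContinuousLinearMap.map_tsum _ hs, hs.tsum_eq_zero_add, h2]
      simp only [h1]
    exact h3

/-! ### Performance difference of two policies -/

/-- The cost difference of two policies is a quadratic expression in the difference of the
policies, weighted by the state covariance of the second one. -/
theorem exists_performance_difference {K : Policy m n} (hK : K ∈ L.domain) :
    ∃ (E : Matrix (Fin n) (Fin m) ℝ) (H : Matrix (Fin n) (Fin n) ℝ), (H - L.R).PosSemidef ∧
      ∀ V : Policy m n, K + V ∈ L.domain → L.realCost (K + V) - L.realCost K =
        ((V.toMatrixᵀ * E + Eᵀ * V.toMatrix + V.toMatrixᵀ * H * V.toMatrix) *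
          (L.covariance (K + V)).toMatrix).trace := by
  obtain ⟨P, hP, hPc, hPe⟩ := L.exists_valueMatrix hK
  set M := (L.closedLoop K).toMatrix with hM
  set g := Real.sqrt L.γ with hg
  have hPt : Pᵀ = P := by
    have := hP.isHermitian
    rwa [Matrix.IsHermitian, Matrix.conjTranspose_eq_transpose_of_trivial] at this
  have hRt : L.Rᵀ = L.R := by
    have := L.R_posDef.isHermitian
    rwa [Matrix.IsHermitian, Matrix.conjTranspose_eq_transpose_of_trivial] at this
  -- These are the linear and quadratic coefficients obtained by substituting `M' = M - g B V` in
  -- the Lyapunov equation of `P`.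
  refine ⟨L.R * K.toMatrix - g • (L.Bᵀ * P * M), L.R + (g • L.B)ᵀ * P * (g • L.B), ?_, ?_⟩
  · rw [add_sub_cancel_left]
    exact posSemidef_transpose_mul_mul hP _
  intro V hV
  set M' := (L.closedLoop (K + V)).toMatrix with hM'
  set S := (L.covariance (K + V)).toMatrix with hS
  have hMM : M' = M - g • (L.B * V.toMatrix) := by
    have h1 : M' = g • (L.A - L.B * (K + V).toMatrix) := rfl
    have h2 : M = g • (L.A - L.B * K.toMatrix) := rfl
    rw [h1, h2, Policy.toMatrix_add, Matrix.mul_add, ← smul_sub, sub_sub]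
  have hSe : S = 1 + M' * S * M'ᵀ := L.covariance_toMatrix hV
  have h1 : L.realCost (K + V) = (L.stageMatrix (K + V) * S).trace := L.realCost_eq hV
  -- Pairing `P` with the covariance equation of the new policy expresses the old cost `P.trace` as
  -- a trace against the new covariance.
  have h2 : (P * S).trace = P.trace + (M'ᵀ * P * M' * S).trace := by
    conv_lhs => rw [hSe]
    rw [Matrix.mul_add, Matrix.trace_add, Matrix.mul_one, Matrix.trace_mul_comm P,
      Matrix.mul_assoc, Matrix.trace_mul_comm (M' * S), Matrix.mul_assoc (M'ᵀ * P)]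
  have h3 : L.realCost (K + V) - L.realCost K =
      ((L.stageMatrix (K + V) + M'ᵀ * P * M' - P) * S).trace := by
    rw [Matrix.sub_mul, Matrix.add_mul, Matrix.trace_sub, Matrix.trace_add, h1, h2, hPc]
    ring
  rw [h3]
  congr 2
  have h4 : L.stageMatrix (K + V) = L.stageMatrix K + (V.toMatrixᵀ * L.R * K.toMatrix +
      K.toMatrixᵀ * L.R * V.toMatrix + V.toMatrixᵀ * L.R * V.toMatrix) := by
    rw [stageMatrix, stageMatrix, Policy.toMatrix_add]
    simp only [Matrix.transpose_add, Matrix.mul_add, Matrix.add_mul]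
    abel
  rw [h4, eq_sub_of_add_eq hPe.symm, hMM]
  simp only [smul_sub, Matrix.transpose_sub, Matrix.transpose_mul,
    Matrix.transpose_smul, Matrix.transpose_transpose, hPt, hRt, Matrix.mul_add, Matrix.add_mul,
    Matrix.mul_sub, Matrix.sub_mul, Matrix.smul_mul, Matrix.mul_smul, Matrix.mul_assoc]
  abel

end LQR
end

noncomputable section

open scoped Matrix Matrix.Norms.Frobenius Topology
open Filter

/-! ### Smoothness of the cost -/

theorem ContDiff.mulLeftRight {E R : Type*} [NormedAddCommGroup E] [NormedSpace ℝ E]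
    [NormedRing R] [NormedAlgebra ℝ R] {k : WithTop ℕ∞} {f g : E → R} (hf : ContDiff ℝ k f)
    (hg : ContDiff ℝ k g) :
    ContDiff ℝ k fun x => ContinuousLinearMap.mulLeftRight ℝ R (f x) (g x) := by
  have h : (fun x => ContinuousLinearMap.mulLeftRight ℝ R (f x) (g x)) = fun x =>
      (ContinuousLinearMap.mul ℝ R (f x)).comp ((ContinuousLinearMap.mul ℝ R).flip (g x)) := by
    funext x; ext y; simp [mul_assoc]
  rw [h]
  exact ((ContinuousLinearMap.mul ℝ R).contDiff.comp hf).clm_comp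
    ((ContinuousLinearMap.mul ℝ R).flip.contDiff.comp hg)

theorem dotProduct_mulVec_le_trace_smul {m : ℕ} {X : Matrix (Fin m) (Fin m) ℝ}
    (hX : X.PosSemidef) : (X.trace • (1 : Matrix (Fin m) (Fin m) ℝ) - X).PosSemidef := by
  refine Matrix.PosSemidef.of_dotProduct_mulVec_nonneg
    (Matrix.IsHermitian.sub (by simp [Matrix.IsHermitian]) hX.isHermitian) fun x => ?_
  have h := dotProduct_mulVec_le_mul_trace hX x
  have h2 : x ⬝ᵥ x = ∑ i, x i ^ 2 := by simp [dotProduct, sq]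
  simp only [Matrix.sub_mulVec, Matrix.smul_mulVec, Matrix.one_mulVec, dotProduct_sub,
      dotProduct_smul, smul_eq_mul, star_trivial, h2]
  linarith

/-- Because `Y ≤ (tr Y) I`, and pairing with `X ≥ 0` under the trace is monotone. -/
theorem trace_mul_le_of_posSemidef {m : ℕ} {X Y : Matrix (Fin m) (Fin m) ℝ}
    (hX : X.PosSemidef) (hY : Y.PosSemidef) : (X * Y).trace ≤ X.trace * Y.trace := by
  have h := trace_mul_nonneg_of_posSemidef hX (dotProduct_mulVec_le_trace_smul hY)
  rw [Matrix.mul_sub, Matrix.trace_sub, Matrix.mul_smul, Matrix.mul_one, Matrix.trace_smul,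
    smul_eq_mul] at h
  linarith

theorem posSemidef_transpose_mul_self {l m : ℕ} (X : Matrix (Fin l) (Fin m) ℝ) :
    (Xᵀ * X).PosSemidef := by
  simpa [Matrix.conjTranspose_eq_transpose_of_trivial] using
    Matrix.posSemidef_conjTranspose_mul_self X

namespace LQR

variable {m n : ℕ} (L : LQR m n)

theorem contDiff_stageMatrix :
    ContDiff ℝ ⊤ fun K : Policy m n => FrobeniusMatrix.of (L.stageMatrix K) := by
  have h : (fun K : Policy m n => FrobeniusMatrix.of (L.stageMatrix K)) = fun K =>
      ∑ i, ∑ j, L.stageMatrix K i j • FrobeniusMatrix.of (Matrix.single i j (1 : ℝ)) := by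
    funext K
    have := Matrix.matrix_eq_sum_single (L.stageMatrix K)
    have h2 : ∀ i j, Matrix.single i j (L.stageMatrix K i j) =
        L.stageMatrix K i j • Matrix.single i j (1 : ℝ) := by
      intro i j; rw [Matrix.smul_single, smul_eq_mul, mul_one]
    simp only [h2] at this
    exact this
  rw [h]
  refine ContDiff.sum fun i _ => ContDiff.sum fun j _ =>
    ContDiff.fun_smul (f := fun K => L.stageMatrix K i j) ?_ contDiff_const
  simp only [stageMatrix, Matrix.add_apply, Matrix.mul_apply, Matrix.transpose_apply,
    Policy.toMatrix, Matrix.of_apply]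
  fun_prop

theorem contDiffAt_covariance {K : Policy m n} (hK : K ∈ L.domain) :
    ContDiffAt ℝ ⊤ L.covariance K := by
  obtain ⟨U, hU⟩ := L.isUnit_one_sub_lyapunov hK
  have h1 : ContDiff ℝ ⊤ L.lyapunov :=
    L.contDiff_closedLoop.mulLeftRight
      ((FrobeniusMatrix.transposeL m).contDiff.comp L.contDiff_closedLoop)
  have h2 : ContDiffAt ℝ ⊤ (fun K => Ring.inverse (1 - L.lyapunov K)) K := by
    refine ContDiffAt.comp K (g := Ring.inverse) ?_ (contDiff_const.sub h1).contDiffAt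
    rw [← hU]
    exact contDiffAt_ringInverse ℝ U
  exact h2.clm_apply contDiffAt_const

theorem contDiffAt_realCost {K : Policy m n} (hK : K ∈ L.domain) :
    ContDiffAt ℝ ⊤ L.realCost K := by
  have h : ContDiffAt ℝ ⊤ (fun K => FrobeniusMatrix.traceL m
      (.of (L.stageMatrix K) * L.covariance K)) K :=
    (FrobeniusMatrix.traceL m).contDiff.contDiffAt.comp K
      (L.contDiff_stageMatrix.contDiffAt.mul (L.contDiffAt_covariance hK))
  -- The trace formula is valid only on the domain; openness makes that enough.
  refine h.congr_of_eventuallyEq ?_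
  filter_upwards [L.isOpen_domain.mem_nhds hK] with K' hK'
  exact L.realCost_eq hK'

theorem differentiableAt_realCost {K : Policy m n} (hK : K ∈ L.domain) :
    DifferentiableAt ℝ L.realCost K :=
  (L.contDiffAt_realCost hK).differentiableAt (by simp)

theorem contDiffAt_gradient {K : Policy m n} (hK : K ∈ L.domain) :
    ContDiffAt ℝ 1 (gradient L.realCost) K := by
  have h : ContDiffAt ℝ 1 (fderiv ℝ L.realCost) K :=
    (L.contDiffAt_realCost hK).fderiv_right (by exact le_top)
  exact (InnerProductSpace.toDual ℝ (Policy m n)).symm.contDiff.contDiffAt.comp K h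

/-! ### Gradient domination -/

/-- Divide the difference formula along `K + t V` by `t` and let `t → 0`. The quadratic term
vanishes, and only continuity of the covariance is needed. -/
theorem hasDerivAt_of_performance {K : Policy m n} (hK : K ∈ L.domain)
    {E : Matrix (Fin n) (Fin m) ℝ} {H : Matrix (Fin n) (Fin n) ℝ}
    (h : ∀ V : Policy m n, K + V ∈ L.domain → L.realCost (K + V) - L.realCost K =
        ((V.toMatrixᵀ * E + Eᵀ * V.toMatrix + V.toMatrixᵀ * H * V.toMatrix) *
          (L.covariance (K + V)).toMatrix).trace) (V : Policy m n) :
    inner ℝ (gradient L.realCost K) V =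
      ((V.toMatrixᵀ * E + Eᵀ * V.toMatrix) * (L.covariance K).toMatrix).trace := by
  have hline : Continuous fun t : ℝ => K + t • V := by fun_prop
  have h0 : K + (0 : ℝ) • V = K := by simp
  have h1 : HasDerivAt (fun t : ℝ => L.realCost (K + t • V))
      (inner ℝ (gradient L.realCost K) V) 0 := by
    have hg : HasGradientAt L.realCost (gradient L.realCost K) (K + (0 : ℝ) • V) := by
      rw [h0]; exact (L.differentiableAt_realCost hK).hasGradientAt
    have hd : HasDerivAt (fun t : ℝ => K + t • V) V 0 := by
      simpa using ((hasDerivAt_id (0 : ℝ)).smul_const V).const_add K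
    exact hg.hasFDerivAt.comp_hasDerivAt (0 : ℝ) hd
  have hcov : ContinuousAt (fun t : ℝ => L.covariance (K + t • V)) 0 := by
    refine ContinuousAt.comp (g := L.covariance) ?_ hline.continuousAt
    rw [h0]
    exact (L.contDiffAt_covariance hK).continuousAt
  have htr : ∀ X : Matrix (Fin m) (Fin m) ℝ,
      ContinuousAt (fun t : ℝ => (X * (L.covariance (K + t • V)).toMatrix).trace) 0 := by
    intro X
    exact (FrobeniusMatrix.traceL m).continuous.continuousAt.comp
      (continuousAt_const.mul hcov : ContinuousAt (fun t : ℝ =>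
        FrobeniusMatrix.of X * L.covariance (K + t • V)) 0)
  set X := V.toMatrixᵀ * E + Eᵀ * V.toMatrix
  set Y := V.toMatrixᵀ * H * V.toMatrix
  have h2 : Tendsto (fun t : ℝ => (X * (L.covariance (K + t • V)).toMatrix).trace +
      t * (Y * (L.covariance (K + t • V)).toMatrix).trace) (𝓝[≠] 0)
      (𝓝 ((X * (L.covariance K).toMatrix).trace)) := by
    have h3 : ContinuousAt (fun t : ℝ => (X * (L.covariance (K + t • V)).toMatrix).trace +
      t * (Y * (L.covariance (K + t • V)).toMatrix).trace) 0 :=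
      (htr X).add (continuousAt_id.mul (htr Y))
    have h4 := h3.tendsto
    rw [h0, zero_mul, add_zero] at h4
    exact h4.mono_left nhdsWithin_le_nhds
  refine tendsto_nhds_unique (hasDerivAt_iff_tendsto_slope_zero.1 h1) (h2.congr' ?_)
  have hev : ∀ᶠ t : ℝ in 𝓝 0, K + t • V ∈ L.domain :=
    hline.continuousAt.eventually (L.isOpen_domain.mem_nhds (by simpa using hK))
  filter_upwards [nhdsWithin_le_nhds hev, self_mem_nhdsWithin] with t ht ht0
  have ht0 : t ≠ 0 := ht0
  rw [zero_add, h0, h _ ht, Policy.toMatrix_smul, Matrix.transpose_smul]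
  have : (t • V.toMatrixᵀ * E + Eᵀ * t • V.toMatrix + t • V.toMatrixᵀ * H * t • V.toMatrix) =
      t • X + (t * t) • Y := by
    simp only [X, Y, Matrix.smul_mul, Matrix.mul_smul, smul_add, smul_smul]
  rw [this, Matrix.add_mul (t • X), Matrix.smul_mul, Matrix.smul_mul, Matrix.trace_add,
    Matrix.trace_smul, Matrix.trace_smul]
  simp only [smul_eq_mul]
  field_simp

/-- The matrix `E` of the difference formula links both sides. Testing the gradient against `E`,
with `Σ_K ≥ I`, gives `‖∇C(K)‖² ≥ 4 ‖E‖²`. Completing the square in the formula bounds the cost gap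
by `σ⁻¹ ‖E‖²` times the trace of the covariance of `K'`. -/
theorem gradient_domination {σ : ℝ} (hσ : 0 < σ)
    (hR : (L.R - σ • (1 : Matrix (Fin n) (Fin n) ℝ)).PosSemidef) {K K' : Policy m n}
    (hK : K ∈ L.domain) (hK' : K' ∈ L.domain) :
    4 * σ * (L.realCost K - L.realCost K') ≤
      (L.covariance K').toMatrix.trace * ‖gradient L.realCost K‖ ^ 2 := by
  obtain ⟨E, H, hH, hE⟩ := L.exists_performance_difference hK
  have hgrad := L.hasDerivAt_of_performance hK hE (Policy.ofMatrix E)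
  set S := (L.covariance K).toMatrix
  set S' := (L.covariance K').toMatrix
  have hS' : S'.PosSemidef := L.covariance_posSemidef hK'
  set e := (Eᵀ * E).trace with he
  have he' : ‖Policy.ofMatrix E‖ ^ 2 = e := Policy.norm_sq_eq_trace _
  have hEE := posSemidef_transpose_mul_self E
  have h1 : 2 * e ≤ inner ℝ (gradient L.realCost K) (Policy.ofMatrix E) := by
    rw [hgrad, Policy.toMatrix_ofMatrix, ← two_smul ℝ (Eᵀ * E), Matrix.smul_mul, Matrix.trace_smul,
      smul_eq_mul]
    have := trace_mul_nonneg_of_posSemidef hEE (L.covariance_sub_one_posSemidef hK)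
    rw [Matrix.mul_sub, Matrix.trace_sub, Matrix.mul_one] at this
    linarith
  have h2 : 4 * e ≤ ‖gradient L.realCost K‖ ^ 2 := by
    have h3 := real_inner_le_norm (gradient L.realCost K) (Policy.ofMatrix E)
    nlinarith [sq_nonneg (‖gradient L.realCost K‖ - 2 * ‖Policy.ofMatrix E‖)]
  have hV := hE (K' - K) (by simpa using hK')
  rw [add_sub_cancel] at hV
  -- Since `H ≥ R ≥ σ I`, the quadratic expression plus `σ⁻¹ Eᵀ E` is a sum of two positive
  -- semidefinite matrices, one of them the square of `σ V + E`.
  set V := (K' - K).toMatrix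
  have h4 : 0 ≤ ((Vᵀ * (H - σ • (1 : Matrix (Fin n) (Fin n) ℝ)) * V +
      σ⁻¹ • ((σ • V + E)ᵀ * (σ • V + E))) * S').trace := by
    refine trace_mul_nonneg_of_posSemidef (Matrix.PosSemidef.add ?_ ?_) hS'
    · refine posSemidef_transpose_mul_mul ?_ V
      simpa using hH.add hR
    · exact (posSemidef_transpose_mul_self _).smul (inv_pos.2 hσ).le
  have h5 : Vᵀ * (H - σ • (1 : Matrix (Fin n) (Fin n) ℝ)) * V +
      σ⁻¹ • ((σ • V + E)ᵀ * (σ • V + E)) =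
      (Vᵀ * E + Eᵀ * V + Vᵀ * H * V) + σ⁻¹ • (Eᵀ * E) := by
    simp only [Matrix.mul_sub, Matrix.sub_mul, Matrix.transpose_add, Matrix.transpose_smul,
      Matrix.mul_add, Matrix.add_mul, Matrix.smul_mul, Matrix.mul_smul, Matrix.mul_one, smul_add,
      smul_smul, ne_eq, hσ.ne', not_false_eq_true, inv_mul_cancel₀, one_smul]
    simp only [← mul_assoc, inv_mul_cancel₀ hσ.ne', one_mul]
    abel
  rw [h5, Matrix.add_mul, Matrix.trace_add, ← hV, Matrix.smul_mul, Matrix.trace_smul,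
    smul_eq_mul] at h4
  have h6 := trace_mul_le_of_posSemidef hEE hS'
  have h7 : σ * (L.realCost K - L.realCost K') ≤ e * S'.trace := by
    have : σ * (σ⁻¹ * (Eᵀ * E * S').trace) = (Eᵀ * E * S').trace := by field_simp
    nlinarith
  have h8 : 0 ≤ S'.trace := hS'.trace_nonneg
  nlinarith

theorem exists_isPL {Kstar : Policy m n} (hdom : Kstar ∈ L.domain) :
    ∃ μ, IsPL L.realCost L.domain (L.realCost Kstar) μ := by
  obtain ⟨σ, hσ, hR⟩ := exists_pos_mul_dotProduct_le L.R_posDef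
  have hs : 0 ≤ (L.covariance Kstar).toMatrix.trace := (L.covariance_posSemidef hdom).trace_nonneg
  refine ⟨4 * σ / ((L.covariance Kstar).toMatrix.trace + 1), by positivity, fun K hK => ?_⟩
  have h := L.gradient_domination hσ hR hK hdom
  rw [div_mul_eq_mul_div, div_le_iff₀ (by positivity)]
  nlinarith [sq_nonneg ‖gradient L.realCost K‖]

/-! ### Sublevel sets -/

/-- A sum of nonnegative continuous functions. As infinite values are allowed, sublevel sets are
closed in the whole policy space and not merely in the domain. -/
theorem lowerSemicontinuous_cost : LowerSemicontinuous L.cost := by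
  have : L.cost = fun K => ∑' t, ENNReal.ofReal (L.stepMatrix K t).trace :=
    funext fun K => L.cost_eq K
  rw [this]
  refine lowerSemicontinuous_tsum fun t => Continuous.lowerSemicontinuous ?_
  refine ENNReal.continuous_ofReal.comp ?_
  simp only [trace_stepMatrix]
  have h := L.contDiff_stageMatrix.continuous
  have h2 := L.contDiff_closedLoop.continuous
  fun_prop

/-- The control cost at time zero alone is coercive in `K`, because the initial covariance is the
identity. -/
theorem exists_mul_norm_sq_le_cost :
    ∃ σ : ℝ, 0 < σ ∧ ∀ K, ENNReal.ofReal (σ * ‖K‖ ^ 2) ≤ L.cost K := by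
  obtain ⟨σ, hσ, hR⟩ := exists_pos_mul_dotProduct_le L.R_posDef
  refine ⟨σ, hσ, fun K => ?_⟩
  rw [cost_eq]
  refine le_trans (ENNReal.ofReal_le_ofReal ?_) (ENNReal.le_tsum 0)
  have h1 : L.stepMatrix K 0 = L.stageMatrix K := by
    have : (L.closedLoop K ^ 0).toMatrix = 1 := by rw [pow_zero]; rfl
    rw [stepMatrix, this]; simp
  have h2 := (posSemidef_transpose_mul_mul hR K.toMatrix).trace_nonneg
  have h3 := L.Q_posDef.posSemidef.trace_nonneg
  rw [h1, stageMatrix, Matrix.trace_add, Policy.norm_sq_eq_trace]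
  rw [Matrix.mul_sub, Matrix.sub_mul, Matrix.trace_sub, Matrix.mul_smul, Matrix.smul_mul,
    Matrix.trace_smul, Matrix.mul_one, smul_eq_mul] at h2
  linarith

theorem isCompact_cost_le (b : ℝ) : IsCompact {K | L.cost K ≤ ENNReal.ofReal b} := by
  refine Metric.isCompact_of_isClosed_isBounded
    (L.lowerSemicontinuous_cost.isClosed_preimage _) ?_
  obtain ⟨σ, hσ, h⟩ := L.exists_mul_norm_sq_le_cost
  refine (Metric.isBounded_closedBall (x := (0 : Policy m n)) (r := |b| / σ + 1)).subset
    fun K hK => ?_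
  have h1 : σ * ‖K‖ ^ 2 ≤ |b| := by
    have := ((h K).trans hK).trans (ENNReal.ofReal_le_ofReal (le_abs_self b))
    exact (ENNReal.ofReal_le_ofReal_iff (abs_nonneg b)).1 this
  rw [mem_closedBall_zero_iff]
  have h2 : ‖K‖ ^ 2 ≤ |b| / σ := by rw [le_div_iff₀ hσ]; linarith
  nlinarith [sq_nonneg (‖K‖ - 1), norm_nonneg K]

theorem cost_eq_ofReal {K : Policy m n} (hK : K ∈ L.domain) :
    L.cost K = ENNReal.ofReal (L.realCost K) :=
  (ENNReal.ofReal_toReal (ne_of_lt hK)).symm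

theorem exists_isOptimal {K₀ : Policy m n} (hK₀ : K₀ ∈ L.domain) :
    ∃ Kstar, L.IsOptimal Kstar := by
  have hK₀' := (L.cost_eq_ofReal hK₀).le
  obtain ⟨K, hK, hmin⟩ := LowerSemicontinuousOn.exists_isMinOn (s := {K | L.cost K ≤
    ENNReal.ofReal (L.realCost K₀)}) ⟨K₀, hK₀'⟩ (L.isCompact_cost_le _)
    (L.lowerSemicontinuous_cost.lowerSemicontinuousOn _)
  refine ⟨K, fun K' => ?_⟩
  by_cases h : L.cost K' ≤ ENNReal.ofReal (L.realCost K₀)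
  · exact hmin h
  · exact le_trans hK (not_le.1 h).le

variable {L} in
theorem IsOptimal.mem_domain {K₀ Kstar : Policy m n} (h : L.IsOptimal Kstar)
    (hK₀ : K₀ ∈ L.domain) : Kstar ∈ L.domain := (h K₀).trans_lt hK₀

variable {L} in
theorem IsOptimal.realCost_le {K Kstar : Policy m n} (h : L.IsOptimal Kstar)
    (hK : K ∈ L.domain) : L.realCost Kstar ≤ L.realCost K :=
  ENNReal.toReal_mono (ne_of_lt hK) (h K)

/-- Domain membership must be carried along because `realCost` takes the value zero where the cost
is infinite. -/
theorem mem_domain_and_realCost_le_iff {K : Policy m n} {b : ℝ} (hb : 0 ≤ b) :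
    K ∈ L.domain ∧ L.realCost K ≤ b ↔ L.cost K ≤ ENNReal.ofReal b := by
  constructor
  · rintro ⟨h, h'⟩
    rw [L.cost_eq_ofReal h]
    exact ENNReal.ofReal_le_ofReal h'
  · intro h
    refine ⟨h.trans_lt ENNReal.ofReal_lt_top, ?_⟩
    exact (ENNReal.toReal_mono ENNReal.ofReal_ne_top h).trans_eq (ENNReal.toReal_ofReal hb)

theorem realCost_nonneg (K : Policy m n) : 0 ≤ L.realCost K := ENNReal.toReal_nonneg

theorem boundedSet_eq {K₀ Kstar : Policy m n} (h : L.IsOptimal Kstar) (hK₀ : K₀ ∈ L.domain) :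
    L.boundedSet K₀ Kstar =
      {K | L.cost K ≤ ENNReal.ofReal (L.realCost Kstar + 10 * L.gap K₀ Kstar)} := by
  have hg : 0 ≤ L.gap K₀ Kstar := sub_nonneg.2 (h.realCost_le hK₀)
  ext K
  rw [boundedSet, Set.mem_ofPred_eq, Set.mem_ofPred_eq,
    ← L.mem_domain_and_realCost_le_iff (by have := L.realCost_nonneg Kstar; positivity),
    sub_le_iff_le_add']

/-- The bounded set is compact, so some closed thickening of it is compact and lies in the open
domain. Derivatives of the cost and of its gradient are bounded there, so constant parameters work
by the mean value inequality. -/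
theorem exists_isValid {K₀ Kstar : Policy m n} (h : L.IsOptimal Kstar) (hK₀ : K₀ ∈ L.domain) :
    ∃ c : CurvatureParams m n, c.IsValid L (L.boundedSet K₀ Kstar) := by
  set G := L.boundedSet K₀ Kstar with hG
  have hcomp : IsCompact G := by rw [hG, L.boundedSet_eq h hK₀]; exact L.isCompact_cost_le _
  have hGd : G ⊆ L.domain := fun K hK => hK.1
  have hne : G.Nonempty :=
    ⟨K₀, hK₀, by
      have : 0 ≤ L.gap K₀ Kstar := sub_nonneg.2 (h.realCost_le hK₀)
      change L.gap K₀ Kstar ≤ _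
      linarith⟩
  obtain ⟨δ, hδ, hsub⟩ := hcomp.exists_cthickening_subset_open L.isOpen_domain hGd
  have hcomp' : IsCompact (Metric.cthickening δ G) := hcomp.cthickening
  have key : ∀ {F : Type} [NormedAddCommGroup F] [NormedSpace ℝ F] (f : Policy m n → F),
      (∀ K ∈ L.domain, ContDiffAt ℝ 1 f K) →
      ∃ c > 0, ∀ K ∈ G, ∀ K', ‖K' - K‖ ≤ δ → ‖f K' - f K‖ ≤ c * ‖K' - K‖ := by
    intro F _ _ f hf
    have hc : ContinuousOn (fun K => fderiv ℝ f K) (Metric.cthickening δ G) := fun K hK =>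
      ((hf K (hsub hK)).continuousAt_fderiv (by simp)).continuousWithinAt
    obtain ⟨c, hc⟩ := hcomp'.exists_bound_of_continuousOn hc
    refine ⟨|c| + 1, by positivity, fun K hK K' hK' => ?_⟩
    have hball : Metric.closedBall K δ ⊆ Metric.cthickening δ G :=
      Metric.closedBall_subset_cthickening hK δ
    refine (convex_closedBall K δ).norm_image_sub_le_of_norm_fderiv_le (𝕜 := ℝ)
      (fun x hx => (hf x (hsub (hball hx))).differentiableAt (by simp))
      (fun x hx => (hc x (hball hx)).trans (by linarith [le_abs_self c]))
      (Metric.mem_closedBall_self hδ.le) (by rwa [mem_closedBall_iff_norm])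
  obtain ⟨φ, hφ, hφ'⟩ := key _ fun K hK => L.contDiffAt_gradient hK
  obtain ⟨lam, hlam, hlam'⟩ := key L.realCost
    fun K hK => (L.contDiffAt_realCost hK).of_le (by exact le_top)
  refine ⟨⟨fun _ => φ, fun _ => δ, fun _ => lam, fun _ => δ⟩, ⟨fun _ _ => ⟨hφ, hδ, hlam, hδ⟩,
    fun K hK K' _ hK' => hφ' K hK K' hK', fun K hK K' _ hK' => hlam' K hK K' hK', ?_, ?_, ?_⟩⟩
  · exact ⟨φ, by rintro _ ⟨_, _, rfl⟩; exact le_rfl⟩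
  · exact ⟨lam, by rintro _ ⟨_, _, rfl⟩; exact le_rfl⟩
  · simp only [CurvatureParams.rho, min_self, hne.image_const, csInf_singleton, hδ]

/-! ### Balls inside the domain and measurability -/

/-- The Lipschitz bound speaks only of points already in the domain, so it is propagated along the
segment from `K`. The set of times with cost at most `b` is closed by lower semicontinuity. It can
be prolonged to the right because the domain is open and the Lipschitz bound restores `b`. -/
theorem mem_domain_of_locallyLipschitz {K K' : Policy m n} {lam ζ : ℝ} (hK : K ∈ L.domain)
    (hlam : 0 ≤ lam) (h : IsLocallyLipschitzAt L.realCost L.domain lam ζ K)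
    (hK' : ‖K' - K‖ ≤ ζ) : K' ∈ L.domain := by
  set b := L.realCost K + lam * ζ with hb
  have hζ : 0 ≤ ζ := (norm_nonneg _).trans hK'
  have hb0 : 0 ≤ b := by have := L.realCost_nonneg K; positivity
  let q : ℝ → Policy m n := fun t => K + t • (K' - K)
  have hq : Continuous q := by fun_prop
  have hbound : ∀ t ∈ Set.Icc (0 : ℝ) 1, q t ∈ L.domain → L.cost (q t) ≤ ENNReal.ofReal b := by
    intro t ht hd
    have h1 : ‖q t - K‖ ≤ ζ := by
      simp only [q, add_sub_cancel_left, norm_smul, Real.norm_eq_abs, abs_of_nonneg ht.1]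
      exact (mul_le_of_le_one_left (norm_nonneg _) ht.2).trans hK'
    have h2 := (abs_le.1 (h _ hd h1)).2
    refine (L.mem_domain_and_realCost_le_iff hb0).1 ⟨hd, ?_⟩
    have : lam * ‖q t - K‖ ≤ lam * ζ := by gcongr
    linarith
  have hclosed : IsClosed {t | L.cost (q t) ≤ ENNReal.ofReal b} :=
    (L.lowerSemicontinuous_cost.isClosed_preimage _).preimage hq
  have hsub : Set.Icc (0 : ℝ) 1 ⊆ {t | L.cost (q t) ≤ ENNReal.ofReal b} := by
    refine IsClosed.Icc_subset_of_forall_exists_gt (hclosed.inter isClosed_Icc) ?_ ?_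
    · refine hbound 0 ⟨le_rfl, zero_le_one⟩ ?_
      simpa [q] using hK
    · rintro t ⟨ht, ht1⟩ y hy
      have hd : q t ∈ L.domain := lt_of_le_of_lt ht ENNReal.ofReal_lt_top
      have hev : ∀ᶠ s in 𝓝[>] t, q s ∈ L.domain :=
        nhdsWithin_le_nhds (hq.continuousAt.eventually (L.isOpen_domain.mem_nhds hd))
      have hev2 : ∀ᶠ s in 𝓝[>] t, s ∈ Set.Ioc t (min y 1) :=
        Ioc_mem_nhdsGT (lt_min hy ht1.2)
      obtain ⟨s, hs, hs2⟩ := (hev.and hev2).exists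
      exact ⟨s, hbound s ⟨ht1.1.trans hs2.1.le, hs2.2.trans (min_le_right _ _)⟩ hs,
        hs2.1, hs2.2.trans (min_le_left _ _)⟩
  have h1 : L.cost (q 1) ≤ ENNReal.ofReal b := hsub ⟨zero_le_one, le_rfl⟩
  have h2 : q 1 = K' := by simp [q]
  rw [h2] at h1
  exact h1.trans_lt ENNReal.ofReal_lt_top

theorem measurable_sampleCost :
    Measurable fun p : Policy m n × LQRState m => L.sampleCost p.1 p.2 := by
  have hK : Continuous fun p : Policy m n × LQRState m => p.1.toMatrix := by
    refine continuous_matrix fun i j => ?_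
    simp only [Policy.toMatrix, Matrix.of_apply]
    fun_prop
  have hs : ∀ t, Continuous fun p : Policy m n × LQRState m => L.state p.1 p.2 t := by
    intro t
    induction t with
    | zero => exact continuous_snd
    | succ t ih =>
      exact (continuous_const.matrix_mulVec ih).add
        (continuous_const.matrix_mulVec (hK.matrix_mulVec ih).neg)
  have hu : ∀ t, Continuous fun p : Policy m n × LQRState m => L.control p.1 p.2 t :=
    fun t => (hK.matrix_mulVec (hs t)).neg
  refine Measurable.tsum fun t => Measurable.ennreal_ofReal (Continuous.measurable ?_)
  exact continuous_const.mul (((hs t).dotProduct (continuous_const.matrix_mulVec (hs t))).add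
    ((hu t).dotProduct (continuous_const.matrix_mulVec (hu t))))

theorem measurable_cost : Measurable L.cost := L.lowerSemicontinuous_cost.measurable

end LQR
end

noncomputable section

open scoped Topology NNReal
open Filter

/-! ### A divergence theorem for balls -/

section Divergence

variable {E : Type*} [NormedAddCommGroup E] [InnerProductSpace ℝ E]

theorem hasDerivAt_norm_line {y : E} (hy : y ≠ 0) (v : E) :
    HasDerivAt (fun t : ℝ => ‖y + t • v‖) (inner ℝ (‖y‖⁻¹ • y) v) 0 := by
  have hd : HasDerivAt (fun t : ℝ => y + t • v) v 0 := by
    simpa using ((hasDerivAt_id (0 : ℝ)).smul_const v).const_add y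
  have h1 := hd.norm_sq
  have h2 := h1.sqrt (by simpa using hy)
  simp only [zero_smul, add_zero, Real.sqrt_sq (norm_nonneg _)] at h2
  convert! h2 using 1
  rw [real_inner_smul_left]
  have : ‖y‖ ≠ 0 := norm_ne_zero_iff.2 hy
  field_simp

/-- The cone is the test function for the divergence theorem: its derivative is the radial field on
the ball, and its derivative in the height `s` is the indicator of the ball. -/
theorem lineDeriv_cone {s : ℝ} (v : E) {y : E} (hy : y ≠ 0) (hys : ‖y‖ ≠ s) :
    lineDeriv ℝ (fun x : E => max 0 (s - ‖x‖)) y (-v) =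
      (Metric.ball (0 : E) s).indicator (fun y => inner ℝ (‖y‖⁻¹ • y) v) y := by
  have hcont : Continuous fun t : ℝ => ‖y + t • -v‖ := by fun_prop
  have h0 : ‖y + (0 : ℝ) • -v‖ = ‖y‖ := by simp
  refine HasLineDerivAt.lineDeriv ?_
  unfold HasLineDerivAt
  rcases lt_or_gt_of_ne hys with h | h
  · rw [Set.indicator_of_mem (by simpa using h)]
    have h1 := (hasDerivAt_norm_line hy (-v)).const_sub s
    rw [inner_neg_right, neg_neg] at h1
    refine h1.congr_of_eventuallyEq ?_
    filter_upwards [hcont.continuousAt.eventually (gt_mem_nhds (h0.trans_lt h))] with t ht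
    exact max_eq_right (by linarith)
  · rw [Set.indicator_of_notMem (by simpa using h.le)]
    refine (hasDerivAt_const (0 : ℝ) (0 : ℝ)).congr_of_eventuallyEq ?_
    filter_upwards [hcont.continuousAt.eventually (lt_mem_nhds (h.trans_eq h0.symm))] with t ht
    exact max_eq_left (by linarith)

variable [FiniteDimensional ℝ E] [MeasurableSpace E] [BorelSpace E]

theorem continuous_integral_sphere {f : E → ℝ} (hf : Continuous f) (w : E) :
    Continuous fun t : ℝ => ∫ u : Metric.sphere (0 : E) 1, f (t • u.1) * inner ℝ u.1 w
      ∂(volume : Measure E).toSphere := by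
  refine continuous_parametric_integral_of_continuous ?_ (s := Set.univ) isCompact_univ |>.congr
    (fun t => by rw [setIntegral_univ])
  fun_prop

variable [Nontrivial E]

/-- Polar coordinates; the origin is a null set. -/
theorem integral_eq_integral_sphere {g : E → ℝ} (hg : Integrable g) :
    ∫ x, g x = ∫ t in Set.Ioi (0 : ℝ), t ^ (Module.finrank ℝ E - 1) *
      ∫ u : Metric.sphere (0 : E) 1, g (t • u.1) ∂(volume : Measure E).toSphere := by
  set μ : Measure E := volume
  have hmp := μ.measurePreserving_homeomorphUnitSphereProd
  have hemb := (homeomorphUnitSphereProd E).measurableEmbedding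
  have hcomp : ∀ x : ({0}ᶜ : Set E), (fun p : Metric.sphere (0 : E) 1 × Set.Ioi (0 : ℝ) =>
      g (p.2.1 • p.1.1)) (homeomorphUnitSphereProd E x) = g x.1 := by
    intro x
    have hx : ‖x.1‖ ≠ 0 := norm_ne_zero_iff.2 x.2
    simp [smul_smul, hx]
  have h1 : ∫ x, g x ∂μ = ∫ x : ({0}ᶜ : Set E), g x.1 ∂(μ.comap (↑)) := by
    rw [integral_subtype_comap (measurableSet_singleton _).compl g, restrict_compl_singleton]
  have h2 := hmp.integral_comp hemb (fun p : Metric.sphere (0 : E) 1 × Set.Ioi (0 : ℝ) =>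
      g (p.2.1 • p.1.1))
  have h3 : Integrable (fun p : Metric.sphere (0 : E) 1 × Set.Ioi (0 : ℝ) => g (p.2.1 • p.1.1))
      (μ.toSphere.prod (.volumeIoiPow (Module.finrank ℝ E - 1))) := by
    rw [← hmp.integrable_comp_emb hemb]
    have : (fun p : Metric.sphere (0 : E) 1 × Set.Ioi (0 : ℝ) => g (p.2.1 • p.1.1)) ∘
      (homeomorphUnitSphereProd E) = fun x => g x.1 := funext hcomp
    rw [this]
    exact (integrableOn_iff_comap_subtypeVal (measurableSet_singleton _).compl).1 hg.integrableOn
  simp only [hcomp] at h2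
  rw [h1, h2, integral_prod_symm _ h3]
  simp only [Measure.volumeIoiPow, ENNReal.ofReal]
  rw [integral_withDensity_eq_integral_smul
      (measurable_subtype_coe.pow_const _).real_toNNReal,
    integral_subtype_comap measurableSet_Ioi fun a : ℝ =>
      Real.toNNReal (a ^ (Module.finrank ℝ E - 1)) •
        ∫ u : Metric.sphere (0 : E) 1, g (a • u.1) ∂μ.toSphere]
  refine setIntegral_congr_fun measurableSet_Ioi fun x hx => ?_
  simp only [NNReal.smul_def, Real.coe_toNNReal _ (pow_nonneg (le_of_lt hx) _), smul_eq_mul]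

theorem integral_ball_radial {f : E → ℝ} (hf : Continuous f) (w : E) {s : ℝ} (hs : 0 < s) :
    ∫ y in Metric.ball (0 : E) s, f y * inner ℝ (‖y‖⁻¹ • y) w =
      ∫ t in (0)..s, t ^ (Module.finrank ℝ E - 1) *
        ∫ u : Metric.sphere (0 : E) 1, f (t • u.1) * inner ℝ u.1 w
          ∂(volume : Measure E).toSphere := by
  have hint : IntegrableOn (fun y : E => f y * inner ℝ (‖y‖⁻¹ • y) w) (Metric.ball 0 s) := by
    obtain ⟨c, hc⟩ := (isCompact_closedBall (0 : E) s).exists_bound_of_continuousOn hf.continuousOn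
    refine Measure.integrableOn_of_bounded (M := c * ‖w‖) measure_ball_lt_top.ne
      (by have := hf.measurable; fun_prop) ?_
    refine (ae_restrict_mem measurableSet_ball).mono fun y hy => ?_
    rw [norm_mul]
    have h1 := hc y (Metric.ball_subset_closedBall hy)
    have h2 : ‖inner ℝ (‖y‖⁻¹ • y) w‖ ≤ ‖w‖ := by
      refine (norm_inner_le_norm _ _).trans (mul_le_of_le_one_left (norm_nonneg _) ?_)
      rw [norm_smul, norm_inv, norm_norm]
      exact inv_mul_le_one
    exact mul_le_mul h1 h2 (norm_nonneg _) ((norm_nonneg _).trans h1)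
  rw [← integral_indicator measurableSet_ball,
    integral_eq_integral_sphere (hint.integrable_indicator measurableSet_ball),
    intervalIntegral.integral_of_le hs.le]
  have hsub : Set.Ioc 0 s ⊆ Set.Ioi (0 : ℝ) := Set.Ioc_subset_Ioi_self
  rw [integral_Ioc_eq_integral_Ioo, ← integral_indicator measurableSet_Ioi,
    ← integral_indicator measurableSet_Ioo]
  congr 1
  funext t
  by_cases ht : 0 < t
  · rw [Set.indicator_of_mem (show t ∈ Set.Ioi 0 from ht)]
    by_cases hts : t < s
    · rw [Set.indicator_of_mem (show t ∈ Set.Ioo 0 s from ⟨ht, hts⟩)]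
      congr 1
      refine integral_congr_ae (ae_of_all _ fun u => ?_)
      have hu : ‖u.1‖ = 1 := by simp
      have hn : ‖t • u.1‖ = t := by rw [norm_smul, hu, mul_one, Real.norm_of_nonneg ht.le]
      have hm : t • u.1 ∈ Metric.ball (0 : E) s := by rwa [mem_ball_zero_iff, hn]
      simp only [Set.indicator_of_mem hm]
      rw [hn, smul_smul, inv_mul_cancel₀ ht.ne', one_smul]
    · rw [Set.indicator_of_notMem (fun h : t ∈ Set.Ioo 0 s => hts h.2)]
      refine mul_eq_zero_of_right _ ?_
      rw [← integral_zero (Metric.sphere (0 : E) 1) ℝ (μ := (volume : Measure E).toSphere)]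
      refine integral_congr_ae (ae_of_all _ fun u => ?_)
      have hu : ‖u.1‖ = 1 := by simp
      have hn : ‖t • u.1‖ = t := by rw [norm_smul, hu, mul_one, Real.norm_of_nonneg ht.le]
      have hm : t • u.1 ∉ Metric.ball (0 : E) s := by rwa [mem_ball_zero_iff, hn]
      exact Set.indicator_of_notMem hm _
  · rw [Set.indicator_of_notMem (fun h : t ∈ Set.Ioi 0 => ht h),
      Set.indicator_of_notMem (fun h : t ∈ Set.Ioo 0 s => ht h.1)]

/-- Integration by parts for Lipschitz functions moves the derivative onto the cone, leaving a
radial integral that polar coordinates evaluate. -/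
theorem integral_lineDeriv_mul_cone {f : E → ℝ} {C : ℝ≥0} (hf : LipschitzWith C f) (w : E)
    {s : ℝ} (hs : 0 < s) :
    ∫ y, lineDeriv ℝ f y w * max 0 (s - ‖y‖) =
      ∫ t in (0)..s, t ^ (Module.finrank ℝ E - 1) *
        ∫ u : Metric.sphere (0 : E) 1, f (t • u.1) * inner ℝ u.1 w
          ∂(volume : Measure E).toSphere := by
  have hlip : LipschitzWith 1 (fun x : E => max 0 (s - ‖x‖)) := by
    refine LipschitzWith.of_dist_le_mul fun x y => ?_
    rw [NNReal.coe_one, one_mul, Real.dist_eq, dist_eq_norm]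
    rw [max_comm 0, max_comm 0]
    refine (abs_max_sub_max_le_abs _ _ _).trans ?_
    rw [sub_sub_sub_cancel_left, abs_sub_comm]
    exact abs_norm_sub_norm_le x y
  have hsupp : HasCompactSupport (fun x : E => max 0 (s - ‖x‖)) := by
    refine HasCompactSupport.intro (isCompact_closedBall (0 : E) s) fun x hx => ?_
    rw [mem_closedBall_zero_iff, not_le] at hx
    exact max_eq_left (by linarith)
  rw [LipschitzWith.integral_lineDeriv_mul_eq hf hlip hsupp, ← integral_ball_radial hf.continuous w hs,
    ← integral_indicator measurableSet_ball]
  refine integral_congr_ae ?_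
  have h1 : ∀ᵐ y : E, y ≠ 0 := Measure.ae_ne volume 0
  have h2 : ∀ᵐ y : E, ‖y‖ ≠ s := by
    have := Measure.addHaar_sphere (volume : Measure E) 0 s
    refine (measure_eq_zero_iff_ae_notMem.1 this).mono fun y hy => ?_
    simpa using hy
  filter_upwards [h1, h2] with y hy hys
  rw [lineDeriv_cone w hy hys]
  by_cases h : y ∈ Metric.ball (0 : E) s
  · rw [Set.indicator_of_mem h, Set.indicator_of_mem h, mul_comm]
  · rw [Set.indicator_of_notMem h, Set.indicator_of_notMem h, zero_mul]

/-- Differentiation under the integral: `max 0 (s - ‖y‖)` is 1-Lipschitz in `s`, with derivative the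
indicator of the ball except on a null sphere. -/
theorem hasDerivAt_integral_mul_cone {f : E → ℝ} {C : ℝ≥0} (hf : LipschitzWith C f) (w : E)
    {r : ℝ} (hr : 0 < r) :
    HasDerivAt (fun s => ∫ y, lineDeriv ℝ f y w * max 0 (s - ‖y‖))
      (∫ y in Metric.ball (0 : E) r, lineDeriv ℝ f y w) r := by
  have hmeas := measurable_lineDeriv (𝕜 := ℝ) (v := w) hf.continuous
  have hb : ∀ y, ‖lineDeriv ℝ f y w‖ ≤ C * ‖w‖ := fun y =>
    norm_lineDeriv_le_of_lipschitz ℝ hf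
  rw [← integral_indicator measurableSet_ball]
  have hbi : Integrable ((Metric.ball (0 : E) (r + 1)).indicator fun _ => (C * ‖w‖ : ℝ)) := by
    rw [integrable_indicator_iff measurableSet_ball]
    exact integrableOn_const measure_ball_lt_top.ne
  refine (hasDerivAt_integral_of_dominated_loc_of_lip (s := Metric.ball r 1)
    (bound := (Metric.ball (0 : E) (r + 1)).indicator fun _ => (C * ‖w‖ : ℝ))
    (Metric.ball_mem_nhds r one_pos) (Eventually.of_forall fun s => ?_) ?_ ?_ ?_ hbi ?_).2
  · exact (by fun_prop : Measurable _).aestronglyMeasurable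
  · refine (hbi.const_mul r).mono' (by fun_prop) (ae_of_all _ fun y => ?_)
    by_cases h : y ∈ Metric.ball (0 : E) (r + 1)
    · rw [Set.indicator_of_mem h, norm_mul, mul_comm]
      refine mul_le_mul ?_ (hb y) (norm_nonneg _) hr.le
      rw [Real.norm_of_nonneg (le_max_left _ _)]
      exact max_le hr.le (by linarith [norm_nonneg y])
    · rw [mem_ball_zero_iff, not_lt] at h
      rw [max_eq_left (by linarith), mul_zero, norm_zero]
      exact mul_nonneg hr.le (Set.indicator_nonneg (fun _ _ => by positivity) _)
  · exact ((hmeas.indicator measurableSet_ball)).aestronglyMeasurable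
  · refine ae_of_all _ fun y => LipschitzOnWith.of_dist_le_mul fun a ha b hb' => ?_
    rw [Metric.mem_ball, Real.dist_eq, abs_lt] at ha hb'
    rw [Real.dist_eq, ← mul_sub, abs_mul, Real.coe_nnabs, Real.dist_eq]
    by_cases h : y ∈ Metric.ball (0 : E) (r + 1)
    · rw [Set.indicator_of_mem h]
      refine mul_le_mul ((hb y).trans (le_abs_self _)) ?_ (abs_nonneg _) (abs_nonneg _)
      have := abs_max_sub_max_le_abs (a - ‖y‖) (b - ‖y‖) 0
      rw [max_comm 0, max_comm 0]
      simpa using this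
    · rw [Set.indicator_of_notMem h]
      rw [mem_ball_zero_iff, not_lt] at h
      rw [max_eq_left (by linarith), max_eq_left (by linarith)]
      simp
  · have h2 : ∀ᵐ y : E, ‖y‖ ≠ r := by
      have := Measure.addHaar_sphere (volume : Measure E) 0 r
      refine (measure_eq_zero_iff_ae_notMem.1 this).mono fun y hy => ?_
      simpa using hy
    filter_upwards [h2] with y hy
    rcases lt_or_gt_of_ne hy with h | h
    · rw [Set.indicator_of_mem (by simpa using h)]
      have h1 : HasDerivAt (fun s : ℝ => lineDeriv ℝ f y w * (s - ‖y‖)) (lineDeriv ℝ f y w) r := by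
        simpa using ((hasDerivAt_id r).sub_const ‖y‖).const_mul (lineDeriv ℝ f y w)
      refine h1.congr_of_eventuallyEq ?_
      filter_upwards [lt_mem_nhds h] with s hs
      rw [max_eq_right (by linarith)]
    · rw [Set.indicator_of_notMem (by simpa using h.le)]
      refine (hasDerivAt_const r (0 : ℝ)).congr_of_eventuallyEq ?_
      filter_upwards [gt_mem_nhds h] with s hs
      rw [max_eq_left (by linarith), mul_zero]

/-- The divergence theorem on a ball, for a vector field of constant direction. -/
theorem integral_ball_lineDeriv {f : E → ℝ} {C : ℝ≥0} (hf : LipschitzWith C f) (w : E)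
    {r : ℝ} (hr : 0 < r) :
    ∫ y in Metric.ball (0 : E) r, lineDeriv ℝ f y w =
      r ^ (Module.finrank ℝ E - 1) *
        ∫ u : Metric.sphere (0 : E) 1, f (r • u.1) * inner ℝ u.1 w
          ∂(volume : Measure E).toSphere := by
  -- Both sides are the derivative at `r` of the integral against the cone, the right one by the
  -- fundamental theorem of calculus.
  refine (hasDerivAt_integral_mul_cone hf w hr).unique ?_
  have hc : Continuous fun t : ℝ => t ^ (Module.finrank ℝ E - 1) *
        ∫ u : Metric.sphere (0 : E) 1, f (t • u.1) * inner ℝ u.1 w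
          ∂(volume : Measure E).toSphere :=
    (continuous_id.pow _).mul (continuous_integral_sphere hf.continuous w)
  refine (hc.integral_hasStrictDerivAt 0 r).hasDerivAt.congr_of_eventuallyEq ?_
  filter_upwards [lt_mem_nhds hr] with s hs
  exact integral_lineDeriv_mul_cone hf w hs

/-- The average of `F (x + r u) u` over the unit sphere, times `D / r`, is within `φ r` of the
gradient of `F` at `x`. -/
theorem abs_sphere_average_sub_inner_gradient_le {F : E → ℝ} {x : E} {φ r : ℝ} (hφ : 0 ≤ φ)
    (hr : 0 < r) (hF : ∀ y ∈ Metric.closedBall x r, DifferentiableAt ℝ F y)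
    (hg : ∀ y ∈ Metric.closedBall x r, ‖gradient F y - gradient F x‖ ≤ φ * ‖y - x‖) (w : E) :
    |(Module.finrank ℝ E : ℝ) / r * (((volume : Measure E).toSphere.real Set.univ)⁻¹ *
      ∫ u : Metric.sphere (0 : E) 1, F (x + r • u.1) * inner ℝ u.1 w
        ∂(volume : Measure E).toSphere) - inner ℝ (gradient F x) w| ≤ φ * r * ‖w‖ := by
  have hg' : ∀ y ∈ Metric.closedBall x r, ‖gradient F y - gradient F x‖ ≤ φ * r := by
    intro y hy
    refine (hg y hy).trans ?_
    gcongr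
    rwa [mem_closedBall_iff_norm] at hy
  set Λ : ℝ≥0 := NNReal.mk (‖gradient F x‖ + φ * r) (by positivity) with hΛ
  have hlip : LipschitzOnWith Λ (fun y => F (x + y)) (Metric.closedBall 0 r) := by
    have h1 : LipschitzOnWith Λ F (Metric.closedBall x r) := by
      refine (convex_closedBall x r).lipschitzOnWith_of_nnnorm_fderiv_le (𝕜 := ℝ) hF
        fun y hy => ?_
      rw [← NNReal.coe_le_coe, coe_nnnorm, hΛ, NNReal.coe_mk, ← toDual_gradient,
        LinearIsometryEquiv.norm_map]
      have := norm_le_norm_add_norm_sub' (gradient F y) (gradient F x)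
      linarith [hg' y hy]
    refine LipschitzOnWith.of_dist_le_mul fun a ha b hb => ?_
    have := h1.dist_le_mul (x + a) (by simpa using ha) (x + b) (by simpa using hb)
    simpa using this
  -- `F` is controlled only on the ball, whereas the divergence theorem asks for a globally
  -- Lipschitz function; an extension agrees with `F` where it matters.
  obtain ⟨f, hf, hfe⟩ := hlip.extend_real
  have hdiv := integral_ball_lineDeriv hf w hr
  have hline : ∀ y ∈ Metric.ball (0 : E) r,
      lineDeriv ℝ f y w = inner ℝ (gradient F (x + y)) w := by
    intro y hy
    have hy' : x + y ∈ Metric.closedBall x r := by simpa using (mem_ball_zero_iff.1 hy).le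
    have h1 : HasFDerivAt (fun y => F (x + y)) (fderiv ℝ F (x + y)) y := by
      exact (hF _ hy').hasFDerivAt.comp y ((hasFDerivAt_id y).const_add x)
    have h2 : f =ᶠ[𝓝 y] fun y => F (x + y) := by
      filter_upwards [Metric.isOpen_ball.mem_nhds hy] with z hz
      exact (hfe (Metric.ball_subset_closedBall hz)).symm
    rw [((h1.congr_of_eventuallyEq h2).hasLineDerivAt w).lineDeriv, inner_gradient_left]
  have hsphere : ∀ u : Metric.sphere (0 : E) 1, f (r • u.1) = F (x + r • u.1) := fun u =>
    (hfe (by simp [norm_smul, abs_of_pos hr])).symm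
  simp only [hsphere] at hdiv
  set I := ∫ u : Metric.sphere (0 : E) 1, F (x + r • u.1) * inner ℝ u.1 w
        ∂(volume : Measure E).toSphere with hI
  set D := Module.finrank ℝ E with hD
  have hD0 : 0 < D := Module.finrank_pos
  set v := (volume : Measure E).real (Metric.ball 0 1) with hv
  have hv0 : 0 < v := ENNReal.toReal_pos (Metric.measure_ball_pos _ _ one_pos).ne'
    measure_ball_lt_top.ne
  have hvr : (volume : Measure E).real (Metric.ball 0 r) = r ^ D * v := by
    rw [Measure.real, Measure.addHaar_ball_of_pos _ _ hr, ENNReal.toReal_mul,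
      ENNReal.toReal_ofReal (by positivity)]
    rfl
  have hbound : ‖∫ y in Metric.ball (0 : E) r,
      (lineDeriv ℝ f y w - inner ℝ (gradient F x) w)‖ ≤ φ * r * ‖w‖ * (r ^ D * v) := by
    rw [← hvr]
    refine norm_setIntegral_le_of_norm_le_const measure_ball_lt_top fun y hy => ?_
    rw [hline y hy, ← inner_sub_left]
    refine (norm_inner_le_norm _ _).trans ?_
    gcongr
    exact hg' _ (by simpa using (mem_ball_zero_iff.1 hy).le)
  have hint : IntegrableOn (fun y => lineDeriv ℝ f y w) (Metric.ball 0 r) :=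
    Measure.integrableOn_of_bounded (M := Λ * ‖w‖) measure_ball_lt_top.ne
      (measurable_lineDeriv hf.continuous).aestronglyMeasurable
      (ae_of_all _ fun y => norm_lineDeriv_le_of_lipschitz ℝ hf)
  rw [integral_sub hint (integrableOn_const measure_ball_lt_top.ne), hdiv, setIntegral_const, hvr,
    smul_eq_mul, Real.norm_eq_abs] at hbound
  rw [Measure.toSphere_real_apply_univ, ← hv, ← hD]
  have hrD : r ^ D = r ^ (D - 1) * r := by rw [← pow_succ, Nat.sub_add_cancel hD0]
  have hpos : 0 < r ^ D * v := by positivity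
  have heq : (D : ℝ) / r * ((D * v)⁻¹ * I) - inner ℝ (gradient F x) w =
      (r ^ (D - 1) * I - r ^ D * v * inner ℝ (gradient F x) w) / (r ^ D * v) := by
    rw [hrD]
    have : (D : ℝ) ≠ 0 := by exact_mod_cast hD0.ne'
    field_simp
  rw [heq, abs_div, abs_of_pos hpos, div_le_iff₀ hpos]
  exact hbound

end Divergence
end

noncomputable section

open scoped Topology NNReal
open Filter

/-! ### Concentration of sums of independent bounded vectors -/

section Concentration

/-- In `z` this is a power series with nonnegative coefficients. -/
theorem convexOn_cosh_sqrt : ConvexOn ℝ (Set.Ici 0) fun z : ℝ => Real.cosh (Real.sqrt z) := by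
  have hs : ∀ z : ℝ, 0 ≤ z →
      HasSum (fun k : ℕ => z ^ k / ((2 * k).factorial : ℝ)) (Real.cosh (Real.sqrt z)) := by
    intro z hz
    have := Real.hasSum_cosh (Real.sqrt z)
    simpa only [pow_mul, Real.sq_sqrt hz] using this
  refine ⟨convex_Ici 0, fun x hx y hy a b ha hb hab => ?_⟩
  have hx' : 0 ≤ x := hx
  have hy' : 0 ≤ y := hy
  simp only [smul_eq_mul]
  refine hasSum_le (fun k => ?_) (hs (a * x + b * y) (by positivity))
    (((hs x hx').mul_left a).add ((hs y hy').mul_left b))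
  have := (convexOn_pow k).2 hx hy ha hb hab
  simp only [smul_eq_mul] at this
  calc (a * x + b * y) ^ k / ((2 * k).factorial : ℝ)
      ≤ (a * x ^ k + b * y ^ k) / ((2 * k).factorial : ℝ) := by gcongr
    _ = _ := by ring

/-- The argument is the convex combination of `(p + q)²` and `(p - q)²` with weights `(1 ± c) / 2`.
-/
theorem cosh_sqrt_le {p q c : ℝ} (hc : |c| ≤ 1) :
    Real.cosh (Real.sqrt (p ^ 2 + q ^ 2 + 2 * c * (p * q))) ≤
      Real.cosh p * Real.cosh q + c * (Real.sinh p * Real.sinh q) := by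
  rw [abs_le] at hc
  have h := convexOn_cosh_sqrt.2 (sq_nonneg (p + q)) (sq_nonneg (p - q))
    (by linarith : 0 ≤ (1 + c) / 2) (by linarith : 0 ≤ (1 - c) / 2) (by ring)
  simp only [smul_eq_mul, Real.sqrt_sq_eq_abs, Real.cosh_abs, Real.cosh_add, Real.cosh_sub] at h
  have h1 : (1 + c) / 2 * (p + q) ^ 2 + (1 - c) / 2 * (p - q) ^ 2 =
      p ^ 2 + q ^ 2 + 2 * c * (p * q) := by ring
  rw [h1] at h
  linarith

theorem integrable_cosh_norm {E Ω : Type*} [NormedAddCommGroup E] [MeasurableSpace E]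
    [BorelSpace E] [MeasurableSpace Ω] {P : Measure Ω} [IsProbabilityMeasure P] {S : Ω → E} (hS : Measurable S) {B : ℝ} (hB : ∀ᵐ ω ∂P, ‖S ω‖ ≤ B)
    {l : ℝ} (hl : 0 ≤ l) : Integrable (fun ω => Real.cosh (l * ‖S ω‖)) P := by
  refine Integrable.of_bound (C := Real.cosh (l * B))
    (Real.continuous_cosh.measurable.comp (by fun_prop)).aestronglyMeasurable ?_
  filter_upwards [hB] with ω hω
  rw [Real.norm_of_nonneg (Real.cosh_pos _).le, Real.cosh_le_cosh,
    abs_of_nonneg (by positivity), abs_of_nonneg (mul_nonneg hl ((norm_nonneg _).trans hω))]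
  gcongr

variable {E : Type*} [NormedAddCommGroup E] [InnerProductSpace ℝ E]

/-- The bound is affine in `y`, so averaging over a centered `y` leaves only the factor `cosh (l
b)`. It is the law of cosines with `c = ⟨x, y⟩ / (‖x‖ b)`. -/
theorem cosh_norm_add_le {l b : ℝ} (hl : 0 ≤ l) (hb : 0 < b) (x : E) {y : E} (hy : ‖y‖ ≤ b) :
    Real.cosh (l * ‖x + y‖) ≤ Real.cosh (l * b) * Real.cosh (l * ‖x‖) +
      Real.sinh (l * ‖x‖) * Real.sinh (l * b) / (‖x‖ * b) * inner ℝ x y := by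
  set c := inner ℝ x y / (‖x‖ * b) with hc
  have hin : |inner ℝ x y| ≤ ‖x‖ * b :=
    (abs_real_inner_le_norm x y).trans (by gcongr)
  have hc1 : |c| ≤ 1 := by
    rw [hc, abs_div, abs_of_nonneg (by positivity : 0 ≤ ‖x‖ * b)]
    exact div_le_one_of_le₀ hin (by positivity)
  have hcm : c * (‖x‖ * b) = inner ℝ x y := by
    by_cases hx : x = 0
    · simp [hx]
    · have : ‖x‖ ≠ 0 := norm_ne_zero_iff.2 hx
      rw [hc]; field_simp
  have h := cosh_sqrt_le (p := l * ‖x‖) (q := l * b) hc1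
  have h2 : l * ‖x + y‖ ≤
      Real.sqrt ((l * ‖x‖) ^ 2 + (l * b) ^ 2 + 2 * c * (l * ‖x‖ * (l * b))) := by
    refine Real.le_sqrt_of_sq_le ?_
    have h3 : (l * ‖x‖) ^ 2 + (l * b) ^ 2 + 2 * c * (l * ‖x‖ * (l * b)) =
        l ^ 2 * (‖x‖ ^ 2 + b ^ 2 + 2 * inner ℝ x y) := by rw [← hcm]; ring
    rw [h3, mul_pow, norm_add_sq_real]
    have : ‖y‖ ^ 2 ≤ b ^ 2 := by gcongr
    gcongr ?_ * ?_
    linarith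
  refine (Real.cosh_le_cosh.2 ?_).trans (h.trans_eq ?_)
  · rwa [abs_of_nonneg (by positivity), abs_of_nonneg (Real.sqrt_nonneg _)]
  · rw [hc]; ring

variable [MeasurableSpace E] [BorelSpace E] [FiniteDimensional ℝ E]
variable {Ω : Type*} [MeasurableSpace Ω] {P : Measure Ω} [IsProbabilityMeasure P]

theorem integral_cosh_norm_add_le {S Y : Ω → E} (hS : Measurable S) (hY : Measurable Y)
    (hind : IndepFun S Y P) {B b l : ℝ} (hB : ∀ᵐ ω ∂P, ‖S ω‖ ≤ B) (hb : 0 < b)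
    (hYb : ∀ᵐ ω ∂P, ‖Y ω‖ ≤ b) (hY0 : ∫ ω, Y ω ∂P = 0) (hl : 0 ≤ l) :
    ∫ ω, Real.cosh (l * ‖S ω + Y ω‖) ∂P ≤ Real.cosh (l * b) * ∫ ω, Real.cosh (l * ‖S ω‖) ∂P := by
  have hSY : ∀ᵐ ω ∂P, ‖S ω + Y ω‖ ≤ B + b := by
    filter_upwards [hB, hYb] with ω h1 h2
    exact (norm_add_le _ _).trans (add_le_add h1 h2)
  have hmap := (indepFun_iff_map_prod_eq_prod_map_map hS.aemeasurable hY.aemeasurable).1 hind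
  set μ := P.map S
  set ν := P.map Y
  have : IsProbabilityMeasure μ := Measure.isProbabilityMeasure_map hS.aemeasurable
  have : IsProbabilityMeasure ν := Measure.isProbabilityMeasure_map hY.aemeasurable
  have hm : Measurable fun p : E × E => Real.cosh (l * ‖p.1 + p.2‖) :=
    Real.continuous_cosh.measurable.comp (by fun_prop)
  have hint : Integrable (fun p : E × E => Real.cosh (l * ‖p.1 + p.2‖)) (μ.prod ν) := by
    rw [← hmap, integrable_map_measure hm.aestronglyMeasurable (hS.prodMk hY).aemeasurable]
    exact integrable_cosh_norm (hS.add hY) hSY hl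
  have h1 : ∫ ω, Real.cosh (l * ‖S ω + Y ω‖) ∂P =
      ∫ p : E × E, Real.cosh (l * ‖p.1 + p.2‖) ∂(μ.prod ν) := by
    rw [← hmap, integral_map (hS.prodMk hY).aemeasurable hm.aestronglyMeasurable]
  have hνb : ∀ᵐ y ∂ν, ‖y‖ ≤ b :=
    (ae_map_iff hY.aemeasurable (measurableSet_le measurable_norm measurable_const)).2 hYb
  have hνi : Integrable (fun y : E => y) ν :=
    Integrable.of_bound (C := b) (by fun_prop) hνb
  have hν0 : ∫ y, y ∂ν = 0 := by
    rw [integral_map hY.aemeasurable (by fun_prop), hY0]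
  have hinner : ∀ s : E, ∫ y, Real.cosh (l * ‖s + y‖) ∂ν ≤
      Real.cosh (l * b) * Real.cosh (l * ‖s‖) := by
    intro s
    set a := Real.sinh (l * ‖s‖) * Real.sinh (l * b) / (‖s‖ * b)
    have hi : Integrable (fun y : E => inner ℝ s y) ν := hνi.const_inner s
    calc ∫ y, Real.cosh (l * ‖s + y‖) ∂ν
        ≤ ∫ y, (Real.cosh (l * b) * Real.cosh (l * ‖s‖) + a * inner ℝ s y) ∂ν := by
          refine integral_mono_ae ?_ ((integrable_const _).add (hi.const_mul a)) ?_
          · refine integrable_cosh_norm (S := fun y : E => s + y) (B := ‖s‖ + b) (by fun_prop) ?_ hl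
            filter_upwards [hνb] with y hy
            exact (norm_add_le _ _).trans (by gcongr)
          · filter_upwards [hνb] with y hy
            exact cosh_norm_add_le hl hb s hy
      _ = _ := by
          have h0 : ∫ y, inner ℝ s y ∂ν = 0 := by
            rw [integral_inner hνi, hν0, inner_zero_right]
          rw [integral_add (integrable_const _) (hi.const_mul a), integral_const_mul a, h0,
            mul_zero, add_zero, integral_const, probReal_univ, one_smul]
  have hSint : Integrable (fun s : E => Real.cosh (l * ‖s‖)) μ := by
    refine integrable_cosh_norm (S := fun s : E => s) (B := B) measurable_id ?_ hl
    exact (ae_map_iff hS.aemeasurable (measurableSet_le measurable_norm measurable_const)).2 hB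
  rw [h1, integral_prod _ hint]
  calc ∫ s, ∫ y, Real.cosh (l * ‖s + y‖) ∂ν ∂μ
      ≤ ∫ s, Real.cosh (l * b) * Real.cosh (l * ‖s‖) ∂μ :=
        integral_mono hint.integral_prod_left (hSint.const_mul _) hinner
    _ = _ := by
      rw [integral_const_mul, integral_map hS.aemeasurable hSint.aestronglyMeasurable]

theorem integral_cosh_norm_sum_le {X : ℕ → Ω → E} (hX : ∀ i, Measurable (X i))
    (hind : iIndepFun X P) {b l : ℝ} (hb : 0 < b) (hXb : ∀ i, ∀ᵐ ω ∂P, ‖X i ω‖ ≤ b)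
    (hX0 : ∀ i, ∫ ω, X i ω ∂P = 0) (hl : 0 ≤ l) (k : ℕ) :
    (∀ᵐ ω ∂P, ‖∑ i ∈ Finset.range k, X i ω‖ ≤ k * b) ∧
    ∫ ω, Real.cosh (l * ‖∑ i ∈ Finset.range k, X i ω‖) ∂P ≤ Real.cosh (l * b) ^ k := by
  induction k with
  | zero => simp
  | succ k ih =>
    refine ⟨?_, ?_⟩
    · filter_upwards [ih.1, hXb k] with ω h1 h2
      rw [Finset.sum_range_succ]
      push_cast
      exact (norm_add_le _ _).trans (by linarith)
    · have hi : IndepFun (fun ω => ∑ i ∈ Finset.range k, X i ω) (X k) P := by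
        have := hind.indepFun_finsetSum_of_notMem hX (Finset.notMem_range_self (n := k))
        convert this using 1
        funext ω; simp
      simp only [Finset.sum_range_succ]
      refine (integral_cosh_norm_add_le (Finset.measurable_fun_sum _ fun i _ => hX i) (hX k) hi
        ih.1 hb (hXb k) (hX0 k) hl).trans ?_
      rw [pow_succ']
      have := Real.cosh_pos (l * b)
      gcongr
      exact ih.2

/-- A dimension-free Hoeffding inequality for sums of independent, centered, bounded vectors. -/
theorem measureReal_norm_sum_ge_le {X : ℕ → Ω → E} (hX : ∀ i, Measurable (X i))
    (hind : iIndepFun X P) {b t : ℝ} (hb : 0 < b) (hXb : ∀ i, ∀ᵐ ω ∂P, ‖X i ω‖ ≤ b)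
    (hX0 : ∀ i, ∫ ω, X i ω ∂P = 0) (ht : 0 ≤ t) (k : ℕ) :
    P.real {ω | k * t ≤ ‖∑ i ∈ Finset.range k, X i ω‖} ≤
      2 * Real.exp (-(k * t ^ 2 / (2 * b ^ 2))) := by
  -- This minimizes the exponent `k (l² b² / 2 - l t)` in the exponential Markov bound.
  set l := t / b ^ 2 with hl
  have hl0 : 0 ≤ l := by positivity
  obtain ⟨h1, h2⟩ := integral_cosh_norm_sum_le hX hind hb hXb hX0 hl0 k
  have hSm : Measurable fun ω => ∑ i ∈ Finset.range k, X i ω :=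
    Finset.measurable_fun_sum _ fun i _ => hX i
  have h3 := mul_meas_ge_le_integral_of_nonneg (μ := P)
    (f := fun ω => Real.cosh (l * ‖∑ i ∈ Finset.range k, X i ω‖))
    (ae_of_all _ fun ω => (Real.cosh_pos _).le) (integrable_cosh_norm hSm h1 hl0)
    (Real.cosh (l * (k * t)))
  have h4 : P.real {ω | k * t ≤ ‖∑ i ∈ Finset.range k, X i ω‖} ≤
      P.real {ω | Real.cosh (l * (k * t)) ≤
        Real.cosh (l * ‖∑ i ∈ Finset.range k, X i ω‖)} := by
    refine measureReal_mono fun ω hω => ?_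
    have hω' : k * t ≤ ‖∑ i ∈ Finset.range k, X i ω‖ := hω
    refine Real.cosh_le_cosh.2 ?_
    rw [abs_of_nonneg (by positivity), abs_of_nonneg (by positivity)]
    gcongr
  have h5 : Real.cosh (l * b) ^ k ≤ Real.exp (k * ((l * b) ^ 2 / 2)) := by
    rw [Real.exp_nat_mul]
    exact pow_le_pow_left₀ (Real.cosh_pos _).le (Real.cosh_le_exp_half_sq _) k
  have h6 : Real.exp (l * (k * t)) / 2 ≤ Real.cosh (l * (k * t)) := by
    -- Replacing `cosh` by half an exponential is the source of the factor 2 in the conclusion.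
    rw [Real.cosh_eq]; linarith [Real.exp_pos (-(l * (k * t)))]
  have h7 : Real.exp (l * (k * t)) / 2 *
      P.real {ω | k * t ≤ ‖∑ i ∈ Finset.range k, X i ω‖} ≤ Real.exp (k * ((l * b) ^ 2 / 2)) :=
    (mul_le_mul h6 h4 measureReal_nonneg (Real.cosh_pos _).le).trans (h3.trans (h2.trans h5))
  have h8 : -(k * t ^ 2 / (2 * b ^ 2)) = k * ((l * b) ^ 2 / 2) - l * (k * t) := by
    rw [hl]; field_simp; ring
  rw [h8, Real.exp_sub, ← mul_div_assoc, le_div_iff₀ (Real.exp_pos _)]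
  linarith

end Concentration
end

noncomputable section

open scoped Topology NNReal
open Filter

/-! ### Inexact gradient descent under a local smoothness condition -/

section Descent

variable {E : Type*} [NormedAddCommGroup E] [InnerProductSpace ℝ E] [CompleteSpace E]
  {f : E → ℝ} {S : Set E} {fstar Δ φ ρ : ℝ}

/-- A gradient which is Lipschitz at scale `ρ` along a segment is Lipschitz along the segment. -/
theorem norm_gradient_sub_le_of_path {G : Set E} (hρ : 0 < ρ)
    (hG : ∀ x ∈ G, ∀ y ∈ G, ‖y - x‖ ≤ ρ → ‖gradient f y - gradient f x‖ ≤ φ * ‖y - x‖)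
    {x d : E} {s : ℝ} (hs : 0 ≤ s) (hpath : ∀ τ ∈ Set.Icc 0 s, x - τ • d ∈ G) :
    ‖gradient f (x - s • d) - gradient f x‖ ≤ φ * (s * ‖d‖) := by
  -- Cut the segment into `N` pieces shorter than `ρ` and add up the local bounds.
  obtain ⟨N, hN⟩ := exists_nat_gt (s * ‖d‖ / ρ)
  have hN0 : (0 : ℝ) < N := lt_of_le_of_lt (by positivity) hN
  let p : ℕ → E := fun i => x - ((i : ℝ) / N * s) • d
  have hp : ∀ i ≤ N, p i ∈ G := by
    intro i hi
    refine hpath _ ⟨by positivity, mul_le_of_le_one_left hs ?_⟩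
    exact div_le_one_of_le₀ (by exact_mod_cast hi) hN0.le
  have hdiff : ∀ i, ‖p (i + 1) - p i‖ = s * ‖d‖ / N := by
    intro i
    have : p (i + 1) - p i = -((s / N) • d) := by
      simp only [p, Nat.cast_add, Nat.cast_one, sub_sub_sub_cancel_left, ← sub_smul, ← neg_smul]
      congr 1
      field_simp
      ring
    rw [this, norm_neg, norm_smul, Real.norm_of_nonneg (by positivity)]
    ring
  have hstep : ∀ i < N, ‖gradient f (p (i + 1)) - gradient f (p i)‖ ≤ φ * (s * ‖d‖ / N) := by
    intro i hi
    rw [← hdiff i]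
    refine hG _ (hp i hi.le) _ (hp (i + 1) hi) ?_
    rw [hdiff, div_le_iff₀ hN0]
    rw [div_lt_iff₀ hρ] at hN
    linarith
  have h0 : p 0 = x := by simp [p]
  have h1 : p N = x - s • d := by simp [p, hN0.ne']
  rw [← h1, ← h0, ← Finset.sum_range_sub (fun i => gradient f (p i))]
  refine (norm_sum_le _ _).trans ?_
  refine (Finset.sum_le_sum fun i hi => hstep i (Finset.mem_range.1 hi)).trans_eq ?_
  rw [Finset.sum_const, Finset.card_range, nsmul_eq_mul]
  field_simp

/-- The usual descent lemma, with the Lipschitz bound required only along the segment. Expanding `‖d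
- g‖²` removes the inner product, and `φ s ≤ 1` absorbs the curvature term. -/
theorem descent_of_path {G : Set E} (hρ : 0 < ρ)
    (hd : ∀ x ∈ G, DifferentiableAt ℝ f x)
    (hG : ∀ x ∈ G, ∀ y ∈ G, ‖y - x‖ ≤ ρ → ‖gradient f y - gradient f x‖ ≤ φ * ‖y - x‖)
    {x d : E} {s : ℝ} (hs : 0 ≤ s) (hφs : φ * s ≤ 1)
    (hpath : ∀ τ ∈ Set.Icc 0 s, x - τ • d ∈ G) :
    f (x - s • d) ≤ f x - s / 2 * ‖gradient f x‖ ^ 2 + s / 2 * ‖d - gradient f x‖ ^ 2 := by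
  set g := gradient f x
  let k : ℝ → ℝ := fun τ => f (x - τ • d) + τ * inner ℝ g d - φ * τ ^ 2 / 2 * ‖d‖ ^ 2
  have hk : ∀ τ ∈ Set.Icc 0 s, HasDerivAt k
      (-inner ℝ (gradient f (x - τ • d)) d + inner ℝ g d - φ * τ * ‖d‖ ^ 2) τ := by
    intro τ hτ
    have h1 : HasDerivAt (fun τ : ℝ => x - τ • d) (-d) τ := by
      simpa using ((hasDerivAt_id τ).smul_const d).const_sub x
    have h2 : HasDerivAt (fun τ : ℝ => f (x - τ • d))
        (-inner ℝ (gradient f (x - τ • d)) d) τ := by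
      have := (hd _ (hpath τ hτ)).hasFDerivAt.comp_hasDerivAt τ h1
      rwa [← inner_gradient_left, inner_neg_right] at this
    have h3 : HasDerivAt (fun τ : ℝ => τ * inner ℝ g d) (inner ℝ g d) τ := by
      simpa using (hasDerivAt_id τ).mul_const (inner ℝ g d)
    have h4 : HasDerivAt (fun τ : ℝ => φ * τ ^ 2 / 2 * ‖d‖ ^ 2) (φ * τ * ‖d‖ ^ 2) τ := by
      have := (((hasDerivAt_pow 2 τ).const_mul φ).div_const 2).mul_const (‖d‖ ^ 2)
      convert! this using 1
      push_cast
      ring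
    exact (h2.add h3).sub h4
  have hanti : AntitoneOn k (Set.Icc 0 s) := by
    refine antitoneOn_of_deriv_nonpos (convex_Icc 0 s)
      (fun τ hτ => (hk τ hτ).continuousAt.continuousWithinAt)
      (fun τ hτ => (hk τ (interior_subset hτ)).differentiableAt.differentiableWithinAt)
      fun τ hτ => ?_
    have hτ' := interior_subset hτ
    rw [(hk τ hτ').deriv]
    have h1 := norm_gradient_sub_le_of_path hρ hG hτ'.1
      (fun t ht => hpath t ⟨ht.1, ht.2.trans hτ'.2⟩)
    have h2 := abs_le.1 (abs_real_inner_le_norm (gradient f (x - τ • d) - g) d)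
    rw [inner_sub_left] at h2
    have h3 : ‖gradient f (x - τ • d) - g‖ * ‖d‖ ≤ φ * (τ * ‖d‖) * ‖d‖ := by gcongr
    nlinarith [h2.1]
  have h := hanti ⟨le_rfl, hs⟩ ⟨hs, le_rfl⟩ hs
  simp only [k, zero_smul, sub_zero, zero_mul, add_zero] at h
  have h5 : ‖d - g‖ ^ 2 = ‖d‖ ^ 2 - 2 * inner ℝ g d + ‖g‖ ^ 2 := by
    rw [norm_sub_sq_real, real_inner_comm]
  rw [h5]
  have h6 : φ * s ^ 2 / 2 * ‖d‖ ^ 2 ≤ s / 2 * ‖d‖ ^ 2 := by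
    gcongr ?_ * _
    nlinarith
  linarith

variable (hS : IsOpen S) (hd : ∀ x ∈ S, DifferentiableAt ℝ f x)
  (hclosed : IsClosed {x | x ∈ S ∧ f x - fstar ≤ Δ})
  (hφ : 0 < φ) (hρ : 0 < ρ)
  (hsm : ∀ x ∈ S, f x - fstar ≤ Δ → ∀ y ∈ S, ‖y - x‖ ≤ ρ →
    ‖gradient f y - gradient f x‖ ≤ φ * ‖y - x‖)

include hS hd hclosed hφ hρ hsm in
/-- One step of inexact gradient descent, started below the level `Δ`. -/
theorem inexact_gradient_step {x d : E} {η : ℝ} (hx : x ∈ S) (hη : 0 ≤ η) (hφη : φ * η ≤ 1)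
    (hlevel : f x - fstar + η / 2 * ‖d - gradient f x‖ ^ 2 < Δ) :
    x - η • d ∈ S ∧ f (x - η • d) ≤
      f x - η / 2 * ‖gradient f x‖ ^ 2 + η / 2 * ‖d - gradient f x‖ ^ 2 := by
  set G := {x | x ∈ S ∧ f x - fstar ≤ Δ} with hG
  have hGd : ∀ x ∈ G, DifferentiableAt ℝ f x := fun x hx => hd x hx.1
  have hGs : ∀ x ∈ G, ∀ y ∈ G, ‖y - x‖ ≤ ρ → ‖gradient f y - gradient f x‖ ≤ φ * ‖y - x‖ :=
    fun x hx y hy h => hsm x hx.1 hx.2 y hy.1 h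
  have hq : Continuous fun τ : ℝ => x - τ • d := by fun_prop
  have hx' : f x - fstar < Δ := lt_of_le_of_lt (le_add_of_nonneg_right (by positivity)) hlevel
  -- Continuation in `τ`: while the segment lies in `G` the descent bound keeps the value strictly
  -- below `Δ`, and openness lets it advance. No bound on the step length `η ‖d‖` is needed.
  suffices h : Set.Icc 0 η ⊆ {τ | ∀ t ∈ Set.Icc 0 τ, x - t • d ∈ G} by
    have hη' := h ⟨hη, le_rfl⟩
    exact ⟨(hη' η ⟨hη, le_rfl⟩).1, descent_of_path hρ hGd hGs hη hφη hη'⟩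
  have hdesc : ∀ τ ∈ Set.Icc 0 η, (∀ t ∈ Set.Icc 0 τ, x - t • d ∈ G) →
      f (x - τ • d) - fstar < Δ := by
    intro τ hτ h
    have := descent_of_path hρ hGd hGs hτ.1 (le_trans (by gcongr; exact hτ.2) hφη) h
    have h2 : τ / 2 * ‖d - gradient f x‖ ^ 2 ≤ η / 2 * ‖d - gradient f x‖ ^ 2 := by
      gcongr
      exact hτ.2
    have h3 : 0 ≤ τ / 2 * ‖gradient f x‖ ^ 2 := by have := hτ.1; positivity
    linarith
  refine IsClosed.Icc_subset_of_forall_exists_gt ?_ ?_ ?_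
  · have : {τ | ∀ t ∈ Set.Icc 0 τ, x - t • d ∈ G} ∩ Set.Icc 0 η =
        Set.Icc 0 η ∩ ⋂ a ∈ Set.Icc (0 : ℝ) 1, {τ | x - (a * τ) • d ∈ G} := by
      ext τ
      simp only [Set.mem_inter_iff, Set.mem_ofPred_eq, Set.mem_iInter]
      refine ⟨fun h => ⟨h.2, fun a ha => h.1 _ ⟨mul_nonneg ha.1 h.2.1,
        mul_le_of_le_one_left h.2.1 ha.2⟩⟩, fun h => ⟨fun t ht => ?_, h.1⟩⟩
      rcases h.1.1.eq_or_lt with h0 | h0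
      · have : t = 0 := le_antisymm (ht.2.trans h0.ge) ht.1
        simpa [this] using h.2 0 ⟨le_rfl, zero_le_one⟩
      · have := h.2 (t / τ) ⟨div_nonneg ht.1 h0.le, div_le_one_of_le₀ ht.2 h0.le⟩
        rwa [div_mul_cancel₀ _ h0.ne'] at this
    rw [this]
    refine isClosed_Icc.inter (isClosed_biInter fun a _ => hclosed.preimage ?_)
    fun_prop
  · intro t ht
    have : t = 0 := le_antisymm ht.2 ht.1
    rw [this, zero_smul, sub_zero]
    exact ⟨hx, hx'.le⟩
  · rintro τ ⟨hτ, hτη⟩ y hy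
    have h1 := hdesc τ ⟨hτη.1, hτη.2.le⟩ hτ
    have hmem := hτ τ ⟨hτη.1, le_rfl⟩
    have hev : ∀ᶠ t in 𝓝 τ, x - t • d ∈ G := by
      have hc : ContinuousAt (fun t : ℝ => f (x - t • d) - fstar) τ :=
        (ContinuousAt.comp (f := fun t : ℝ => x - t • d)
          (hGd _ hmem).continuousAt hq.continuousAt).sub continuousAt_const
      filter_upwards [hq.continuousAt.eventually (hS.mem_nhds hmem.1),
        hc.eventually (gt_mem_nhds h1)] with t ht1 ht2
      exact ⟨ht1, ht2.le⟩
    obtain ⟨ε, hε, hball⟩ := Metric.eventually_nhds_iff.1 hev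
    have hlt : τ < min (τ + ε / 2) (min y η) := lt_min (by linarith) (lt_min hy hτη.2)
    refine ⟨min (τ + ε / 2) (min y η), fun t ht => ?_, hlt,
      (min_le_right _ _).trans (min_le_left _ _)⟩
    rcases le_or_gt t τ with h | h
    · exact hτ t ⟨ht.1, h⟩
    · refine hball ?_
      have := ht.2.trans (min_le_left _ _)
      rw [Real.dist_eq, abs_of_pos (by linarith)]
      linarith

include hS hd hclosed hφ hρ hsm in
-- An exact gradient step of size `1 / φ` decreases `f` by at least `‖∇f‖² / (2 φ)` but cannot pass
-- the minimum; compare with the PL inequality.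
theorem pl_constant_le {x : E} {μ : ℝ} (hx : x ∈ S) (h0 : 0 < f x - fstar)
    (hxΔ : f x - fstar < Δ) (hmin : ∀ y ∈ S, fstar ≤ f y)
    (hPL : μ * (f x - fstar) ≤ ‖gradient f x‖ ^ 2) : μ ≤ 2 * φ := by
  have hinv : φ * φ⁻¹ = 1 := mul_inv_cancel₀ hφ.ne'
  have h := inexact_gradient_step hS hd hclosed hφ hρ hsm (d := gradient f x) (η := φ⁻¹) hx
    (inv_nonneg.2 hφ.le) hinv.le (by simpa using hxΔ)
  rw [sub_self, norm_zero] at h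
  have h1 := hmin _ h.1
  have h2 : φ⁻¹ / 2 * (μ * (f x - fstar)) ≤ f x - fstar := by
    have : φ⁻¹ / 2 * (μ * (f x - fstar)) ≤ φ⁻¹ / 2 * ‖gradient f x‖ ^ 2 := by gcongr
    linarith [h.2]
  have h3 : φ⁻¹ / 2 * μ ≤ 1 := by
    by_contra hcon
    push Not at hcon
    nlinarith
  have h4 : μ = 2 * φ * (φ⁻¹ / 2 * μ) := by field_simp
  rw [h4]
  nlinarith

include hS hd hclosed hφ hρ hsm in
/-- Inexact gradient descent under a Polyak-Lojasiewicz condition. -/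
theorem inexact_gradient_descent {μ η ε Δ₀ : ℝ} (hμ : 0 < μ) (hη : 0 < η) (hφη : φ * η ≤ 1 / 8)
    (hμφ : μ ≤ 2 * φ) (hε : 0 < ε) (hε₀ : ε ≤ Δ₀) (hΔ : 2 * Δ₀ ≤ Δ)
    (hPL : ∀ x ∈ S, μ * (f x - fstar) ≤ ‖gradient f x‖ ^ 2) {x g : ℕ → E}
    (hstep : ∀ t, x (t + 1) = x t - η • g t) (hx0 : x 0 ∈ S) (hx0' : f (x 0) - fstar ≤ Δ₀) {T : ℕ}
    (herr : ∀ t < T, x t ∈ S → f (x t) - fstar ≤ Δ₀ →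
      ‖g t - gradient f (x t)‖ ^ 2 ≤ μ * ε / 2) :
    ∀ t ≤ T, x t ∈ S ∧ f (x t) - fstar ≤ Δ₀ ∧
      f (x t) - fstar ≤ (1 - η * μ / 2) ^ t * Δ₀ + ε / 2 := by
  have hημ : η * μ ≤ 1 / 4 := by nlinarith
  have hημ0 : 0 < η * μ := by positivity
  intro t
  induction t with
  | zero => intro _; exact ⟨hx0, hx0', by simp only [pow_zero, one_mul]; linarith⟩
  | succ t ih =>
    intro ht
    obtain ⟨h1, h2, h3⟩ := ih (by omega)
    have he := herr t (by omega) h1 h2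
    -- The per-step error is chosen so that `ε / 2` is the fixed point of `z ↦ (1 - η μ / 2) z + η μ
    -- ε / 4`.
    have he' : η / 2 * ‖g t - gradient f (x t)‖ ^ 2 ≤ η * μ * ε / 4 := by
      have : η / 2 * ‖g t - gradient f (x t)‖ ^ 2 ≤ η / 2 * (μ * ε / 2) := by gcongr
      linarith
    have hlev : f (x t) - fstar + η / 2 * ‖g t - gradient f (x t)‖ ^ 2 < Δ := by
      nlinarith
    obtain ⟨h4, h5⟩ := inexact_gradient_step hS hd hclosed hφ hρ hsm (d := g t) h1 hη.le
      (by linarith) hlev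
    rw [← hstep] at h4 h5
    have h6 : η / 2 * (μ * (f (x t) - fstar)) ≤ η / 2 * ‖gradient f (x t)‖ ^ 2 := by
      have := hPL _ h1
      gcongr
    have h7 : f (x (t + 1)) - fstar ≤
        (1 - η * μ / 2) * (f (x t) - fstar) + η * μ * ε / 4 := by linarith
    have h8 : 0 ≤ 1 - η * μ / 2 := by linarith
    refine ⟨h4, ?_, ?_⟩
    · have := mul_le_mul_of_nonneg_left h2 h8
      nlinarith
    · have := mul_le_mul_of_nonneg_left h3 h8
      rw [pow_succ']
      linarith

end Descent
end

noncomputable section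

open scoped Topology NNReal
open Filter

/-! ### The one-point estimate -/

section UnifSphere

variable {m n : ℕ}

theorem finrank_policy (m n : ℕ) : Module.finrank ℝ (Policy m n) = m * n := by
  rw [finrank_euclideanSpace, Fintype.card_prod, Fintype.card_fin, Fintype.card_fin, mul_comm]

theorem nontrivial_policy (hD : 0 < m * n) : Nontrivial (Policy m n) :=
  Module.finrank_pos_iff.1 (by rwa [finrank_policy])

theorem isProbabilityMeasure_unifSphere [Nontrivial (Policy m n)] :
    IsProbabilityMeasure (unifSphere m n) := by
  have : IsProbabilityMeasure
      (ProbabilityTheory.cond (volume : Measure (Policy m n)).toSphere Set.univ) :=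
    cond_isProbabilityMeasure
      (Measure.measure_univ_ne_zero.2 (Measure.toSphere_ne_zero volume))
  exact Measure.isProbabilityMeasure_map measurable_subtype_coe.aemeasurable

theorem integral_unifSphere {F : Policy m n → ℝ} (hF : Measurable F) :
    ∫ u, F u ∂(unifSphere m n) =
      ((volume : Measure (Policy m n)).toSphere.real Set.univ)⁻¹ *
        ∫ u : Metric.sphere (0 : Policy m n) 1, F u.1
          ∂(volume : Measure (Policy m n)).toSphere := by
  rw [unifSphere, integral_map measurable_subtype_coe.aemeasurable hF.aestronglyMeasurable,
    ProbabilityTheory.cond, Measure.restrict_univ, integral_smul_measure, ENNReal.toReal_inv,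
    smul_eq_mul]
  rfl

theorem ae_norm_eq_one_unifSphere : ∀ᵐ u ∂(unifSphere m n), ‖u‖ = 1 := by
  rw [unifSphere, ae_map_iff measurable_subtype_coe.aemeasurable
    (measurableSet_eq_fun measurable_norm measurable_const)]
  exact ae_of_all _ fun u => by simp

end UnifSphere

namespace LQR

variable {m n : ℕ} (L : LQR m n)

/-- The mean of `‖v‖²` is `m`. This supplies the positivity of `Cm`. -/
theorem natCast_le_Cm : (m : ℝ) ≤ L.Cm := by
  have := L.init_prob
  have h1 : ∫ v, ∑ i, v i ^ 2 ∂L.init = m := by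
    rw [integral_finsetSum _ fun i _ => by simpa only [sq] using L.integrable_mul_coord i i]
    simp only [sq, L.init_cov, if_true]
    simp
  rw [← h1]
  calc ∫ v, ∑ i, v i ^ 2 ∂L.init ≤ ∫ _, L.Cm ∂L.init := by
        refine integral_mono_ae (integrable_finsetSum _ fun i _ => by
          simpa only [sq] using L.integrable_mul_coord i i) (integrable_const _) L.init_bound
    _ = L.Cm := by simp

theorem measurable_onePointEstimate (r : ℝ) :
    Measurable fun p : Policy m n × Policy m n × LQRState m =>
      L.onePointEstimate r p.1 p.2.1 p.2.2 := by
  unfold onePointEstimate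
  have h : Measurable fun p : Policy m n × Policy m n × LQRState m =>
      L.sampleCost (p.1 + r • p.2.1) p.2.2 :=
    L.measurable_sampleCost.comp (g := fun p : Policy m n × LQRState m => L.sampleCost p.1 p.2)
      (f := fun p : Policy m n × Policy m n × LQRState m => (p.1 + r • p.2.1, p.2.2))
      (by fun_prop)
  exact (h.ennreal_toReal.mul_const _).smul (by fun_prop)

theorem measurable_onePointEstimate' (r : ℝ) (K : Policy m n) :
    Measurable fun p : Policy m n × LQRState m => L.onePointEstimate r K p.1 p.2 := by
  have h : Measurable fun p : Policy m n × LQRState m => (K, p) :=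
    measurable_const.prodMk measurable_id
  have h2 := (L.measurable_onePointEstimate r).comp h
  simpa only [Function.comp_def] using h2

theorem sampleCost_lt_top {K : Policy m n} (hK : K ∈ L.domain) (s : LQRState m) :
    L.sampleCost K s < ∞ :=
  (L.sampleCost_le K s).trans_lt (ENNReal.mul_lt_top ENNReal.ofReal_lt_top hK)

theorem toReal_sampleCost_le {K : Policy m n} (hK : K ∈ L.domain) (s : LQRState m) :
    (L.sampleCost K s).toReal ≤ (∑ i, s i ^ 2) * L.realCost K := by
  have h := ENNReal.toReal_mono (ENNReal.mul_lt_top ENNReal.ofReal_lt_top hK).ne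
    (L.sampleCost_le K s)
  rwa [ENNReal.toReal_mul, ENNReal.toReal_ofReal (Finset.sum_nonneg fun i _ => sq_nonneg _)] at h

theorem integral_toReal_sampleCost {K : Policy m n} (hK : K ∈ L.domain) :
    ∫ s, (L.sampleCost K s).toReal ∂L.init = L.realCost K :=
  integral_toReal (L.measurable_sampleCost.comp
      (measurable_const.prodMk measurable_id : Measurable fun s : LQRState m =>
        (K, s))).aemeasurable
    (ae_of_all _ fun s => L.sampleCost_lt_top hK s)

section Estimate

variable {L} {K : Policy m n} {r cb φ : ℝ} (hD : 0 < m * n) (hr : 0 < r) (hφ : 0 ≤ φ)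
  (hball : ∀ y ∈ Metric.closedBall K r, y ∈ L.domain ∧ L.realCost y ≤ cb)
  (hgrad : ∀ y ∈ Metric.closedBall K r,
    ‖gradient L.realCost y - gradient L.realCost K‖ ≤ φ * ‖y - K‖)

include hr hball in
theorem ae_norm_onePointEstimate_le :
    ∀ᵐ p ∂((unifSphere m n).prod L.init),
      ‖L.onePointEstimate r K p.1 p.2‖ ≤ L.Cm * (((m * n : ℕ) : ℝ) / r) * cb := by
  have := L.init_prob
  have h1 : ∀ᵐ p ∂((unifSphere m n).prod L.init), ‖p.1‖ = 1 := by
    have hq : Measure.QuasiMeasurePreserving Prod.fst ((unifSphere m n).prod L.init)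
        (unifSphere m n) := Measure.quasiMeasurePreserving_fst
    exact hq.ae ae_norm_eq_one_unifSphere
  have h2 : ∀ᵐ p ∂((unifSphere m n).prod L.init), ∑ i, p.2 i ^ 2 ≤ L.Cm := by
    rcases eq_or_ne (unifSphere m n) 0 with h0 | h0
    · simp [h0]
    · have : SFinite (unifSphere m n) := by unfold unifSphere; infer_instance
      have hq : Measure.QuasiMeasurePreserving Prod.snd ((unifSphere m n).prod L.init)
        L.init := Measure.quasiMeasurePreserving_snd
      exact hq.ae L.init_bound
  filter_upwards [h1, h2] with p hp1 hp2
  obtain ⟨hd, hc⟩ := hball (K + r • p.1) (by simp [norm_smul, hp1, abs_of_pos hr])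
  rw [onePointEstimate, norm_smul, hp1, mul_one, Real.norm_of_nonneg (by positivity)]
  have h3 := L.toReal_sampleCost_le hd p.2
  have h4 := L.realCost_nonneg (K + r • p.1)
  have h5 : (∑ i, p.2 i ^ 2) * L.realCost (K + r • p.1) ≤ L.Cm * cb := by
    have h6 : 0 ≤ ∑ i, p.2 i ^ 2 := Finset.sum_nonneg fun i _ => sq_nonneg _
    exact mul_le_mul hp2 hc h4 (h6.trans hp2)
  calc _ ≤ L.Cm * cb * (((m * n : ℕ) : ℝ) / r) := by
        gcongr
        exact h3.trans h5
    _ = _ := by ring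

include hD hr hball in
theorem integrable_onePointEstimate :
    Integrable (fun p : Policy m n × LQRState m => L.onePointEstimate r K p.1 p.2)
      ((unifSphere m n).prod L.init) := by
  have := L.init_prob
  have := nontrivial_policy hD
  have := isProbabilityMeasure_unifSphere (m := m) (n := n)
  exact Integrable.of_bound
    (L.measurable_onePointEstimate' r K).aestronglyMeasurable _
    (ae_norm_onePointEstimate_le hr hball)

include hD hr hφ hball hgrad in
/-- The bias of the one-point estimate. -/
theorem norm_integral_onePointEstimate_sub_le :
    ‖∫ p, L.onePointEstimate r K p.1 p.2 ∂((unifSphere m n).prod L.init) -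
      gradient L.realCost K‖ ≤ φ * r := by
  have := L.init_prob
  have := nontrivial_policy hD
  have := isProbabilityMeasure_unifSphere (m := m) (n := n)
  have hint := integrable_onePointEstimate hD hr hball
  set D : ℝ := ((m * n : ℕ) : ℝ) with hDdef
  -- Integrating over the initial state first replaces the sample cost by the population cost.
  have hinner : ∀ w, inner ℝ (∫ p, L.onePointEstimate r K p.1 p.2
      ∂((unifSphere m n).prod L.init)) w = D / r * ∫ u, L.realCost (K + r • u) * inner ℝ u w
        ∂(unifSphere m n) := by
    intro w
    rw [real_inner_comm, ← integral_inner hint w, integral_prod _ (hint.const_inner w),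
      ← integral_const_mul]
    refine integral_congr_ae ?_
    filter_upwards [ae_norm_eq_one_unifSphere] with u hu
    obtain ⟨hd, -⟩ := hball (K + r • u) (by simp [norm_smul, hu, abs_of_pos hr])
    simp only [onePointEstimate, real_inner_smul_right]
    rw [integral_mul_const, integral_mul_const, L.integral_toReal_sampleCost hd,
      real_inner_comm w u]
    ring
  have hmeas : ∀ w : Policy m n, Measurable fun u => L.realCost (K + r • u) * inner ℝ u w := by
    intro w
    have : Measurable fun u => L.realCost (K + r • u) :=
      (L.measurable_cost.comp (by fun_prop : Measurable fun u : Policy m n =>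
        K + r • u)).ennreal_toReal
    fun_prop
  -- Testing the scalar bound against the bias `a` itself gives `‖a‖² ≤ φ r ‖a‖`.
  set a := ∫ p, L.onePointEstimate r K p.1 p.2 ∂((unifSphere m n).prod L.init) -
      gradient L.realCost K with ha
  have h1 := abs_sphere_average_sub_inner_gradient_le hφ hr
    (fun y hy => L.differentiableAt_realCost (hball y hy).1) hgrad a
  rw [← integral_unifSphere (hmeas a), finrank_policy, ← hDdef, ← hinner, ← inner_sub_left, ← ha,
    real_inner_self_eq_norm_sq, abs_of_nonneg (sq_nonneg _)] at h1
  rcases (norm_nonneg a).eq_or_lt with h0 | h0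
  · rw [← h0]; positivity
  · nlinarith

include hD hr hφ hball hgrad in
/-- The minibatch estimate concentrates around the gradient. -/
theorem measureReal_minibatch_error_le {Ω : Type*} [MeasurableSpace Ω] {P : Measure Ω}
    [IsProbabilityMeasure P] {Z : ℕ → Ω → Policy m n × LQRState m} (hZ : ∀ i, Measurable (Z i))
    (hind : iIndepFun Z P) (hlaw : ∀ i, P.map (Z i) = (unifSphere m n).prod L.init)
    (hcb : 0 < cb) {t : ℝ} (ht : 0 ≤ t) {k : ℕ} (hk : 0 < k) :
    P.real {ω | φ * r + t < ‖L.minibatchEstimate r k K (fun i => (Z i ω).1) (fun i => (Z i ω).2) -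
      gradient L.realCost K‖} ≤
      2 * Real.exp (-(k * t ^ 2 / (8 * (L.Cm * (((m * n : ℕ) : ℝ) / r) * cb) ^ 2))) := by
  have := L.init_prob
  have := nontrivial_policy hD
  have := isProbabilityMeasure_unifSphere (m := m) (n := n)
  set M := L.Cm * (((m * n : ℕ) : ℝ) / r) * cb with hM
  have hCm : 0 < L.Cm := by
    refine lt_of_lt_of_le ?_ L.natCast_le_Cm
    exact_mod_cast Nat.pos_of_mul_pos_right hD
  have hM0 : 0 < M := by
    have : (0 : ℝ) < ((m * n : ℕ) : ℝ) := by exact_mod_cast hD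
    positivity
  set X : Policy m n × LQRState m → Policy m n := fun p => L.onePointEstimate r K p.1 p.2 with hX
  have hXm : Measurable X := L.measurable_onePointEstimate' r K
  have hXb : ∀ᵐ p ∂((unifSphere m n).prod L.init), ‖X p‖ ≤ M :=
    ae_norm_onePointEstimate_le hr hball
  set a := ∫ p, X p ∂((unifSphere m n).prod L.init) with ha
  have haM : ‖a‖ ≤ M := by
    simpa using norm_integral_le_of_norm_le_const hXb
  have hbias : ‖a - gradient L.realCost K‖ ≤ φ * r :=
    norm_integral_onePointEstimate_sub_le hD hr hφ hball hgrad
  set Y : ℕ → Ω → Policy m n := fun i ω => X (Z i ω) - a with hY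
  have hYm : ∀ i, Measurable (Y i) := fun i => (hXm.comp (hZ i)).sub_const a
  have hYi : iIndepFun Y P := hind.comp (fun _ p => X p - a) fun _ => hXm.sub_const a
  -- Centering doubles the bound, which turns the `2 b²` of Hoeffding into `8 M²`.
  have hYb : ∀ i, ∀ᵐ ω ∂P, ‖Y i ω‖ ≤ 2 * M := by
    intro i
    have h1 : ∀ᵐ ω ∂P, ‖X (Z i ω)‖ ≤ M := by
      refine ae_of_ae_map (hZ i).aemeasurable (p := fun p => ‖X p‖ ≤ M) ?_
      rw [hlaw i]; exact hXb
    filter_upwards [h1] with ω hω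
    exact (norm_sub_le _ _).trans (by linarith)
  have hXint : Integrable X ((unifSphere m n).prod L.init) :=
    integrable_onePointEstimate hD hr hball
  have hY0 : ∀ i, ∫ ω, Y i ω ∂P = 0 := by
    intro i
    have h1 : Integrable (fun ω => X (Z i ω)) P := by
      have := hXint
      rw [← hlaw i] at this
      exact this.comp_measurable (hZ i)
    have h2 : ∫ ω, X (Z i ω) ∂P = a := by
      rw [ha, ← hlaw i, integral_map (hZ i).aemeasurable hXm.aestronglyMeasurable]
    rw [integral_sub h1 (integrable_const _), h2]
    simp
  have hconc := measureReal_norm_sum_ge_le hYm hYi (b := 2 * M) (by positivity) hYb hY0 ht k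
  have hk0 : (0 : ℝ) < k := by exact_mod_cast hk
  refine (measureReal_mono fun ω hω => ?_).trans (hconc.trans_eq ?_)
  · have hω' : φ * r + t < ‖L.minibatchEstimate r k K (fun i => (Z i ω).1) (fun i => (Z i ω).2) -
      gradient L.realCost K‖ := hω
    have h1 : ∑ i ∈ Finset.range k, Y i ω = (k : ℝ) •
        (L.minibatchEstimate r k K (fun i => (Z i ω).1) (fun i => (Z i ω).2) - a) := by
      simp only [hY, hX, minibatchEstimate, Finset.sum_sub_distrib, Finset.sum_const,
        Finset.card_range, smul_sub, smul_smul, mul_one_div_cancel hk0.ne', one_smul]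
      rw [Nat.cast_smul_eq_nsmul]
    change k * t ≤ ‖∑ i ∈ Finset.range k, Y i ω‖
    rw [h1, norm_smul, Real.norm_of_nonneg hk0.le]
    gcongr
    have h2 := norm_sub_le_norm_sub_add_norm_sub
      (L.minibatchEstimate r k K (fun i => (Z i ω).1) (fun i => (Z i ω).2)) a
      (gradient L.realCost K)
    linarith
  · congr 3
    ring

end Estimate

end LQR
end

noncomputable section

open scoped Topology NNReal
open Filter

/-! ### The trajectory of the algorithm -/

/-- A finite family of values, extended by zero to all indices. -/
def extendByZero {α : Type*} [Zero α] (J : Finset (ℕ × ℕ)) (V : J → α) (t i : ℕ) : α :=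
  if h : (t, i) ∈ J then V ⟨(t, i), h⟩ else 0

theorem measurable_extendByZero {α : Type*} [Zero α] [MeasurableSpace α] (J : Finset (ℕ × ℕ))
    (t i : ℕ) : Measurable fun V : J → α => extendByZero J V t i := by
  unfold extendByZero
  by_cases h : (t, i) ∈ J
  · simp only [h, dif_pos]
    exact measurable_pi_apply _
  · simp only [h, dif_neg, not_false_eq_true]
    exact measurable_const

theorem extendByZero_restrict {α : Type*} [Zero α] {J : Finset (ℕ × ℕ)} {V : ℕ × ℕ → α} {t i : ℕ}
    (h : (t, i) ∈ J) : extendByZero J (fun p => V p) t i = V (t, i) := by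
  rw [extendByZero, dif_pos h]

theorem measurable_gradient {E : Type*} [NormedAddCommGroup E] [InnerProductSpace ℝ E]
    [CompleteSpace E] [MeasurableSpace E] [BorelSpace E] [SecondCountableTopology E]
    [FiniteDimensional ℝ E] (f : E → ℝ) : Measurable (gradient f) :=
  (InnerProductSpace.toDual ℝ E).symm.continuous.measurable.comp (measurable_fderiv ℝ f)

namespace LQR

variable {m n : ℕ} (L : LQR m n)

theorem minibatchEstimate_congr {r : ℝ} {k : ℕ} {K : Policy m n} {u u' : ℕ → Policy m n}
    {s s' : ℕ → LQRState m} (hu : ∀ i < k, u i = u' i) (hs : ∀ i < k, s i = s' i) :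
    L.minibatchEstimate r k K u s = L.minibatchEstimate r k K u' s' := by
  unfold minibatchEstimate
  congr 1
  refine Finset.sum_congr rfl fun i hi => ?_
  rw [hu i (Finset.mem_range.1 hi), hs i (Finset.mem_range.1 hi)]

theorem iterate_congr {η r : ℝ} {k : ℕ} {K₀ : Policy m n} {U U' : ℕ → ℕ → Policy m n}
    {S S' : ℕ → ℕ → LQRState m} {t : ℕ} (hU : ∀ a < t, ∀ i < k, U a i = U' a i)
    (hS : ∀ a < t, ∀ i < k, S a i = S' a i) :
    L.iterate η r k K₀ U S t = L.iterate η r k K₀ U' S' t := by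
  induction t with
  | zero => rfl
  | succ t ih =>
    rw [iterate, iterate, ih (fun a ha => hU a (by omega)) (fun a ha => hS a (by omega)),
      L.minibatchEstimate_congr (hU t (by omega)) (hS t (by omega))]

theorem measurable_minibatchEstimate {α : Type*} [MeasurableSpace α] (r : ℝ) (k : ℕ)
    {K : α → Policy m n} {u : ℕ → α → Policy m n} {s : ℕ → α → LQRState m} (hK : Measurable K)
    (hu : ∀ i, Measurable (u i)) (hs : ∀ i, Measurable (s i)) :
    Measurable fun a => L.minibatchEstimate r k (K a) (fun i => u i a) (fun i => s i a) := by
  unfold minibatchEstimate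
  refine (Finset.measurable_fun_sum _ fun i _ => ?_).const_smul (1 / (k : ℝ))
  have h := (L.measurable_onePointEstimate r).comp (hK.prodMk ((hu i).prodMk (hs i)))
  simpa only [Function.comp_def] using h

theorem measurable_iterate {α : Type*} [MeasurableSpace α] (η r : ℝ) (k : ℕ) (K₀ : Policy m n)
    {U : ℕ → ℕ → α → Policy m n} {S : ℕ → ℕ → α → LQRState m}
    (hU : ∀ t i, Measurable (U t i)) (hS : ∀ t i, Measurable (S t i)) (t : ℕ) :
    Measurable fun a => L.iterate η r k K₀ (fun t i => U t i a) (fun t i => S t i a) t := by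
  induction t with
  | zero => exact measurable_const
  | succ t ih =>
    simp only [iterate]
    exact ih.sub ((L.measurable_minibatchEstimate r k ih (hU t) (hS t)).const_smul η)

section Stage

variable {Ω : Type*} [MeasurableSpace Ω] {P : Measure Ω} [IsProbabilityMeasure P]
  {Z : ℕ × ℕ → Ω → Policy m n × LQRState m}

/-- The iterates, as random variables driven by the samples `Z`. -/
def trajectory (η r : ℝ) (k : ℕ) (K₀ : Policy m n) (Z : ℕ × ℕ → Ω → Policy m n × LQRState m)
    (ω : Ω) (t : ℕ) : Policy m n :=
  L.iterate η r k K₀ (fun t i => (Z (t, i) ω).1) (fun t i => (Z (t, i) ω).2) t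

/-- The minibatch estimates along the trajectory. -/
def trajectoryEstimate (η r : ℝ) (k : ℕ) (K₀ : Policy m n)
    (Z : ℕ × ℕ → Ω → Policy m n × LQRState m) (ω : Ω) (t : ℕ) : Policy m n :=
  L.minibatchEstimate r k (L.trajectory η r k K₀ Z ω t) (fun i => (Z (t, i) ω).1)
    (fun i => (Z (t, i) ω).2)

/-- If the minibatch error is rarely large at every fixed policy of `A`, then it is rarely large
at the iterate, which is independent of the minibatch. -/
theorem measure_stage_error_le (hZ : ∀ p, Measurable (Z p)) (hind : iIndepFun Z P)
    (η r : ℝ) (k : ℕ) (K₀ : Policy m n) (t : ℕ) {A : Set (Policy m n)} (hA : MeasurableSet A)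
    {b : ℝ} {δ : ℝ≥0∞}
    (hδ : ∀ K ∈ A, P {ω | b < ‖L.minibatchEstimate r k K (fun i => (Z (t, i) ω).1)
      (fun i => (Z (t, i) ω).2) - gradient L.realCost K‖} ≤ δ) :
    P {ω | L.trajectory η r k K₀ Z ω t ∈ A ∧ b < ‖L.trajectoryEstimate η r k K₀ Z ω t -
      gradient L.realCost (L.trajectory η r k K₀ Z ω t)‖} ≤ δ := by
  -- `J₁` indexes the samples that determine the iterate, `J₂` the current minibatch; disjointness
  -- makes them independent.
  set J₁ : Finset (ℕ × ℕ) := Finset.range t ×ˢ Finset.range k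
  set J₂ : Finset (ℕ × ℕ) := {t} ×ˢ Finset.range k
  have hdisj : Disjoint J₁ J₂ := by
    rw [Finset.disjoint_left]
    intro p h1 h2
    simp only [J₁, J₂, Finset.mem_product, Finset.mem_range, Finset.mem_singleton] at h1 h2
    omega
  let F : (J₁ → Policy m n × LQRState m) → Policy m n := fun V =>
    L.iterate η r k K₀ (fun t i => (extendByZero J₁ V t i).1)
      (fun t i => (extendByZero J₁ V t i).2) t
  have hF : Measurable F := L.measurable_iterate η r k K₀
    (fun t i => (measurable_extendByZero J₁ t i).fst)
    (fun t i => (measurable_extendByZero J₁ t i).snd) t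
  let H : Policy m n × (J₂ → Policy m n × LQRState m) → Policy m n := fun p =>
    L.minibatchEstimate r k p.1 (fun i => (extendByZero J₂ p.2 t i).1)
      (fun i => (extendByZero J₂ p.2 t i).2)
  have hH : Measurable H := L.measurable_minibatchEstimate r k measurable_fst
    (fun i => ((measurable_extendByZero J₂ t i).comp measurable_snd).fst)
    (fun i => ((measurable_extendByZero J₂ t i).comp measurable_snd).snd)
  have h1 := hind.indepFun_finset J₁ J₂ hdisj hZ
  have h2 : IndepFun (fun ω => F fun p => Z p ω) (fun ω (p : J₂) => Z p ω) P :=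
    h1.comp hF measurable_id
  have hV₁ : Measurable fun ω => F fun p => Z p ω :=
    hF.comp (measurable_pi_lambda _ fun p => hZ p)
  have hV₂ : Measurable fun ω (p : J₂) => Z p ω := measurable_pi_lambda _ fun p => hZ p
  have hFeq : ∀ ω, F (fun p => Z p ω) = L.trajectory η r k K₀ Z ω t := by
    intro ω
    have hmem : ∀ a < t, ∀ i < k, (a, i) ∈ J₁ := fun a ha i hi => by
      simp only [J₁, Finset.mem_product, Finset.mem_range]; exact ⟨ha, hi⟩
    refine L.iterate_congr (fun a ha i hi => ?_) (fun a ha i hi => ?_)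
    · rw [extendByZero_restrict (V := fun p => Z p ω) (hmem a ha i hi)]
    · rw [extendByZero_restrict (V := fun p => Z p ω) (hmem a ha i hi)]
  have hHeq : ∀ K ω, H (K, fun p => Z p ω) = L.minibatchEstimate r k K
      (fun i => (Z (t, i) ω).1) (fun i => (Z (t, i) ω).2) := by
    intro K ω
    have hmem : ∀ i < k, (t, i) ∈ J₂ := fun i hi => by
      simp only [J₂, Finset.mem_product, Finset.mem_range, Finset.mem_singleton]; exact ⟨trivial, hi⟩
    refine L.minibatchEstimate_congr (fun i hi => ?_) (fun i hi => ?_)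
    · rw [extendByZero_restrict (V := fun p => Z p ω) (hmem i hi)]
    · rw [extendByZero_restrict (V := fun p => Z p ω) (hmem i hi)]
  let B : Set (Policy m n × (J₂ → Policy m n × LQRState m)) :=
    {p | p.1 ∈ A ∧ b < ‖H p - gradient L.realCost p.1‖}
  have hB : MeasurableSet B := by
    have hm : Measurable fun p : Policy m n × (J₂ → Policy m n × LQRState m) =>
        ‖H p - gradient L.realCost p.1‖ :=
      (hH.sub ((measurable_gradient L.realCost).comp measurable_fst)).norm
    exact (measurable_fst hA).inter (hm measurableSet_Ioi)
  have h3 : P {ω | L.trajectory η r k K₀ Z ω t ∈ A ∧ b < ‖L.trajectoryEstimate η r k K₀ Z ω t -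
      gradient L.realCost (L.trajectory η r k K₀ Z ω t)‖} =
      P ((fun ω => (F fun p => Z p ω, fun p : J₂ => Z p ω)) ⁻¹' B) := by
    congr 1
    ext ω
    simp only [B, Set.mem_preimage, Set.mem_ofPred_eq, hHeq, hFeq]
    rfl
  rw [h3, ← Measure.map_apply (hV₁.prodMk hV₂) hB,
    (indepFun_iff_map_prod_eq_prod_map_map hV₁.aemeasurable hV₂.aemeasurable).1 h2]
  have : IsProbabilityMeasure (P.map fun ω => F fun p => Z p ω) :=
    Measure.isProbabilityMeasure_map hV₁.aemeasurable
  have : IsProbabilityMeasure (P.map fun ω (p : J₂) => Z p ω) :=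
    Measure.isProbabilityMeasure_map hV₂.aemeasurable
  -- Under the product law, freeze the iterate and apply the fixed-policy bound to each section;
  -- sections outside `A` are empty.
  rw [Measure.prod_apply hB]
  calc ∫⁻ K, (P.map fun ω (p : J₂) => Z p ω) (Prod.mk K ⁻¹' B) ∂(P.map fun ω => F fun p => Z p ω)
      ≤ ∫⁻ _, δ ∂(P.map fun ω => F fun p => Z p ω) := by
        refine lintegral_mono fun K => ?_
        rw [Measure.map_apply hV₂ (measurable_prodMk_left hB)]
        by_cases hK : K ∈ A
        · refine (measure_mono fun ω hω => ?_).trans (hδ K hK)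
          have := hω.2
          rwa [hHeq] at this
        · refine (measure_mono_null (fun ω hω => hK hω.1) measure_empty).trans_le zero_le
    _ = δ := by simp

end Stage

end LQR
end

noncomputable section

open scoped Topology NNReal
open Filter

/-! ### The high-probability guarantee -/

namespace CurvatureParams

variable {m n : ℕ} {c : CurvatureParams m n} {L : LQR m n} {G : Set (Policy m n)}

theorem IsValid.phi_pos (hc : c.IsValid L G) (hG : G.Nonempty) : 0 < c.phi G := by
  obtain ⟨K, hK⟩ := hG
  exact (hc.pos K hK).1.trans_le (le_csSup hc.phi_finite (Set.mem_image_of_mem _ hK))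

theorem IsValid.lambda_pos (hc : c.IsValid L G) (hG : G.Nonempty) : 0 < c.lambda G := by
  obtain ⟨K, hK⟩ := hG
  exact (hc.pos K hK).2.2.1.trans_le (le_csSup hc.lambda_finite (Set.mem_image_of_mem _ hK))

theorem IsValid.rho_le (hc : c.IsValid L G) {K : Policy m n} (hK : K ∈ G) :
    c.rho G ≤ min (c.β K) (c.ζ K) := by
  refine csInf_le ⟨0, ?_⟩ (Set.mem_image_of_mem _ hK)
  rintro _ ⟨K', hK', rfl⟩
  exact (lt_min (hc.pos K' hK').2.1 (hc.pos K' hK').2.2.2).le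

theorem IsValid.hasLocallyLipschitzGradientAt (hc : c.IsValid L G) {K : Policy m n} (hK : K ∈ G) :
    HasLocallyLipschitzGradientAt L.realCost L.domain (c.phi G) (c.rho G) K := by
  intro y hy h
  refine (hc.smooth K hK y hy (h.trans ((hc.rho_le hK).trans (min_le_left _ _)))).trans ?_
  gcongr
  exact le_csSup hc.phi_finite (Set.mem_image_of_mem _ hK)

theorem IsValid.isLocallyLipschitzAt (hc : c.IsValid L G) {K : Policy m n} (hK : K ∈ G) :
    IsLocallyLipschitzAt L.realCost L.domain (c.lambda G) (c.rho G) K := by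
  intro y hy h
  refine (hc.lipschitz K hK y hy (h.trans ((hc.rho_le hK).trans (min_le_right _ _)))).trans ?_
  gcongr
  exact le_csSup hc.lambda_finite (Set.mem_image_of_mem _ hK)

end CurvatureParams

/-! ### Scalar inequalities behind the parameter choices -/

/-- The smoothing bias and the concentration threshold add up to at most `√(μ ε / 2)`. -/
theorem smoothing_error_le {φ ρ θ μ ε r : ℝ} (hφ : 0 < φ) (hμ : 0 < μ) (hε : 0 < ε)
    (hr : r ≤ maxRadius φ ρ θ μ ε) :
    φ * r + Real.sqrt (μ * ε) / 2 ≤ Real.sqrt (μ * ε / 2) := by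
  have h1 : r ≤ 1 / (8 * φ) * (min 1 (1 / φ) * Real.sqrt (ε * μ / 30)) :=
    (hr.trans (min_le_right _ _)).trans (by gcongr; exact min_le_right _ _)
  have h2 : min 1 (1 / φ) * Real.sqrt (ε * μ / 30) ≤ Real.sqrt (μ * ε) / 5 := by
    have : Real.sqrt (ε * μ / 30) ≤ Real.sqrt (μ * ε) / 5 := by
      rw [Real.sqrt_le_left (by positivity), div_pow, Real.sq_sqrt (by positivity)]
      nlinarith [mul_pos hμ hε]
    calc min 1 (1 / φ) * Real.sqrt (ε * μ / 30) ≤ 1 * Real.sqrt (ε * μ / 30) := by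
          gcongr; exact min_le_left _ _
      _ ≤ _ := by rwa [one_mul]
  have h3 : φ * r ≤ Real.sqrt (μ * ε) / 40 := by
    calc φ * r ≤ φ * (1 / (8 * φ) * (Real.sqrt (μ * ε) / 5)) := by
          gcongr; exact h1.trans (by gcongr)
      _ = _ := by field_simp; norm_num
  -- Here `21 / 40 = 1 / 40 + 1 / 2`, bias plus threshold.
  have h4 : (21 / 40) * Real.sqrt (μ * ε) ≤ Real.sqrt (μ * ε / 2) := by
    refine Real.le_sqrt_of_sq_le ?_
    rw [mul_pow, Real.sq_sqrt (by positivity)]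
    nlinarith [mul_pos hμ hε]
  linarith

/-- With the prescribed batch size, the concentration bound is at most `δ / 2`. -/
theorem two_mul_exp_le {M D μ ε δ : ℝ} {k : ℕ} (hM : 0 < M) (hD : 1 ≤ D) (hμ : 0 < μ) (hε : 0 < ε)
    (hδ : 0 < δ) (hδ' : δ < 1)
    (hk : (M * Real.sqrt (Real.log (2 * D / δ))) ^ 2 * (1024 / (μ * ε)) ≤ k) :
    2 * Real.exp (-(k * (Real.sqrt (μ * ε) / 2) ^ 2 / (8 * M ^ 2))) ≤ δ / 2 := by
  have hD' : 1 ≤ 2 * D / δ := by rw [one_le_div hδ]; linarith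
  have hl := Real.log_nonneg hD'
  rw [mul_pow, Real.sq_sqrt hl] at hk
  -- Twice the logarithm suffices: the tail is then at most `2 (δ / 2)²`, below `δ / 2` because `δ <
  -- 1`.
  have h1 : 2 * Real.log (2 * D / δ) ≤ k * (Real.sqrt (μ * ε) / 2) ^ 2 / (8 * M ^ 2) := by
    rw [div_pow, Real.sq_sqrt (by positivity), le_div_iff₀ (by positivity)]
    calc 2 * Real.log (2 * D / δ) * (8 * M ^ 2)
        ≤ M ^ 2 * Real.log (2 * D / δ) * (1024 / (μ * ε)) * (μ * ε / 2 ^ 2) := by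
          have : M ^ 2 * Real.log (2 * D / δ) * (1024 / (μ * ε)) * (μ * ε / 2 ^ 2) =
            256 * (M ^ 2 * Real.log (2 * D / δ)) := by field_simp; ring
          rw [this]
          nlinarith [mul_nonneg (sq_nonneg M) hl]
      _ ≤ _ := by gcongr
  have h2 : Real.exp (-(k * (Real.sqrt (μ * ε) / 2) ^ 2 / (8 * M ^ 2))) ≤ (δ / (2 * D)) ^ 2 := by
    calc _ ≤ Real.exp (2 * -Real.log (2 * D / δ)) := Real.exp_le_exp.2 (by linarith)
      _ = (δ / (2 * D)) ^ 2 := by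
        rw [← Real.log_inv, inv_div, two_mul, Real.exp_add, Real.exp_log (by positivity), sq]
  have h3 : δ / (2 * D) ≤ δ / 2 := by gcongr; linarith
  have h4 : (δ / (2 * D)) ^ 2 ≤ (δ / 2) ^ 2 := by gcongr
  nlinarith

/-- The contraction over the prescribed number of iterations. -/
theorem one_sub_pow_mul_le {η μ Δ ε : ℝ} {T : ℕ} (hημ : 0 < η * μ) (hημ' : η * μ ≤ 2) (hΔ : 0 < Δ)
    (hε : 0 < ε) (hεΔ : ε ≤ Δ) (hT : numIterations η μ Δ ε ≤ T) :
    (1 - η * μ / 2) ^ T * Δ ≤ ε / 2 := by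
  have hl : 0 ≤ Real.log (2 * Δ / ε) := Real.log_nonneg (by rw [one_le_div hε]; linarith)
  have h1 : (1 - η * μ / 2) ^ T ≤ Real.exp (-(η * μ / 2)) ^ T :=
    pow_le_pow_left₀ (by linarith) (Real.one_sub_le_exp_neg _) T
  have h2 : Real.exp (-(η * μ / 2)) ^ T ≤ ε / (2 * Δ) := by
    rw [← Real.exp_nat_mul]
    have : Real.exp (-Real.log (2 * Δ / ε)) = ε / (2 * Δ) := by
      rw [← Real.log_inv, inv_div, Real.exp_log (by positivity)]
    rw [← this, Real.exp_le_exp]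
    have h3 : 8 / (η * μ) * Real.log (2 * Δ / ε) * (η * μ / 2) ≤ T * (η * μ / 2) := by
      unfold numIterations at hT
      gcongr
    have h4 : 8 / (η * μ) * Real.log (2 * Δ / ε) * (η * μ / 2) = 4 * Real.log (2 * Δ / ε) := by
      have := hημ.ne'
      generalize η * μ = a at this
      field_simp; ring
    linarith
  calc (1 - η * μ / 2) ^ T * Δ ≤ ε / (2 * Δ) * Δ := by gcongr; exact h1.trans h2
    _ = ε / 2 := by field_simp

namespace LQR

variable {m n : ℕ} {L : LQR m n} {K₀ Kstar : Policy m n}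

theorem gap_nonneg (hopt : L.IsOptimal Kstar) (hK₀ : K₀ ∈ L.domain) : 0 ≤ L.gap K₀ Kstar :=
  sub_nonneg.2 (hopt.realCost_le hK₀)

theorem mem_boundedSet_self (hopt : L.IsOptimal Kstar) (hK₀ : K₀ ∈ L.domain) :
    K₀ ∈ L.boundedSet K₀ Kstar := by
  have := gap_nonneg hopt hK₀
  refine ⟨hK₀, ?_⟩
  change L.gap K₀ Kstar ≤ _
  linarith

/-- A positive gap needs two distinct policies, hence a nonzero dimension. -/
theorem mul_pos_of_gap_pos (hgap : 0 < L.gap K₀ Kstar) : 0 < m * n := by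
  rw [← finrank_policy]
  have hne : K₀ ≠ Kstar := by
    rintro rfl
    simp [gap] at hgap
  have : Nontrivial (Policy m n) := ⟨⟨_, _, hne⟩⟩
  exact Module.finrank_pos

theorem isClosed_boundedSet (hopt : L.IsOptimal Kstar) (hK₀ : K₀ ∈ L.domain) :
    IsClosed (L.boundedSet K₀ Kstar) := by
  rw [L.boundedSet_eq hopt hK₀]
  exact (L.isCompact_cost_le _).isClosed

variable {φ lam ρ : ℝ}

/-- Around policies no worse than `K₀`, the smoothing ball stays in the domain, with bounded
cost. -/
theorem closedBall_cost_le (hopt : L.IsOptimal Kstar) (hK₀ : K₀ ∈ L.domain) (hlam : 0 ≤ lam)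
    (hlip : ∀ K ∈ L.boundedSet K₀ Kstar, IsLocallyLipschitzAt L.realCost L.domain lam ρ K)
    {r : ℝ} (hrρ : r ≤ ρ) (hrρ' : r ≤ 1 / ρ) {K : Policy m n} (hK : K ∈ L.domain)
    (hKK₀ : L.realCost K ≤ L.realCost K₀) :
    K ∈ L.boundedSet K₀ Kstar ∧ ∀ y ∈ Metric.closedBall K r,
      y ∈ L.domain ∧ L.realCost y ≤ 10 * L.realCost K₀ + lam / ρ := by
  have hgap := gap_nonneg hopt hK₀
  have hKG : K ∈ L.boundedSet K₀ Kstar := by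
    refine ⟨hK, ?_⟩
    have : L.realCost K - L.realCost Kstar ≤ L.gap K₀ Kstar := by unfold gap; linarith
    linarith
  refine ⟨hKG, fun y hy => ?_⟩
  rw [Metric.mem_closedBall, dist_eq_norm] at hy
  have hyd := L.mem_domain_of_locallyLipschitz hK hlam (hlip K hKG) (hy.trans hrρ)
  refine ⟨hyd, ?_⟩
  have h1 := (abs_le.1 (hlip K hKG y hyd (hy.trans hrρ))).2
  -- The constraint `r ≤ 1 / ρ` is what yields the term `λ / ρ` in the batch size.
  have h2 : lam * ‖y - K‖ ≤ lam * (1 / ρ) := by gcongr; exact hy.trans hrρ'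
  have h3 := L.realCost_nonneg K₀
  rw [mul_one_div] at h2
  linarith

/-- At every policy no worse than `K₀`, the minibatch error exceeds `√(μ ε / 2)` with probability
at most `δ / 2`. -/
theorem measure_minibatch_error_le (hopt : L.IsOptimal Kstar) (hK₀ : K₀ ∈ L.domain)
    (hD : 0 < m * n) (hφ : 0 < φ) (hlam : 0 < lam) (hρ : 0 < ρ)
    (hsm : ∀ K ∈ L.boundedSet K₀ Kstar, HasLocallyLipschitzGradientAt L.realCost L.domain φ ρ K)
    (hlip : ∀ K ∈ L.boundedSet K₀ Kstar, IsLocallyLipschitzAt L.realCost L.domain lam ρ K)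
    {μ ε r δ θ : ℝ} (hμ : 0 < μ) (hε : 0 < ε) (hr : 0 < r) (hrmax : r ≤ maxRadius φ ρ θ μ ε)
    (hδ : 0 < δ) (hδ' : δ < 1) {k : ℕ}
    (hk : batchSize L.Cm ((m * n : ℕ) : ℝ) (L.realCost K₀) lam ρ μ r δ ε ≤ k)
    {Ω : Type*} [MeasurableSpace Ω] {P : Measure Ω} [IsProbabilityMeasure P]
    {Z : ℕ → Ω → Policy m n × LQRState m} (hZ : ∀ i, Measurable (Z i)) (hind : iIndepFun Z P)
    (hlaw : ∀ i, P.map (Z i) = (unifSphere m n).prod L.init) {K : Policy m n} (hK : K ∈ L.domain)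
    (hKK₀ : L.realCost K ≤ L.realCost K₀) :
    P {ω | Real.sqrt (μ * ε / 2) < ‖L.minibatchEstimate r k K (fun i => (Z i ω).1)
      (fun i => (Z i ω).2) - gradient L.realCost K‖} ≤ ENNReal.ofReal (δ / 2) := by
  have hrρ : r ≤ ρ := hrmax.trans ((min_le_left _ _).trans (min_le_left _ _))
  have hrρ' : r ≤ 1 / ρ := hrmax.trans ((min_le_left _ _).trans (min_le_right _ _))
  obtain ⟨hKG, hball⟩ := closedBall_cost_le hopt hK₀ hlam.le hlip hrρ hrρ' hK hKK₀
  have hD1 : (1 : ℝ) ≤ ((m * n : ℕ) : ℝ) := by exact_mod_cast hD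
  have hcb : 0 < 10 * L.realCost K₀ + lam / ρ := by
    have := L.realCost_nonneg K₀
    positivity
  have hCm : 0 < L.Cm := by
    refine lt_of_lt_of_le ?_ L.natCast_le_Cm
    exact_mod_cast Nat.pos_of_mul_pos_right hD
  have hM : 0 < L.Cm * (((m * n : ℕ) : ℝ) / r) * (10 * L.realCost K₀ + lam / ρ) := by positivity
  have hk0 : 0 < k := by
    have hl : 0 < Real.log (2 * ((m * n : ℕ) : ℝ) / δ) :=
      Real.log_pos (by rw [lt_div_iff₀ hδ]; linarith)
    have : (0 : ℝ) < k := by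
      refine lt_of_lt_of_le ?_ hk
      unfold batchSize
      positivity
    exact_mod_cast this
  have h := measureReal_minibatch_error_le hD hr hφ.le hball (fun y hy => by
    refine hsm K hKG y (hball y hy).1 ?_
    rw [Metric.mem_closedBall, dist_eq_norm] at hy
    exact hy.trans hrρ) hZ hind hlaw hcb (t := Real.sqrt (μ * ε) / 2) (by positivity) hk0
  rw [← ofReal_measureReal]
  refine ENNReal.ofReal_le_ofReal (le_trans ?_ (h.trans (two_mul_exp_le hM hD1 hμ hε hδ hδ' hk)))
  refine measureReal_mono fun ω hω => ?_
  exact (smoothing_error_le hφ hμ hε hrmax).trans_lt hω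

/-- If all minibatch errors along the trajectory are small, the trajectory remains below its
initial cost and its last iterate is `ε`-optimal. -/
theorem iterate_mem_of_estimate_error_le (hopt : L.IsOptimal Kstar) (hK₀ : K₀ ∈ L.domain)
    (hφ : 0 < φ) (hρ : 0 < ρ)
    (hsm : ∀ K ∈ L.boundedSet K₀ Kstar, HasLocallyLipschitzGradientAt L.realCost L.domain φ ρ K)
    {μ η ε r : ℝ} (hPL : IsPL L.realCost L.domain (L.realCost Kstar) μ) (hη : 0 < η)
    (hφη : φ * η ≤ 1 / 8) (hε : 0 < ε) (hεgap : ε ≤ L.gap K₀ Kstar) {k T : ℕ}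
    (hT : numIterations η μ (L.gap K₀ Kstar) ε ≤ T)
    {U : ℕ → ℕ → Policy m n} {S : ℕ → ℕ → LQRState m}
    (herr : ∀ t < T, L.iterate η r k K₀ U S t ∈ L.domain →
      L.realCost (L.iterate η r k K₀ U S t) ≤ L.realCost K₀ →
      ‖L.minibatchEstimate r k (L.iterate η r k K₀ U S t) (U t) (S t) -
        gradient L.realCost (L.iterate η r k K₀ U S t)‖ ≤ Real.sqrt (μ * ε / 2)) :
    (∀ t ≤ T, L.iterate η r k K₀ U S t ∈ L.domain ∧
      L.realCost (L.iterate η r k K₀ U S t) ≤ L.realCost K₀) ∧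
    L.realCost (L.iterate η r k K₀ U S T) ≤ L.realCost Kstar + ε := by
  have hgap : 0 < L.gap K₀ Kstar := hε.trans_le hεgap
  have hμ := hPL.1
  have hsm' : ∀ x ∈ L.domain, L.realCost x - L.realCost Kstar ≤ 10 * L.gap K₀ Kstar →
      ∀ y ∈ L.domain, ‖y - x‖ ≤ ρ →
        ‖gradient L.realCost y - gradient L.realCost x‖ ≤ φ * ‖y - x‖ :=
    fun x hx hx' => hsm x ⟨hx, hx'⟩
  have hd : ∀ x ∈ L.domain, DifferentiableAt ℝ L.realCost x := fun x hx =>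
    L.differentiableAt_realCost hx
  have hclosed := isClosed_boundedSet hopt hK₀
  have hμφ : μ ≤ 2 * φ := pl_constant_le L.isOpen_domain hd hclosed hφ hρ hsm' hK₀ hgap
    (by change L.gap K₀ Kstar < _; linarith) (fun y hy => hopt.realCost_le hy) (hPL.2 K₀ hK₀)
  have hle : ∀ x, L.realCost x - L.realCost Kstar ≤ L.gap K₀ Kstar ↔
      L.realCost x ≤ L.realCost K₀ := fun x => by unfold gap; constructor <;> intro <;> linarith
  have hmain := inexact_gradient_descent L.isOpen_domain hd hclosed hφ hρ hsm' hμ hη hφη hμφ hε hεgap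
    (by linarith) hPL.2 (x := L.iterate η r k K₀ U S)
    (g := fun t => L.minibatchEstimate r k (L.iterate η r k K₀ U S t) (U t) (S t))
    (fun t => rfl) hK₀ le_rfl (T := T) (fun t ht h1 h2 => by
      have h3 := herr t ht h1 ((hle _).1 h2)
      calc _ ≤ Real.sqrt (μ * ε / 2) ^ 2 := by gcongr
        _ = _ := Real.sq_sqrt (by positivity))
  refine ⟨fun t ht => ⟨(hmain t ht).1, (hle _).1 (hmain t ht).2.1⟩, ?_⟩
  have hημ : η * μ ≤ 2 := by nlinarith
  have h1 := one_sub_pow_mul_le (T := T) (mul_pos hη hμ) hημ hgap hε hεgap hT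
  have h2 := (hmain T le_rfl).2.2
  linarith

/-- The high-probability guarantee of the minibatch algorithm. -/
theorem achieves_of_isValid (hopt : L.IsOptimal Kstar) (hK₀ : K₀ ∈ L.domain)
    {c : CurvatureParams m n} {G : Set (Policy m n)} (hG : G = L.boundedSet K₀ Kstar)
    (hc : c.IsValid L G) {μ : ℝ} (hPL : IsPL L.realCost L.domain (L.realCost Kstar) μ)
    {η : ℝ} (hη : 0 < η) (hη' : η ≤ maxStepSize (c.phi G) (c.lambda G) (c.rho G) μ)
    {ε : ℝ} (hε : 0 < ε) (hε' : ε < maxTolerance (c.rho G) μ (L.gap K₀ Kstar))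
    {r : ℝ} (hr : 0 < r) (hr' : r ≤ maxRadius (c.phi G) (c.rho G) (c.theta G) μ ε)
    {δ : ℝ} (hδ : 0 < δ) (hδ' : δ < 1) {k T : ℕ}
    (hk : batchSize L.Cm ((m * n : ℕ) : ℝ) (L.realCost K₀) (c.lambda G) (c.rho G) μ r δ ε ≤ k)
    (hT : numIterations η μ (L.gap K₀ Kstar) ε ≤ T) :
    LQR.Achieves.{u} L K₀ Kstar η r k T ε (1 - T * δ) := by
  subst hG
  set G := L.boundedSet K₀ Kstar
  have hG : G.Nonempty := ⟨K₀, mem_boundedSet_self hopt hK₀⟩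
  have hφ := hc.phi_pos hG
  have hlam := hc.lambda_pos hG
  have hρ := hc.rho_pos
  have hμ := hPL.1
  have hgap0 := gap_nonneg hopt hK₀
  have hεgap : ε ≤ L.gap K₀ Kstar := by
    have : maxTolerance (c.rho G) μ (L.gap K₀ Kstar) ≤ 1 * (L.gap K₀ Kstar / 10) := by
      unfold maxTolerance; gcongr; exact min_le_left _ _
    linarith
  have hgap : 0 < L.gap K₀ Kstar := hε.trans_le hεgap
  have hD := mul_pos_of_gap_pos hgap
  have hφη : c.phi G * η ≤ 1 / 8 := by
    calc c.phi G * η ≤ c.phi G * (1 / (8 * c.phi G)) := by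
          gcongr; exact hη'.trans ((min_le_right _ _).trans (min_le_left _ _))
      _ = 1 / 8 := by field_simp
  have hT0 : (0 : ℝ) < T := by
    refine lt_of_lt_of_le ?_ hT
    have : 0 < Real.log (2 * L.gap K₀ Kstar / ε) :=
      Real.log_pos (by rw [lt_div_iff₀ hε]; linarith)
    unfold numIterations
    positivity
  intro Ω _ P _ U S hUS
  obtain ⟨hlaw, hind⟩ := hUS
  have hae := fun p : ℕ × ℕ => (hlaw p.1 p.2).aemeasurable
  -- The samples are only almost everywhere measurable; a measurable modification of each leaves
  -- their laws and independence unchanged.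
  set Z : ℕ × ℕ → Ω → Policy m n × LQRState m := fun p => (hae p).mk _ with hZdef
  have hZ : ∀ p, Measurable (Z p) := fun p => (hae p).measurable_mk
  have hZeq : ∀ p : ℕ × ℕ, (fun ω => (U p.1 p.2 ω, S p.1 p.2 ω)) =ᵐ[P] Z p :=
    fun p => (hae p).ae_eq_mk
  have hZind : iIndepFun Z P := hind.congr hZeq
  have hZlaw : ∀ p, P.map (Z p) = (unifSphere m n).prod L.init := fun p => by
    rw [← Measure.map_congr (hZeq p)]; exact (hlaw p.1 p.2).map_eq
  have hZnorm : ∀ p, ∀ᵐ ω ∂P, ‖(Z p ω).1‖ = 1 := by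
    intro p
    have := L.init_prob
    refine ae_of_ae_map (hZ p).aemeasurable (p := fun z => ‖z.1‖ = 1) ?_
    rw [hZlaw p]
    exact Measure.quasiMeasurePreserving_fst.ae ae_norm_eq_one_unifSphere
  have hgood : ∀ᵐ ω ∂P, ∀ p : ℕ × ℕ, (U p.1 p.2 ω, S p.1 p.2 ω) = Z p ω ∧ ‖(Z p ω).1‖ = 1 :=
    ae_all_iff.2 fun p => (hZeq p).and (hZnorm p)
  set A : Set (Policy m n) := {K | K ∈ L.domain ∧ L.realCost K ≤ L.realCost K₀} with hAdef
  have hA : MeasurableSet A := by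
    have : A = {K | L.cost K ≤ ENNReal.ofReal (L.realCost K₀)} := by
      ext K
      exact L.mem_domain_and_realCost_le_iff (L.realCost_nonneg K₀)
    rw [this]
    exact (L.isCompact_cost_le _).isClosed.measurableSet
  set Bad : ℕ → Set Ω := fun t => {ω | L.trajectory η r k K₀ Z ω t ∈ A ∧
    Real.sqrt (μ * ε / 2) < ‖L.trajectoryEstimate η r k K₀ Z ω t -
      gradient L.realCost (L.trajectory η r k K₀ Z ω t)‖} with hBad
  have hBadle : ∀ t, P (Bad t) ≤ ENNReal.ofReal (δ / 2) := by
    intro t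
    refine L.measure_stage_error_le hZ hZind η r k K₀ t hA fun K hK => ?_
    exact measure_minibatch_error_le hopt hK₀ hD hφ hlam hρ
      (fun K hK => hc.hasLocallyLipschitzGradientAt hK) (fun K hK => hc.isLocallyLipschitzAt hK)
      hμ hε hr hr' hδ hδ' hk (Z := fun i => Z (t, i)) (fun i => hZ _)
      (hZind.precomp (g := fun i => (t, i)) fun i j h => (Prod.mk.inj h).2) (fun i => hZlaw _)
      hK.1 hK.2
  set Event : Set Ω := {ω |
      (∀ t < T, ∀ i < k, L.sampleCost
        (L.iterate η r k K₀ (fun t i => U t i ω) (fun t i => S t i ω) t + r • U t i ω)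
        (S t i ω) < ∞) ∧
      L.cost (L.iterate η r k K₀ (fun t i => U t i ω) (fun t i => S t i ω) T)
        ≤ L.cost Kstar + ENNReal.ofReal ε} with hEvent
  set N : Set Ω := {ω | ¬ ∀ p : ℕ × ℕ, (U p.1 p.2 ω, S p.1 p.2 ω) = Z p ω ∧ ‖(Z p ω).1‖ = 1}
    with hN
  -- Covering the whole space needs only subadditivity, so measurability of the success event is
  -- never required.
  have hcover : (Set.univ : Set Ω) ⊆ Event ∪ (N ∪ ⋃ t ∈ Finset.range T, Bad t) := by
    intro ω _
    by_cases hωN : ω ∈ N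
    · exact Or.inr (Or.inl hωN)
    by_cases hωB : ω ∈ ⋃ t ∈ Finset.range T, Bad t
    · exact Or.inr (Or.inr hωB)
    refine Or.inl ?_
    have hω : ∀ p : ℕ × ℕ, (U p.1 p.2 ω, S p.1 p.2 ω) = Z p ω ∧ ‖(Z p ω).1‖ = 1 := not_not.1 hωN
    have hU : (fun t i => U t i ω) = fun t i => (Z (t, i) ω).1 := by
      funext t i; rw [← (hω (t, i)).1]
    have hS : (fun t i => S t i ω) = fun t i => (Z (t, i) ω).2 := by
      funext t i; rw [← (hω (t, i)).1]
    have hUn : ∀ t i, ‖U t i ω‖ = 1 := fun t i => by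
      have := (hω (t, i)).2
      rwa [← (hω (t, i)).1] at this
    have hsmall : ∀ t < T, L.trajectory η r k K₀ Z ω t ∈ L.domain →
        L.realCost (L.trajectory η r k K₀ Z ω t) ≤ L.realCost K₀ →
        ‖L.trajectoryEstimate η r k K₀ Z ω t -
          gradient L.realCost (L.trajectory η r k K₀ Z ω t)‖ ≤ Real.sqrt (μ * ε / 2) := by
      intro t ht h1 h2
      by_contra! h3
      exact hωB (Set.mem_biUnion (Finset.mem_coe.2 (Finset.mem_range.2 ht)) ⟨⟨h1, h2⟩, h3⟩)
    obtain ⟨hmem, hlast⟩ := iterate_mem_of_estimate_error_le hopt hK₀ hφ hρ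
      (fun K hK => hc.hasLocallyLipschitzGradientAt hK) hPL hη hφη hε hεgap hT hsmall
    rw [← hU, ← hS] at hmem hlast
    have hrρ : r ≤ c.rho G := hr'.trans ((min_le_left _ _).trans (min_le_left _ _))
    have hrρ' : r ≤ 1 / c.rho G := hr'.trans ((min_le_left _ _).trans (min_le_right _ _))
    refine ⟨fun t ht i _ => L.sampleCost_lt_top ?_ _, ?_⟩
    · refine ((closedBall_cost_le hopt hK₀ hlam.le (fun K hK => hc.isLocallyLipschitzAt hK)
        hrρ hrρ' (hmem t ht.le).1 (hmem t ht.le).2).2 _ ?_).1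
      rw [Metric.mem_closedBall, dist_eq_norm, add_sub_cancel_left, norm_smul, hUn,
        Real.norm_of_nonneg hr.le, mul_one]
    · rw [L.cost_eq_ofReal (hmem T le_rfl).1, L.cost_eq_ofReal (hopt.mem_domain hK₀),
        ← ENNReal.ofReal_add (L.realCost_nonneg _) hε.le]
      exact ENNReal.ofReal_le_ofReal hlast
  have hN0 : P N = 0 := hgood
  have hNB : P.real (N ∪ ⋃ t ∈ Finset.range T, Bad t) ≤ T * (δ / 2) := by
    rw [Measure.real]
    refine ENNReal.toReal_le_of_le_ofReal (by positivity) ?_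
    calc P (N ∪ ⋃ t ∈ Finset.range T, Bad t)
        ≤ P N + ∑ t ∈ Finset.range T, P (Bad t) :=
          (measure_union_le _ _).trans (by gcongr; exact measure_biUnion_finset_le _ _)
      _ ≤ 0 + ∑ t ∈ Finset.range T, ENNReal.ofReal (δ / 2) := by
          rw [hN0]; gcongr; exact hBadle _
      _ = ENNReal.ofReal (T * (δ / 2)) := by
          rw [zero_add, Finset.sum_const, Finset.card_range, nsmul_eq_mul,
            ENNReal.ofReal_mul hT0.le, ENNReal.ofReal_natCast]
  have htot : (1 : ℝ) ≤ P.real Event + P.real (N ∪ ⋃ t ∈ Finset.range T, Bad t) := by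
    calc (1 : ℝ) = P.real Set.univ := by simp
      _ ≤ P.real (Event ∪ (N ∪ ⋃ t ∈ Finset.range T, Bad t)) := measureReal_mono hcover
      _ ≤ _ := measureReal_union_le _ _
  -- The spare factor 2 in the stage bound makes the final inequality strict, since `T > 0`.
  have : (T : ℝ) * (δ / 2) < T * δ := by gcongr; linarith
  linarith

end LQR
end

noncomputable section

open scoped Topology NNReal
open Filter

/-! ### The number of evaluations -/

theorem maxRadius_pos {φ ρ θ μ ε : ℝ} (hφ : 0 < φ) (hρ : 0 < ρ) (hθ : 0 < θ) (hμ : 0 < μ)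
    (hε : 0 < ε) : 0 < maxRadius φ ρ θ μ ε := by
  unfold maxRadius
  have : 0 < min 1 (1 / φ) := lt_min one_pos (by positivity)
  refine lt_min (lt_min hρ (by positivity)) (mul_pos (by positivity) (lt_min ?_ ?_)) <;> positivity

/-- The admissible radii scale at least like `√ε`. -/
theorem sqrt_mul_maxRadius_one_le {φ ρ θ μ ε : ℝ} (hρ : 0 < ρ) (hε : 0 < ε)
    (hε' : ε ≤ 1) : Real.sqrt ε * maxRadius φ ρ θ μ 1 ≤ maxRadius φ ρ θ μ ε := by
  have hs : Real.sqrt ε ≤ 1 := Real.sqrt_le_one.2 hε'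
  have h1 : Real.sqrt (ε / 240) = Real.sqrt ε * Real.sqrt (1 / 240) := by
    rw [← Real.sqrt_mul hε.le, mul_one_div]
  have h2 : Real.sqrt (ε * μ / 30) = Real.sqrt ε * Real.sqrt (1 * μ / 30) := by
    rw [← Real.sqrt_mul hε.le]; congr 1; ring
  unfold maxRadius
  rw [mul_min_of_nonneg _ _ (Real.sqrt_nonneg ε), h1, h2]
  refine min_le_min ?_ (le_of_eq ?_)
  · have : 0 < min ρ (1 / ρ) := lt_min hρ (by positivity)
    nlinarith
  · rw [mul_left_comm, mul_min_of_nonneg _ _ (Real.sqrt_nonneg ε)]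
    congr 2 <;> ring

/-- With radius `a √ε`, the batch size is of order `ε⁻² log (1 / δ)`. -/
theorem batchSize_sqrt_mul {Cm D c₀ lam ρ μ a δ ε : ℝ} (hε : 0 < ε)
    (hl : 0 ≤ Real.log (2 * D / δ)) :
    batchSize Cm D c₀ lam ρ μ (Real.sqrt ε * a) δ ε =
      (Cm * (D / a) * (10 * c₀ + lam / ρ)) ^ 2 * (1024 / μ) * (1 / ε ^ 2) *
        Real.log (2 * D / δ) := by
  unfold batchSize
  rw [mul_pow, Real.sq_sqrt hl]
  have h1 : (D / (Real.sqrt ε * a)) ^ 2 = (D / a) ^ 2 * (1 / ε) := by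
    rw [div_pow, mul_pow, Real.sq_sqrt hε.le, div_pow, div_mul_div_comm, mul_one, mul_comm ε]
  calc (Cm * (D / (Real.sqrt ε * a)) * (10 * c₀ + lam / ρ)) ^ 2 * Real.log (2 * D / δ) *
        (1024 / (μ * ε))
      = Cm ^ 2 * (D / (Real.sqrt ε * a)) ^ 2 * (10 * c₀ + lam / ρ) ^ 2 * Real.log (2 * D / δ) *
        (1024 / (μ * ε)) := by ring
    _ = _ := by rw [h1, one_div, one_div, div_eq_mul_inv 1024, mul_inv, div_eq_mul_inv 1024]; ring

/-- If `N ≤ a log (b / ε)` iterations are run with batches of size `B ε⁻² log (D N / δ)`, the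
total number of evaluations is of order `ε⁻²` up to logarithms. -/
theorem exists_evaluations_le {B D a b : ℝ} (hB : 0 ≤ B) (hD : 1 ≤ D) (ha : 0 < a) (hb : 0 < b) :
    ∃ C > (0 : ℝ), ∃ ε₀ > (0 : ℝ), ε₀ ≤ 1 ∧ ∀ ε : ℝ, 0 < ε → ε < ε₀ → ε ≤ b →
      ∀ δ : ℝ, 0 < δ → δ < 1 →
      (⌈B * (1 / ε ^ 2) * Real.log (D * ⌈a * Real.log (b / ε)⌉₊ / δ)⌉₊ : ℝ) *
        ⌈a * Real.log (b / ε)⌉₊ ≤ C * (1 / ε ^ 2) * Real.log (1 / ε) *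
          (Real.log (Real.log (1 / ε)) + Real.log (1 / δ)) := by
  set c₁ : ℝ := a * (|Real.log b| + 1) + 1 with hc₁
  have hc₁1 : 1 ≤ c₁ := by
    have : 0 ≤ a * (|Real.log b| + 1) := by positivity
    linarith
  set c₂ : ℝ := Real.log (D * c₁) with hc₂
  have hc₂0 : 0 ≤ c₂ := Real.log_nonneg (one_le_mul_of_one_le_of_one_le hD hc₁1)
  -- Below `exp (-e)` both `log (1 / ε)` and its logarithm are at least one, so ceilings and
  -- additive constants can be absorbed into products.
  refine ⟨(B * (c₂ + 1) + 1) * c₁, by positivity, Real.exp (-Real.exp 1), Real.exp_pos _,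
    Real.exp_le_one_iff.2 (by have := Real.exp_pos 1; linarith), ?_⟩
  intro ε hε hε₀ hεb δ hδ hδ'
  set l := Real.log (1 / ε) with hl
  have hle : Real.exp 1 ≤ l := by
    rw [hl, one_div, Real.log_inv, le_neg, ← Real.log_exp (-Real.exp 1)]
    exact Real.log_le_log hε hε₀.le
  have hl0 : 0 < l := (Real.exp_pos 1).trans_le hle
  have hl1 : 1 ≤ l := (Real.one_le_exp zero_le_one).trans hle
  have hll : 1 ≤ Real.log l := by
    rw [← Real.log_exp 1]
    exact Real.log_le_log (Real.exp_pos 1) hle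
  have hlδ : 0 ≤ Real.log (1 / δ) := Real.log_nonneg (by rw [one_le_div hδ]; exact hδ'.le)
  set X := Real.log l + Real.log (1 / δ) with hX
  have hX1 : 1 ≤ X := by linarith
  have hlog : Real.log (b / ε) = Real.log b + l := by
    rw [div_eq_mul_one_div, Real.log_mul hb.ne' (by positivity)]
  have hlog0 : 0 ≤ Real.log (b / ε) := Real.log_nonneg (by rwa [one_le_div hε])
  set T : ℝ := (⌈a * Real.log (b / ε)⌉₊ : ℝ) with hT
  have hT0 : 0 ≤ T := by positivity
  have hTle : T ≤ c₁ * l := by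
    have h1 : T ≤ a * Real.log (b / ε) + 1 := (Nat.ceil_lt_add_one (by positivity)).le
    have h2 : Real.log (b / ε) ≤ (|Real.log b| + 1) * l := by
      rw [hlog]
      nlinarith [le_abs_self (Real.log b), abs_nonneg (Real.log b)]
    have h3 := mul_le_mul_of_nonneg_left h2 ha.le
    rw [hc₁]
    nlinarith
  have hε1 : 1 ≤ 1 / ε ^ 2 := by
    have hε1 : ε ≤ 1 := hε₀.le.trans (Real.exp_le_one_iff.2 (by have := Real.exp_pos 1; linarith))
    rw [one_le_div (by positivity)]
    exact pow_le_one₀ hε.le hε1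
  have hlogT : Real.log (D * T / δ) ≤ (c₂ + 1) * X := by
    rcases hT0.eq_or_lt with h0 | h0
    · rw [← h0, mul_zero, zero_div, Real.log_zero]
      positivity
    · calc Real.log (D * T / δ) ≤ Real.log (D * c₁ * (l * (1 / δ))) := by
            refine Real.log_le_log (by positivity) ?_
            rw [div_eq_mul_one_div, ← mul_assoc, mul_assoc D c₁ l]
            gcongr
        _ = c₂ + X := by
            rw [Real.log_mul (x := D * c₁) (by positivity) (by positivity),
              Real.log_mul hl0.ne' (by positivity)]
        _ ≤ (c₂ + 1) * X := by nlinarith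
  set k : ℝ := (⌈B * (1 / ε ^ 2) * Real.log (D * T / δ)⌉₊ : ℝ) with hk
  have hkle : k ≤ (B * (c₂ + 1) + 1) * (1 / ε ^ 2) * X := by
    have h1 : k ≤ (⌈B * (1 / ε ^ 2) * ((c₂ + 1) * X)⌉₊ : ℝ) := by
      rw [hk]
      gcongr
    have h2 : (⌈B * (1 / ε ^ 2) * ((c₂ + 1) * X)⌉₊ : ℝ) ≤ B * (1 / ε ^ 2) * ((c₂ + 1) * X) + 1 :=
      (Nat.ceil_lt_add_one (by positivity)).le
    nlinarith
  calc k * T ≤ (B * (c₂ + 1) + 1) * (1 / ε ^ 2) * X * (c₁ * l) := by gcongr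
    _ = _ := by ring

namespace LQR

variable {m n : ℕ} {L : LQR m n} {K₀ Kstar : Policy m n}

/-- With a fixed step size, `Õ(ε⁻²)` evaluations suffice. -/
theorem exists_evaluations_achieves (hopt : L.IsOptimal Kstar) (hK₀ : K₀ ∈ L.domain)
    {c : CurvatureParams m n} {G : Set (Policy m n)} (hG : G = L.boundedSet K₀ Kstar)
    (hc : c.IsValid L G) {μ : ℝ} (hPL : IsPL L.realCost L.domain (L.realCost Kstar) μ)
    {η : ℝ} (hη : 0 < η) (hη' : η ≤ maxStepSize (c.phi G) (c.lambda G) (c.rho G) μ) :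
    ∃ C > (0 : ℝ), ∃ ε₀ > (0 : ℝ), ∀ ε : ℝ, 0 < ε → ε < ε₀ →
      ε < maxTolerance (c.rho G) μ (L.gap K₀ Kstar) →
      ∀ δ : ℝ, 0 < δ → δ < 1 →
      ∃ (r : ℝ) (k T : ℕ),
        0 < r ∧ r ≤ maxRadius (c.phi G) (c.rho G) (c.theta G) μ ε ∧ 0 < T ∧
        batchSize L.Cm ((m * n : ℕ) : ℝ) (L.realCost K₀) (c.lambda G) (c.rho G) μ r
          (δ / (T : ℝ)) ε ≤ (k : ℝ) ∧
        numIterations η μ (L.gap K₀ Kstar) ε ≤ (T : ℝ) ∧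
        (k : ℝ) * (T : ℝ) ≤ C * (1 / ε ^ 2) * Real.log (1 / ε) *
          (Real.log (Real.log (1 / ε)) + Real.log (1 / δ)) ∧
        LQR.Achieves.{u} L K₀ Kstar η r k T ε (1 - δ) := by
  have hGne : G.Nonempty := ⟨K₀, hG ▸ mem_boundedSet_self hopt hK₀⟩
  have hφ := hc.phi_pos hGne
  have hlam := hc.lambda_pos hGne
  have hρ := hc.rho_pos
  have hμ := hPL.1
  have hθ : 0 < c.theta G := lt_min (by positivity) (by positivity)
  have hgap0 := gap_nonneg hopt hK₀
  have htol : maxTolerance (c.rho G) μ (L.gap K₀ Kstar) ≤ L.gap K₀ Kstar / 10 := by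
    have : maxTolerance (c.rho G) μ (L.gap K₀ Kstar) ≤ 1 * (L.gap K₀ Kstar / 10) := by
      unfold maxTolerance; gcongr; exact min_le_left _ _
    linarith
  rcases hgap0.eq_or_lt with hgap | hgap
  -- With zero gap the admissible range of `ε` is empty.
  · refine ⟨1, one_pos, 1, one_pos, fun ε hε _ hε' => ?_⟩
    linarith
  have hD : (1 : ℝ) ≤ ((m * n : ℕ) : ℝ) := by exact_mod_cast mul_pos_of_gap_pos hgap
  set a := maxRadius (c.phi G) (c.rho G) (c.theta G) μ 1
  have ha : 0 < a := maxRadius_pos hφ hρ hθ hμ one_pos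
  obtain ⟨C, hC, ε₀, hε₀, hε₀1, hmain⟩ := exists_evaluations_le
    (B := (L.Cm * (((m * n : ℕ) : ℝ) / a) * (10 * L.realCost K₀ + c.lambda G / c.rho G)) ^ 2 *
      (1024 / μ)) (D := 2 * ((m * n : ℕ) : ℝ)) (a := 8 / (η * μ)) (b := 2 * L.gap K₀ Kstar)
    (by positivity) (by linarith) (by positivity) (by positivity)
  refine ⟨C, hC, ε₀, hε₀, fun ε hε hεε₀ hεtol δ hδ hδ' => ?_⟩
  have hbound := hmain ε hε hεε₀ (by linarith) δ hδ hδ'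
  -- `T` does not involve the failure probability, so using `δ / T` in the batch size is not
  -- circular.
  set T : ℕ := ⌈8 / (η * μ) * Real.log (2 * L.gap K₀ Kstar / ε)⌉₊ with hTdef
  have hT : numIterations η μ (L.gap K₀ Kstar) ε ≤ T := Nat.le_ceil _
  have hTpos : 0 < T := by
    rw [hTdef, Nat.ceil_pos]
    have : 0 < Real.log (2 * L.gap K₀ Kstar / ε) :=
      Real.log_pos (by rw [lt_div_iff₀ hε]; linarith)
    positivity
  have hT1 : (1 : ℝ) ≤ T := by exact_mod_cast hTpos
  have hT0 : (0 : ℝ) < T := by linarith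
  have hδT : δ / T < 1 := (div_le_self hδ.le hT1).trans_lt hδ'
  have hδT0 : 0 < δ / T := by positivity
  have hr : 0 < Real.sqrt ε * a := by positivity
  have hr' : Real.sqrt ε * a ≤ maxRadius (c.phi G) (c.rho G) (c.theta G) μ ε :=
    sqrt_mul_maxRadius_one_le hρ hε (hεε₀.le.trans hε₀1)
  have hdiv : 2 * ((m * n : ℕ) : ℝ) / (δ / T) = 2 * ((m * n : ℕ) : ℝ) * T / δ := by
    rw [div_div_eq_mul_div]
  have hbatch := batchSize_sqrt_mul (Cm := L.Cm) (D := ((m * n : ℕ) : ℝ)) (c₀ := L.realCost K₀)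
    (lam := c.lambda G) (ρ := c.rho G) (μ := μ) (a := a) (δ := δ / T) hε
    (Real.log_nonneg (by rw [one_le_div hδT0]; linarith))
  rw [hdiv] at hbatch
  have hk := hbatch.trans_le (Nat.le_ceil _)
  refine ⟨_, _, T, hr, hr', hTpos, hk, hT, hbound, ?_⟩
  have := achieves_of_isValid.{u} hopt hK₀ hG hc hPL hη hη' hε hεtol hr hr' hδT0 hδT hk hT
  rwa [mul_div_cancel₀ _ hT0.ne'] at this

end LQR
end

/-! ### The main theorem -/

theorem mainTheorem6 {m n : ℕ} (L : LQR m n) (K₀ : Policy m n) (hK₀ : L.cost K₀ < ∞) :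
    (∃ Kstar, L.IsOptimal Kstar) ∧
    ∀ Kstar, L.IsOptimal Kstar →
      -- the cost is continuously differentiable on its domain, and the parameters in the
      -- guarantee exist
      (IsOpen L.domain ∧ ContDiffOn ℝ 1 L.realCost L.domain ∧
        (∃ c : CurvatureParams m n, c.IsValid L (L.boundedSet K₀ Kstar)) ∧
        ∃ μ, IsPL L.realCost L.domain (L.realCost Kstar) μ) ∧
      ∀ (c : CurvatureParams m n) (G : Set (Policy m n)), G = L.boundedSet K₀ Kstar →
        c.IsValid L G →
        ∀ μ : ℝ, IsPL L.realCost L.domain (L.realCost Kstar) μ →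
        ∀ η : ℝ, 0 < η → η ≤ maxStepSize (c.phi G) (c.lambda G) (c.rho G) μ →
          -- the high-probability guarantee
          (∀ ε : ℝ, 0 < ε → ε < maxTolerance (c.rho G) μ (L.gap K₀ Kstar) →
            ∀ r : ℝ, 0 < r → r ≤ maxRadius (c.phi G) (c.rho G) (c.theta G) μ ε →
            ∀ δ : ℝ, 0 < δ → δ < 1 →
            ∀ k T : ℕ,
              batchSize L.Cm ((m * n : ℕ) : ℝ) (L.realCost K₀) (c.lambda G) (c.rho G) μ r δ ε
                ≤ (k : ℝ) →
              numIterations η μ (L.gap K₀ Kstar) ε ≤ (T : ℝ) →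
              LQR.Achieves.{u} L K₀ Kstar η r k T ε (1 - (T : ℝ) * δ)) ∧
          -- the total number `k * T` of cost evaluations, with a step size not depending on `ε`
          (∃ C > (0 : ℝ), ∃ ε₀ > (0 : ℝ), ∀ ε : ℝ, 0 < ε → ε < ε₀ →
            ε < maxTolerance (c.rho G) μ (L.gap K₀ Kstar) →
            ∀ δ : ℝ, 0 < δ → δ < 1 →
            ∃ (r : ℝ) (k T : ℕ),
              0 < r ∧ r ≤ maxRadius (c.phi G) (c.rho G) (c.theta G) μ ε ∧ 0 < T ∧
              batchSize L.Cm ((m * n : ℕ) : ℝ) (L.realCost K₀) (c.lambda G) (c.rho G) μ r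
                (δ / (T : ℝ)) ε ≤ (k : ℝ) ∧
              numIterations η μ (L.gap K₀ Kstar) ε ≤ (T : ℝ) ∧
              (k : ℝ) * (T : ℝ) ≤ C * (1 / ε ^ 2) * Real.log (1 / ε) *
                (Real.log (Real.log (1 / ε)) + Real.log (1 / δ)) ∧
              LQR.Achieves.{u} L K₀ Kstar η r k T ε (1 - δ)) := by
  refine ⟨L.exists_isOptimal hK₀, fun Kstar hopt => ⟨⟨L.isOpen_domain, fun K hK => ?_,
    L.exists_isValid hopt hK₀, L.exists_isPL (hopt.mem_domain hK₀)⟩, ?_⟩⟩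
  · exact ((L.contDiffAt_realCost hK).of_le le_top).contDiffWithinAt
  intro c G hG hc μ hPL η hη hη'
  refine ⟨fun ε hε hε' r hr hr' δ hδ hδ' k T hk hT => ?_, ?_⟩
  · exact LQR.achieves_of_isValid hopt hK₀ hG hc hPL hη hη' hε hε' hr hr' hδ hδ' hk hT
  · exact LQR.exists_evaluations_achieves hopt hK₀ hG hc hPL hη hη'
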